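/- Let $k\ge 2$, $d\ge 1$, $M\ge 0$ be integers, $w_1,\dots,w_k>0$, $W=\prod_{t=1}^k w_t$, $\delta>0$. Let $\mathcal A_1=\dots=\mathcal A_k=\mathbb C^d$ and let $Q$ be a Hermitian operator on $\mathcal A_1\otimes\cdots\otimes\mathcal A_k$ with a given decomposition $Q=\sum_{i=1}^M Q^1_i\otimes\cdots\otimes Q^k_i$, where the $Q^t_i$ are operators on $\mathcal A_t$ with $\|Q^t_i\|_{op}\le w_t$. Write $\mathrm{OptSep}(Q)=\max \operatorname{Tr}\bigl(Q(\rho_1\otimes\cdots\otimes\rho_k)\bigr)$, the maximum being over all density operators $\rho_t$ on $\mathcal A_t$. For $t<k$ let $S_t=\{(\operatorname{Tr}(Q^t_1\rho),\dots,\operatorname{Tr}(Q^t_M\rho)) : \rho \text{ a density operator}\}\subseteq\mathbb C^M$ and $\epsilon_t=w_t\delta/((k-1)W)$. An admissible net for $t$ is a finite set $N_t\subseteq\{q\in\mathbb C^M:|q_i|\le w_t\text{ for all }i\}$ such that every point of $S_t$ has $\ell_1$ distance at most $\epsilon_t$ to some point of $N_t$ and every point of $N_t$ has $\ell_1$ distance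 at most $\epsilon_t$ to $S_t$. The enumeration algorithm generates admissible nets $N_1,\dots,N_{k-1}$, computes for every $q=(q^1,\dots,q^{k-1})\in N_1\times\cdots\times N_{k-1}$ the largest eigenvalue $\lambda_{\max}(q)$ of $\frac12(Q_q+Q_q^*)$, where $Q_q=\sum_{i=1}^M q^1_i\cdots q^{k-1}_i\,Q^k_i$, and returns the largest of these numbers. 1. (Correctness.) The maximum defining $\mathrm{OptSep}(Q)$ is attained, and for all admissible nets $N_1,\dots,N_{k-1}$ $$\Bigl|\max_{q\in N_1\times\cdots\times N_{k-1}}\lambda_{\max}(q)-\mathrm{OptSep}(Q)\Bigr|\le\delta .$$ 2. (Running time.) The algorithm can be carried out by a single program of a real random access machine (unit cost for the field operations and comparisons of real numbers, for addition, subtraction, multiplication and comparison of natural numbers used as indices, and for memory access; no rounding, no roots, no conversion of reals to indices). There are a program and absolute constants $C,c$ such that for every input $k,d,M,\delta,(w_t)_t,(Q^t_i)_{t,i}$ as above the program halts with admissible nets $N_1,\dots,N_{k-1}$ and a number $\mathrm{OPT}$ in its memory, where $$\Bigl|\mathrm{OPT}-\max_{q\in N_1\times\cdots\times N_{k-1}}\lambda_{\max}(q)\Bigr|\le\frac{\delta}{2}\quad\text{(the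 error allowed for the numerical computation of eigenvalues)},\qquad |\mathrm{OPT}-\mathrm{OptSep}(Q)|\le\delta,$$ after at most $$C\cdot\max\Bigl\{1,\;C\,\frac{(k-1)^2W^2M^2}{\delta^2}\Bigr\}^{(k-1)M}\cdot\Bigl(d+M+k+W+\frac1\delta\Bigr)^{c}$$ steps. Moreover this is quasi-polynomial time in $d$, $W$ and $1/\delta$ when $kM$ is polylogarithmic in $d$: for every $a\in\mathbb N$ there is $b\in\mathbb N$, depending on $a$ only, such that for all inputs with $M\ge1$ and $kM\le(\log(d+2))^a$ the number of steps is at most $\exp\bigl((\log(d+W+1/\delta+2))^{b}\bigr)$. -/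

import Mathlib

/-! ## Operators, density operators and the optimum over product states -/

/-- Operators on `A_1 ⊗ ⋯ ⊗ A_k`, each factor being `ℂ^d`, in the product basis, which is indexed
by the maps `Fin k → Fin d`. -/
abbrev MultiOp (k d : ℕ) : Type := Matrix (Fin k → Fin d) (Fin k → Fin d) ℂ

/-- The tensor (Kronecker) product `B_1 ⊗ ⋯ ⊗ B_k`. -/
def tensorOp {k d : ℕ} (B : Fin k → Matrix (Fin d) (Fin d) ℂ) : MultiOp k d :=
  Matrix.of fun a b => ∏ t, B t (a t) (b t)

/-- The operator norm for the Euclidean norm on `ℂ^d`. -/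
noncomputable def opNorm {d : ℕ} (B : Matrix (Fin d) (Fin d) ℂ) : ℝ :=
  ‖Matrix.toEuclideanCLM (n := Fin d) (𝕜 := ℂ) B‖

open scoped ComplexOrder in
/-- Density operators. -/
def IsDensity {d : ℕ} (ρ : Matrix (Fin d) (Fin d) ℂ) : Prop :=
  ρ.PosSemidef ∧ ρ.trace = 1

/-- All values `⟨Q, ρ_1 ⊗ ⋯ ⊗ ρ_k⟩ = Tr (Q (ρ_1 ⊗ ⋯ ⊗ ρ_k))` at product states (for Hermitian `Q`
the trace is a real number). -/
def productValues {k d : ℕ} (Q : MultiOp k d) : Set ℝ :=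
  {v | ∃ ρ : Fin k → Matrix (Fin d) (Fin d) ℂ,
    (∀ t, IsDensity (ρ t)) ∧ v = (Matrix.trace (Q * tensorOp ρ)).re}

/-- The optimum value `OptSep(Q)`. -/
noncomputable def optSep {k d : ℕ} (Q : MultiOp k d) : ℝ := sSup (productValues Q)

/-- `Q = ∑_{i=1}^M A^1_i ⊗ ⋯ ⊗ A^k_i` with `‖A^t_i‖_op ≤ w_t`. -/
def IsDecomposition {k d M : ℕ} (w : Fin k → ℝ)
    (A : Fin k → Fin M → Matrix (Fin d) (Fin d) ℂ) (Q : MultiOp k d) : Prop :=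
  Q = ∑ i, tensorOp (fun t => A t i) ∧ ∀ t i, opNorm (A t i) ≤ w t

/-! ## The nets -/

/-- The vector `(Tr (B_1 ρ), …, Tr (B_M ρ))`. -/
def qVec {d M : ℕ} (B : Fin M → Matrix (Fin d) (Fin d) ℂ) (ρ : Matrix (Fin d) (Fin d) ℂ) :
    Fin M → ℂ :=
  fun i => Matrix.trace (B i * ρ)

/-- The set of the vectors `qVec B ρ` over all density operators `ρ`. -/
def qSpace {d M : ℕ} (B : Fin M → Matrix (Fin d) (Fin d) ℂ) : Set (Fin M → ℂ) :=
  {q | ∃ ρ, IsDensity ρ ∧ q = qVec B ρ}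

/-- The `ℓ_1` distance on `ℂ^M`. -/
noncomputable def l1Dist {M : ℕ} (p q : Fin M → ℂ) : ℝ := ∑ i, ‖p i - q i‖

/-- The `ℓ_1` distance of `p` to `qSpace B`. -/
noncomputable def dis {d M : ℕ} (B : Fin M → Matrix (Fin d) (Fin d) ℂ) (p : Fin M → ℂ) : ℝ :=
  sInf (l1Dist p '' qSpace B)

/-- `N` is a finite `ε`-net of `(qSpace B, ℓ_1)`, made of points of the raw set
`{q : |q_i| ≤ w}` that have passed the selection `dis ≤ ε`. -/
structure IsSelectedNet {d M : ℕ} (B : Fin M → Matrix (Fin d) (Fin d) ℂ) (w ε : ℝ)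
    (N : Finset (Fin M → ℂ)) : Prop where
  raw : ∀ q ∈ N, ∀ i, ‖q i‖ ≤ w
  covers : ∀ p ∈ qSpace B, ∃ q ∈ N, l1Dist p q ≤ ε
  selected : ∀ q ∈ N, dis B q ≤ ε

/-! ## The enumeration algorithm, with exact arithmetic

The number of parties is `k = m + 1`; the nets belong to the first `m = k - 1` of them. -/

/-- The net precisions `ε_t = w_t δ / ((k - 1) W)`, `W = ∏ w_t`. -/
noncomputable def netEps {m : ℕ} (w : Fin (m + 1) → ℝ) (δ : ℝ) (t : Fin m) : ℝ :=
  w t.castSucc * δ / (m * ∏ s, w s)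

/-- `Q^k = ∑_i q^1_i ⋯ q^{k-1}_i A^k_i`. -/
def lastOp {m d M : ℕ} (A : Fin (m + 1) → Fin M → Matrix (Fin d) (Fin d) ℂ)
    (q : Fin m → Fin M → ℂ) : Matrix (Fin d) (Fin d) ℂ :=
  ∑ i, (∏ t, q t i) • A (Fin.last m) i

/-- The Hermitian part `(B + B*) / 2`. -/
noncomputable def hermPart {d : ℕ} (B : Matrix (Fin d) (Fin d) ℂ) : Matrix (Fin d) (Fin d) ℂ :=
  (1 / 2 : ℂ) • (B + B.conjTranspose)

/-- The largest (real) eigenvalue. -/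
noncomputable def lambdaMax {d : ℕ} (B : Matrix (Fin d) (Fin d) ℂ) : ℝ := sSup (spectrum ℝ B)

/-- The number OPT that the algorithm returns when it enumerates the product of the nets `N t`. -/
noncomputable def enumOpt {m d M : ℕ} (A : Fin (m + 1) → Fin M → Matrix (Fin d) (Fin d) ℂ)
    (N : Fin m → Finset (Fin M → ℂ)) : ℝ :=
  sSup ((fun q => lambdaMax (hermPart (lastOp A q))) ''
    {q : Fin m → Fin M → ℂ | ∀ t, q t ∈ N t})

/-! ## Real random access machines

Programs over registers and arrays of natural numbers (for indices and counters) and of real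
numbers. The operations on reals are the four field operations and the test `≤`; there is no
rounding, no root, no oracle and no passage from reals back to indices. Every operation, memory
access, assignment and test costs one step (unit cost). -/

namespace RealRAM

/-- The memory: registers and arrays, named by numerals that are fixed in the program text; the
entries of an array are addressed at run time. -/
structure Mem where
  nreg : ℕ → ℕ
  narr : ℕ → ℕ → ℕ
  rreg : ℕ → ℝ
  rarr : ℕ → ℕ → ℝ

/-- Expressions of natural number type. -/
inductive NExp where
  | lit (n : ℕ)
  | reg (v : ℕ)
  | get (a : ℕ) (e : NExp)
  | add (e f : NExp)
  | sub (e f : NExp)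
  | mul (e f : NExp)

/-- Expressions of real type; `ofN` turns a natural number into a real. -/
inductive RExp where
  | ofN (e : NExp)
  | reg (v : ℕ)
  | get (a : ℕ) (e : NExp)
  | add (e f : RExp)
  | sub (e f : RExp)
  | mul (e f : RExp)
  | div (e f : RExp)

/-- Tests. -/
inductive Test where
  | nle (e f : NExp)
  | rle (e f : RExp)
  | neg (b : Test)

/-- Programs. -/
inductive Prog where
  | skip
  | setN (v : ℕ) (e : NExp)
  | putN (a : ℕ) (i e : NExp)
  | setR (v : ℕ) (e : RExp)
  | putR (a : ℕ) (i : NExp) (e : RExp)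
  | seq (p q : Prog)
  | ite (b : Test) (p q : Prog)
  | loop (b : Test) (p : Prog)

/-- The value of an expression (subtraction is truncated). -/
def NExp.eval (σ : Mem) : NExp → ℕ
  | .lit n => n
  | .reg v => σ.nreg v
  | .get a e => σ.narr a (e.eval σ)
  | .add e f => e.eval σ + f.eval σ
  | .sub e f => e.eval σ - f.eval σ
  | .mul e f => e.eval σ * f.eval σ

/-- The number of operations of an expression. -/
def NExp.cost : NExp → ℕ
  | .lit _ => 1
  | .reg _ => 1
  | .get _ e => e.cost + 1
  | .add e f => e.cost + f.cost + 1
  | .sub e f => e.cost + f.cost + 1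
  | .mul e f => e.cost + f.cost + 1

/-- The value of an expression (a division by zero returns zero). -/
noncomputable def RExp.eval (σ : Mem) : RExp → ℝ
  | .ofN e => (e.eval σ : ℝ)
  | .reg v => σ.rreg v
  | .get a e => σ.rarr a (e.eval σ)
  | .add e f => e.eval σ + f.eval σ
  | .sub e f => e.eval σ - f.eval σ
  | .mul e f => e.eval σ * f.eval σ
  | .div e f => e.eval σ / f.eval σ

/-- The number of operations of an expression. -/
def RExp.cost : RExp → ℕ
  | .ofN e => e.cost + 1
  | .reg _ => 1
  | .get _ e => e.cost + 1
  | .add e f => e.cost + f.cost + 1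
  | .sub e f => e.cost + f.cost + 1
  | .mul e f => e.cost + f.cost + 1
  | .div e f => e.cost + f.cost + 1

/-- The outcome of a test. -/
def Test.holds (σ : Mem) : Test → Prop
  | .nle e f => e.eval σ ≤ f.eval σ
  | .rle e f => e.eval σ ≤ f.eval σ
  | .neg b => ¬ b.holds σ

/-- The number of operations of a test. -/
def Test.cost : Test → ℕ
  | .nle e f => e.cost + f.cost + 1
  | .rle e f => e.cost + f.cost + 1
  | .neg b => b.cost + 1

/-- Store a natural number in a register. -/
def Mem.setN (σ : Mem) (v x : ℕ) : Mem :=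
  { σ with nreg := Function.update σ.nreg v x }

/-- Store a natural number in an array. -/
def Mem.putN (σ : Mem) (a i x : ℕ) : Mem :=
  { σ with narr := Function.update σ.narr a (Function.update (σ.narr a) i x) }

/-- Store a real in a register. -/
noncomputable def Mem.setR (σ : Mem) (v : ℕ) (x : ℝ) : Mem :=
  { σ with rreg := Function.update σ.rreg v x }

/-- Store a real in an array. -/
noncomputable def Mem.putR (σ : Mem) (a i : ℕ) (x : ℝ) : Mem :=
  { σ with rarr := Function.update σ.rarr a (Function.update (σ.rarr a) i x) }

/-- `Exec p σ T τ`: started in the memory `σ`, the program `p` halts after exactly `T` steps with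
the memory `τ`. -/
inductive Exec : Prog → Mem → ℕ → Mem → Prop where
  | skip (σ : Mem) : Exec .skip σ 1 σ
  | setN (σ : Mem) (v : ℕ) (e : NExp) :
      Exec (.setN v e) σ (e.cost + 1) (σ.setN v (e.eval σ))
  | putN (σ : Mem) (a : ℕ) (i e : NExp) :
      Exec (.putN a i e) σ (i.cost + e.cost + 1) (σ.putN a (i.eval σ) (e.eval σ))
  | setR (σ : Mem) (v : ℕ) (e : RExp) :
      Exec (.setR v e) σ (e.cost + 1) (σ.setR v (e.eval σ))
  | putR (σ : Mem) (a : ℕ) (i : NExp) (e : RExp) :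
      Exec (.putR a i e) σ (i.cost + e.cost + 1) (σ.putR a (i.eval σ) (e.eval σ))
  | seq {p q : Prog} {σ τ υ : Mem} {S T : ℕ} :
      Exec p σ S τ → Exec q τ T υ → Exec (.seq p q) σ (S + T) υ
  | iteTrue {b : Test} {p q : Prog} {σ τ : Mem} {T : ℕ} :
      b.holds σ → Exec p σ T τ → Exec (.ite b p q) σ (b.cost + T) τ
  | iteFalse {b : Test} {p q : Prog} {σ τ : Mem} {T : ℕ} :
      ¬ b.holds σ → Exec q σ T τ → Exec (.ite b p q) σ (b.cost + T) τ
  | loopTrue {b : Test} {p : Prog} {σ τ υ : Mem} {S T : ℕ} :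
      b.holds σ → Exec p σ S τ → Exec (.loop b p) τ T υ →
        Exec (.loop b p) σ (b.cost + S + T) υ
  | loopFalse {b : Test} {p : Prog} {σ : Mem} :
      ¬ b.holds σ → Exec (.loop b p) σ b.cost σ

/-- The memory `σ` holds the input: `k = m + 1`, `d`, `M` in the first index registers, `δ` in the
first real register, the widths `w` in the real array 0, and the real and imaginary parts of the
entries of the decomposition in the real arrays 1 and 2 (row by row). All other cells are
arbitrary. -/
structure IsInput {m d M : ℕ} (w : Fin (m + 1) → ℝ) (δ : ℝ)
    (A : Fin (m + 1) → Fin M → Matrix (Fin d) (Fin d) ℂ) (σ : Mem) : Prop where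
  parties : σ.nreg 0 = m + 1
  dimension : σ.nreg 1 = d
  terms : σ.nreg 2 = M
  precision : σ.rreg 0 = δ
  widths : ∀ t : Fin (m + 1), σ.rarr 0 t = w t
  re_entry : ∀ (t : Fin (m + 1)) (i : Fin M) (a b : Fin d),
    σ.rarr 1 (((t * M + i) * d + a) * d + b) = (A t i a b).re
  im_entry : ∀ (t : Fin (m + 1)) (i : Fin M) (a b : Fin d),
    σ.rarr 2 (((t * M + i) * d + a) * d + b) = (A t i a b).im

/-- The net for party `t` that is stored in the memory: the number of its points is the entry `t`
of the index array 0, the coordinates of the points are in the real arrays 3 (real parts) and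
4 (imaginary parts). -/
noncomputable def outNet (m M : ℕ) (σ : Mem) (t : Fin m) : Finset (Fin M → ℂ) :=
  open Classical in
  (Finset.range (σ.narr 0 t)).image fun l i =>
    (⟨σ.rarr 3 ((l * m + t) * M + i), σ.rarr 4 ((l * m + t) * M + i)⟩ : ℂ)

/-- The returned number OPT, in the first real register. -/
def outOpt (σ : Mem) : ℝ := σ.rreg 0

end RealRAM

/-! Correctness is a perturbation estimate. The value of `Q` at a product state depends on the first
`k - 1` states only through their vectors `qVec`, and equals the trace of `lastOp` against the last
state (`IsDecomposition.trace_eq`). Telescoping the products `∏ q^t_i` (`norm_prod_sub_prod_le`)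
shows that moving every `q^t` by at most `ε_t` in `ℓ_1` changes this trace by at most `W ∑ ε_t / w_t
= δ`. Covering allows the vectors of an optimal product state to be rounded to net points, which
gives one inequality; closeness of the net points to `S_t` allows them to be replaced by vectors of
genuine states, which gives the other (`abs_enumOpt_sub_optSep_le`).

The machine has field operations only, so eigenvalue computations are replaced by powers: for a
positive matrix `P` with spectrum below `Λ`, the state `P ^ N / Tr (P ^ N)` comes within `Λ d / N`
of maximising `Tr (P ρ)` (`gibbs_spec`). Shifting by a multiple of the identity turns this into an
oracle that nearly minimises any linear form over the density operators. It is used to select net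
points and to evaluate `λ_max`.

The raw net is a square grid in the disc of radius `w_t`, in each coordinate. A grid vector `q` is
tested by an approachability argument (`Rounds`): accumulate `S = ∑ (qVec σ_j - q)`, where `σ_j`
nearly minimises the linear form given by the current `S`. By convexity `S / n = p - q` with `p ∈
S_t`, so a small `S` certifies that `q` is close. Conversely, when some point of `S_t` is close to
`q`, a step has almost no component along `S`, and `S` has size `O(√n)` apart from a small drift
(`Rounds.sqrt_sum_le`). Comparing squares avoids roots.

With mesh parameter `L` there are `K = (2 L + 1) ^ (2 M)` grid vectors per party and at most `K ^ (k
- 1)` tuples, each handled in time polynomial in `d + M + k + L`. When the ratio of scale to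
precision is at most one, `L = 0` and the grid is a single point, which accounts for the `1` in the
maximum. The program works with `δ / 2`, so that net error and numerical error add up to `δ`.

Programs are verified by a Hoare logic for total correctness with time bounds (`Runs`), over a view
of the memory as a store of complex numbers (`CMem`). What a program leaves unchanged is read off
its syntax (`Exec.frame`), so that frame conditions can be decided. -/

namespace RealRAM

/-! ## Complex arithmetic on the real machine

A complex register `r` is stored in the real registers `2 r + 1` and `2 r + 2`, and a complex array
`a` in the real arrays `2 a + 1` and `2 a + 2`. The real register `0` is a scratch cell, and the
real array `0`, which is never written, holds the widths. -/

/-- The memory, seen as a store for natural and for complex numbers. -/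
structure CMem where
  n : ℕ → ℕ
  na : ℕ → ℕ → ℕ
  c : ℕ → ℂ
  ca : ℕ → ℕ → ℂ
  wd : ℕ → ℝ

/-- The complex store that is held in a memory. -/
def Mem.toC (σ : Mem) : CMem where
  n := σ.nreg
  na := σ.narr
  c r := ⟨σ.rreg (2 * r + 1), σ.rreg (2 * r + 2)⟩
  ca a j := ⟨σ.rarr (2 * a + 1) j, σ.rarr (2 * a + 2) j⟩
  wd := σ.rarr 0

namespace CMem

variable (s : CMem)

/-- Write an index register. -/
def setN (v x : ℕ) : CMem :=
  { s with n := Function.update s.n v x }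

/-- Write an entry of an index array. -/
def putN (a i x : ℕ) : CMem :=
  { s with na := Function.update s.na a (Function.update (s.na a) i x) }

/-- Write a complex register. -/
noncomputable def setC (r : ℕ) (z : ℂ) : CMem :=
  { s with c := Function.update s.c r z }

/-- Write an entry of a complex array. -/
noncomputable def putC (a i : ℕ) (z : ℂ) : CMem :=
  { s with ca := Function.update s.ca a (Function.update (s.ca a) i z) }

@[simp] theorem setN_n (v x : ℕ) : (s.setN v x).n = Function.update s.n v x := rfl
@[simp] theorem setN_na (v x : ℕ) : (s.setN v x).na = s.na := rfl
@[simp] theorem setN_c (v x : ℕ) : (s.setN v x).c = s.c := rfl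
@[simp] theorem setN_ca (v x : ℕ) : (s.setN v x).ca = s.ca := rfl
@[simp] theorem setN_wd (v x : ℕ) : (s.setN v x).wd = s.wd := rfl

@[simp] theorem putN_n (a i x : ℕ) : (s.putN a i x).n = s.n := rfl
@[simp] theorem putN_na (a i x : ℕ) : (s.putN a i x).na =
    Function.update s.na a (Function.update (s.na a) i x) := rfl
@[simp] theorem putN_c (a i x : ℕ) : (s.putN a i x).c = s.c := rfl
@[simp] theorem putN_ca (a i x : ℕ) : (s.putN a i x).ca = s.ca := rfl
@[simp] theorem putN_wd (a i x : ℕ) : (s.putN a i x).wd = s.wd := rfl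

@[simp] theorem setC_n (r : ℕ) (z : ℂ) : (s.setC r z).n = s.n := rfl
@[simp] theorem setC_na (r : ℕ) (z : ℂ) : (s.setC r z).na = s.na := rfl
@[simp] theorem setC_c (r : ℕ) (z : ℂ) : (s.setC r z).c = Function.update s.c r z := rfl
@[simp] theorem setC_ca (r : ℕ) (z : ℂ) : (s.setC r z).ca = s.ca := rfl
@[simp] theorem setC_wd (r : ℕ) (z : ℂ) : (s.setC r z).wd = s.wd := rfl

@[simp] theorem putC_n (a i : ℕ) (z : ℂ) : (s.putC a i z).n = s.n := rfl
@[simp] theorem putC_na (a i : ℕ) (z : ℂ) : (s.putC a i z).na = s.na := rfl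
@[simp] theorem putC_c (a i : ℕ) (z : ℂ) : (s.putC a i z).c = s.c := rfl
@[simp] theorem putC_ca (a i : ℕ) (z : ℂ) : (s.putC a i z).ca =
    Function.update s.ca a (Function.update (s.ca a) i z) := rfl
@[simp] theorem putC_wd (a i : ℕ) (z : ℂ) : (s.putC a i z).wd = s.wd := rfl

end CMem

/-- The value of an index expression. -/
def NExp.ev (s : CMem) : NExp → ℕ
  | .lit n => n
  | .reg v => s.n v
  | .get a e => s.na a (e.ev s)
  | .add e f => e.ev s + f.ev s
  | .sub e f => e.ev s - f.ev s
  | .mul e f => e.ev s * f.ev s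

theorem NExp.eval_eq_ev (e : NExp) (σ : Mem) : e.eval σ = e.ev σ.toC := by
  induction e <;> simp_all [NExp.eval, NExp.ev, Mem.toC]

/-- Complex expressions. -/
inductive CExp where
  | ofN (e : NExp)
  | wid (e : NExp)
  | unitI
  | reg (r : ℕ)
  | get (a : ℕ) (e : NExp)
  | add (x y : CExp)
  | sub (x y : CExp)
  | mul (x y : CExp)
  | div (x y : CExp)
  | conj (x : CExp)

namespace CExp

/-- The value of a complex expression. -/
noncomputable def ev (s : CMem) : CExp → ℂ
  | ofN e => (e.ev s : ℂ)
  | wid e => (s.wd (e.ev s) : ℂ)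
  | unitI => Complex.I
  | reg r => s.c r
  | get a e => s.ca a (e.ev s)
  | add x y => x.ev s + y.ev s
  | sub x y => x.ev s - y.ev s
  | mul x y => x.ev s * y.ev s
  | div x y => x.ev s / y.ev s
  | conj x => (starRingEnd ℂ) (x.ev s)

/-- The real expressions for the real and the imaginary part. -/
def parts : CExp → RExp × RExp
  | ofN e => (.ofN e, .ofN (.lit 0))
  | wid e => (.get 0 e, .ofN (.lit 0))
  | unitI => (.ofN (.lit 0), .ofN (.lit 1))
  | reg r => (.reg (2 * r + 1), .reg (2 * r + 2))
  | get a e => (.get (2 * a + 1) e, .get (2 * a + 2) e)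
  | add x y => (.add x.parts.1 y.parts.1, .add x.parts.2 y.parts.2)
  | sub x y => (.sub x.parts.1 y.parts.1, .sub x.parts.2 y.parts.2)
  | mul x y => (.sub (.mul x.parts.1 y.parts.1) (.mul x.parts.2 y.parts.2),
      .add (.mul x.parts.1 y.parts.2) (.mul x.parts.2 y.parts.1))
  | div x y =>
      let s := RExp.add (.mul y.parts.1 y.parts.1) (.mul y.parts.2 y.parts.2)
      (.add (.div (.mul x.parts.1 y.parts.1) s) (.div (.mul x.parts.2 y.parts.2) s),
        .sub (.div (.mul x.parts.2 y.parts.1) s) (.div (.mul x.parts.1 y.parts.2) s))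
  | conj x => (x.parts.1, .sub (.ofN (.lit 0)) x.parts.2)

theorem eval_parts (x : CExp) (σ : Mem) :
    x.parts.1.eval σ = (x.ev σ.toC).re ∧ x.parts.2.eval σ = (x.ev σ.toC).im := by
  induction x with
  | div x y hx hy =>
    simp [parts, RExp.eval, ev, hx, hy, Complex.div_re, Complex.div_im, Complex.normSq_apply]
  | _ => simp_all [parts, RExp.eval, ev, NExp.eval_eq_ev, NExp.ev, Mem.toC]

/-- Complex registers occupy real registers with positive numbers, so no compiled expression reads
the scratch cell. The imaginary part can be parked there before the real part is overwritten, even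
if the expression mentions the target register. -/
theorem eval_parts_scratch (x : CExp) (σ : Mem) (z : ℝ) :
    x.parts.1.eval (σ.setR 0 z) = x.parts.1.eval σ ∧
      x.parts.2.eval (σ.setR 0 z) = x.parts.2.eval σ := by
  have hn : ∀ e : NExp, e.eval (σ.setR 0 z) = e.eval σ := by
    intro e
    induction e <;> simp_all [NExp.eval, Mem.setR]
  induction x with
  | reg r => simp [parts, RExp.eval, Mem.setR]
  | get a e => simp [parts, RExp.eval, hn]; simp [Mem.setR]
  | wid e => simp [parts, RExp.eval, hn]; simp [Mem.setR]
  | _ => simp_all [parts, RExp.eval]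

/-- The number of operations for both parts. -/
def cost (x : CExp) : ℕ := x.parts.1.cost + x.parts.2.cost

end CExp

/-! ## The compiled instructions -/

namespace Prog

/-- Store a complex number in a register. -/
def setC (r : ℕ) (x : CExp) : Prog :=
  .seq (.setR 0 x.parts.2) (.seq (.setR (2 * r + 1) x.parts.1) (.setR (2 * r + 2) (.reg 0)))

/-- Store a complex number in an array. -/
def putC (a : ℕ) (i : NExp) (x : CExp) : Prog :=
  .seq (.setR 0 x.parts.2)
    (.seq (.putR (2 * a + 1) i x.parts.1) (.putR (2 * a + 2) i (.reg 0)))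

/-- Repeat `p` for the values `0, …, n - 1` of the register `v`, where `n` is the value of the
register `b`. -/
def count (v b : ℕ) (p : Prog) : Prog :=
  .seq (.setN v (.lit 0))
    (.loop (.neg (.nle (.reg b) (.reg v))) (.seq p (.setN v (.add (.reg v) (.lit 1)))))

/-- Whether a program writes to an index register. -/
def modN : Prog → ℕ → Bool
  | .setN v _, u => v == u
  | .seq p q, u => p.modN u || q.modN u
  | .ite _ p q, u => p.modN u || q.modN u
  | .loop _ p, u => p.modN u
  | _, _ => false

/-- Whether a program writes to an index array. -/
def modNA : Prog → ℕ → Bool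
  | .putN v _ _, u => v == u
  | .seq p q, u => p.modNA u || q.modNA u
  | .ite _ p q, u => p.modNA u || q.modNA u
  | .loop _ p, u => p.modNA u
  | _, _ => false

/-- Whether a program writes to a real register. -/
def modR : Prog → ℕ → Bool
  | .setR v _, u => v == u
  | .seq p q, u => p.modR u || q.modR u
  | .ite _ p q, u => p.modR u || q.modR u
  | .loop _ p, u => p.modR u
  | _, _ => false

/-- Whether a program writes to a real array. -/
def modRA : Prog → ℕ → Bool
  | .putR v _ _, u => v == u
  | .seq p q, u => p.modRA u || q.modRA u
  | .ite _ p q, u => p.modRA u || q.modRA u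
  | .loop _ p, u => p.modRA u
  | _, _ => false

/-- Whether a program writes to a complex register. -/
def modC (p : Prog) (u : ℕ) : Bool := p.modR (2 * u + 1) || p.modR (2 * u + 2)

/-- Whether a program writes to a complex array. -/
def modCA (p : Prog) (u : ℕ) : Bool := p.modRA (2 * u + 1) || p.modRA (2 * u + 2)

end Prog

/-! ### What a run leaves unchanged. -/

theorem Exec.frame {p : Prog} {σ τ : Mem} {T : ℕ} (h : Exec p σ T τ) :
    (∀ u, p.modN u = false → τ.nreg u = σ.nreg u) ∧
    (∀ u, p.modNA u = false → τ.narr u = σ.narr u) ∧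
    (∀ u, p.modR u = false → τ.rreg u = σ.rreg u) ∧
    (∀ u, p.modRA u = false → τ.rarr u = σ.rarr u) := by
  induction h with
  | setN σ v e =>
    refine ⟨fun u hu => ?_, fun _ _ => rfl, fun _ _ => rfl, fun _ _ => rfl⟩
    simp [Prog.modN] at hu
    simp [Mem.setN, Function.update_of_ne (Ne.symm hu)]
  | putN σ a i e =>
    refine ⟨fun _ _ => rfl, fun u hu => ?_, fun _ _ => rfl, fun _ _ => rfl⟩
    simp [Prog.modNA] at hu
    simp [Mem.putN, Function.update_of_ne (Ne.symm hu)]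
  | setR σ v e =>
    refine ⟨fun _ _ => rfl, fun _ _ => rfl, fun u hu => ?_, fun _ _ => rfl⟩
    simp [Prog.modR] at hu
    simp [Mem.setR, Function.update_of_ne (Ne.symm hu)]
  | putR σ a i e =>
    refine ⟨fun _ _ => rfl, fun _ _ => rfl, fun _ _ => rfl, fun u hu => ?_⟩
    simp [Prog.modRA] at hu
    simp [Mem.putR, Function.update_of_ne (Ne.symm hu)]
  | _ => simp_all [Prog.modN, Prog.modNA, Prog.modR, Prog.modRA]

/-- The cells that `p` does not write have the same content in `s` and `s'`. -/
structure Frame (p : Prog) (s s' : CMem) : Prop where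
  n : ∀ u, p.modN u = false → s'.n u = s.n u
  na : ∀ u, p.modNA u = false → s'.na u = s.na u
  c : ∀ u, p.modC u = false → s'.c u = s.c u
  ca : ∀ u, p.modCA u = false → s'.ca u = s.ca u
  wd : p.modRA 0 = false → s'.wd = s.wd

theorem Exec.frame_toC {p : Prog} {σ τ : Mem} {T : ℕ} (h : Exec p σ T τ) :
    Frame p σ.toC τ.toC := by
  obtain ⟨h1, h2, h3, h4⟩ := h.frame
  refine ⟨h1, h2, fun u hu => ?_, fun u hu => ?_, h4 0⟩
  · simp [Prog.modC] at hu
    simp [Mem.toC, h3 _ hu.1, h3 _ hu.2]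
  · simp [Prog.modCA] at hu
    simp [Mem.toC, h4 _ hu.1, h4 _ hu.2]

theorem Frame.trans {p : Prog} {s s' s'' : CMem} (h : Frame p s s') (h' : Frame p s' s'') :
    Frame p s s'' :=
  ⟨fun u hu => (h'.n u hu).trans (h.n u hu), fun u hu => (h'.na u hu).trans (h.na u hu),
    fun u hu => (h'.c u hu).trans (h.c u hu), fun u hu => (h'.ca u hu).trans (h.ca u hu),
    fun hu => (h'.wd hu).trans (h.wd hu)⟩

/-! ## Total correctness with a time bound -/

/-- Started in a memory that holds `s`, the program `p` halts after at most `T` steps in a memory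
that holds a store with the property `Φ`. -/
def Runs (p : Prog) (s : CMem) (T : ℕ) (Φ : CMem → Prop) : Prop :=
  ∀ σ : Mem, σ.toC = s → ∃ (t : ℕ) (τ : Mem), Exec p σ t τ ∧ t ≤ T ∧ Φ τ.toC

variable {p q : Prog} {s : CMem} {T T' : ℕ} {Φ Ψ : CMem → Prop}

theorem Runs.mono (h : Runs p s T Ψ) (hT : T ≤ T') (hΦ : ∀ s', Ψ s' → Φ s') : Runs p s T' Φ :=
  fun σ hσ =>
    let ⟨t, τ, h1, h2, h3⟩ := h σ hσ
    ⟨t, τ, h1, h2.trans hT, hΦ _ h3⟩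

theorem Runs.le (hT : T ≤ T') (h : Runs p s T Φ) : Runs p s T' Φ :=
  h.mono hT fun _ h => h

/-- Use a specification, together with what the program leaves unchanged. -/
theorem Runs.call (h : Runs p s T Ψ) (hΦ : ∀ s', Frame p s s' → Ψ s' → Φ s') :
    Runs p s T Φ := fun σ hσ =>
  let ⟨t, τ, h1, h2, h3⟩ := h σ hσ
  ⟨t, τ, h1, h2, hΦ _ (hσ ▸ h1.frame_toC) h3⟩

theorem Runs.seq {U : ℕ} (h : Runs p s T fun s' => Runs q s' U Φ) :
    Runs (.seq p q) s (T + U) Φ := fun σ hσ => by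
  obtain ⟨t, τ, h1, h2, h3⟩ := h σ hσ
  obtain ⟨t', τ', h1', h2', h3'⟩ := h3 τ rfl
  exact ⟨_, _, .seq h1 h1', by omega, h3'⟩

theorem Runs.setN {v : ℕ} {e : NExp} (h : Φ (s.setN v (e.ev s))) :
    Runs (.setN v e) s (e.cost + 1) Φ := fun σ hσ => by
  subst hσ
  refine ⟨_, _, .setN σ v e, le_rfl, ?_⟩
  rw [NExp.eval_eq_ev]
  exact h

theorem Runs.putN {a : ℕ} {i e : NExp} (h : Φ (s.putN a (i.ev s) (e.ev s))) :
    Runs (.putN a i e) s (i.cost + e.cost + 1) Φ := fun σ hσ => by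
  subst hσ
  refine ⟨_, _, .putN σ a i e, le_rfl, ?_⟩
  rw [NExp.eval_eq_ev, NExp.eval_eq_ev]
  exact h

/-- The scratch register is invisible in the complex view and distinct complex registers use
disjoint pairs of cells, so three real writes amount to one complex write. -/
theorem Mem.toC_setR_setR (σ : Mem) (r : ℕ) (x a b : ℝ) :
    (((σ.setR 0 x).setR (2 * r + 1) a).setR (2 * r + 2) b).toC = σ.toC.setC r ⟨a, b⟩ := by
  simp only [Mem.toC, CMem.setC, CMem.mk.injEq]
  refine ⟨rfl, rfl, ?_, rfl, rfl⟩
  funext u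
  rcases eq_or_ne u r with rfl | hu
  · simp [Mem.setR]
  · have h1 : 2 * u ≠ 2 * r + 1 := by omega
    have h2 : 2 * u + 2 ≠ 2 * r + 1 := by omega
    simp [Mem.setR, hu, h1, h2]

theorem Mem.toC_putR_putR (σ : Mem) (v i : ℕ) (x a b : ℝ) :
    (((σ.setR 0 x).putR (2 * v + 1) i a).putR (2 * v + 2) i b).toC = σ.toC.putC v i ⟨a, b⟩ := by
  simp only [Mem.toC, CMem.putC, CMem.mk.injEq]
  refine ⟨rfl, rfl, rfl, ?_, ?_⟩
  · funext u j
    rcases eq_or_ne u v with rfl | hu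
    · rcases eq_or_ne j i with rfl | hj
      · simp [Mem.putR, Mem.setR]
      · simp [Mem.putR, Mem.setR, hj]
    · have h1 : 2 * u ≠ 2 * v + 1 := by omega
      have h2 : 2 * u + 2 ≠ 2 * v + 1 := by omega
      simp [Mem.putR, Mem.setR, hu, h1, h2]
  · simp [Mem.putR, Mem.setR]

theorem Runs.setC {r : ℕ} {x : CExp} (h : Φ (s.setC r (x.ev s))) :
    Runs (.setC r x) s (x.cost + 4) Φ := fun σ hσ => by
  subst hσ
  refine ⟨_, _, .seq (.setR _ _ _) (.seq (.setR _ _ _) (.setR _ _ _)), ?_, ?_⟩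
  · simp only [CExp.cost, RExp.cost]
    omega
  have e0 : (RExp.reg 0).eval ((σ.setR 0 (x.parts.2.eval σ)).setR (2 * r + 1)
      (x.parts.1.eval (σ.setR 0 (x.parts.2.eval σ)))) = x.parts.2.eval σ := by
    simp [RExp.eval, Mem.setR]
  rw [e0, Mem.toC_setR_setR, (x.eval_parts_scratch σ _).1, (x.eval_parts σ).1, (x.eval_parts σ).2]
  exact h

theorem NExp.eval_setR (e : NExp) (σ : Mem) (v : ℕ) (x : ℝ) : e.eval (σ.setR v x) = e.eval σ := by
  induction e <;> simp_all [NExp.eval, Mem.setR]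

theorem NExp.eval_putR (e : NExp) (σ : Mem) (a i : ℕ) (x : ℝ) :
    e.eval (σ.putR a i x) = e.eval σ := by
  induction e <;> simp_all [NExp.eval, Mem.putR]

theorem Runs.putC {a : ℕ} {i : NExp} {x : CExp} (h : Φ (s.putC a (i.ev s) (x.ev s))) :
    Runs (.putC a i x) s (x.cost + 2 * i.cost + 4) Φ := fun σ hσ => by
  subst hσ
  refine ⟨_, _, .seq (.setR _ _ _) (.seq (.putR _ _ _ _) (.putR _ _ _ _)), ?_, ?_⟩
  · simp only [CExp.cost, RExp.cost]
    omega
  have e0 : ∀ (j : ℕ) (z : ℝ),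
      (RExp.reg 0).eval ((σ.setR 0 (x.parts.2.eval σ)).putR (2 * a + 1) j z)
      = x.parts.2.eval σ := by
    simp [RExp.eval, Mem.setR, Mem.putR]
  rw [e0]
  simp only [NExp.eval_putR, NExp.eval_setR]
  rw [Mem.toC_putR_putR, (x.eval_parts_scratch σ _).1, (x.eval_parts σ).1, (x.eval_parts σ).2,
    NExp.eval_eq_ev]
  exact h

theorem Runs.ite {b : Test} (B : Prop) (hb : ∀ σ : Mem, σ.toC = s → (b.holds σ ↔ B))
    (hp : B → Runs p s T Φ) (hq : ¬ B → Runs q s T Φ) :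
    Runs (.ite b p q) s (b.cost + T) Φ := fun σ hσ => by
  by_cases h : B
  · obtain ⟨t, τ, h1, h2, h3⟩ := hp h σ hσ
    exact ⟨_, _, .iteTrue ((hb σ hσ).2 h) h1, by omega, h3⟩
  · obtain ⟨t, τ, h1, h2, h3⟩ := hq h σ hσ
    exact ⟨_, _, .iteFalse (fun h' => h ((hb σ hσ).1 h')) h1, by omega, h3⟩

theorem Runs.skip (h : Φ s) : Runs .skip s 1 Φ := fun σ hσ =>
  ⟨_, _, .skip σ, le_rfl, hσ ▸ h⟩

/-- The test `x ≤ y` for the real parts. -/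
def Test.cle (x y : CExp) : Test := .rle x.parts.1 y.parts.1

theorem Runs.iteC {x y : CExp}
    (hp : (x.ev s).re ≤ (y.ev s).re → Runs p s T Φ)
    (hq : ¬ (x.ev s).re ≤ (y.ev s).re → Runs q s T Φ) :
    Runs (.ite (.cle x y) p q) s ((Test.cle x y).cost + T) Φ :=
  Runs.ite _ (fun σ hσ => by
    subst hσ
    simp [Test.cle, Test.holds, (x.eval_parts σ).1, (y.eval_parts σ).1]) hp hq

theorem Runs.iteN {e f : NExp} (hp : e.ev s ≤ f.ev s → Runs p s T Φ)
    (hq : ¬ e.ev s ≤ f.ev s → Runs q s T Φ) :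
    Runs (.ite (.nle e f) p q) s ((Test.nle e f).cost + T) Φ :=
  Runs.ite _ (fun σ hσ => by
    subst hσ
    simp [Test.holds, NExp.eval_eq_ev]) hp hq

/-- The rule for counting loops. -/
theorem Runs.count {v b : ℕ} (n : ℕ) (I : ℕ → CMem → Prop) (hn : s.n b = n)
    (hv : p.modN v = false) (hb : (Prog.count v b p).modN b = false)
    (h0 : I 0 (s.setN v 0))
    (hI : ∀ i < n, ∀ s', Frame (.count v b p) s s' → s'.n v = i → I i s' →
      Runs p s' T fun s'' => I (i + 1) (s''.setN v (i + 1)))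
    (hΦ : ∀ s', Frame (.count v b p) s s' → s'.n v = n → I n s' → Φ s') :
    Runs (.count v b p) s ((n + 1) * (T + 8)) Φ := fun σ hσ => by
  have hvb : v ≠ b := by
    intro h
    simp [Prog.count, Prog.modN, h] at hb
  -- Induction on the number `j` of rounds still to run. The frame back to `s` is carried along, so
  -- the bound register still holds `n` at every test. A round costs `T` plus 4 for the test and 4
  -- for the increment; the failing test at the end costs 4.
  have key : ∀ j ≤ n, ∀ τ : Mem, Frame (.count v b p) s τ.toC → τ.nreg v = n - j →
      I (n - j) τ.toC → ∃ (t : ℕ) (υ : Mem), Exec (.loop (.neg (.nle (.reg b) (.reg v)))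
        (.seq p (.setN v (.add (.reg v) (.lit 1))))) τ t υ ∧ t ≤ j * (T + 8) + 4 ∧
        Frame (.count v b p) s υ.toC ∧ υ.nreg v = n ∧ I n υ.toC := by
    intro j
    induction j with
    | zero =>
      intro _ τ hF hτ hIτ
      have hbn : τ.nreg b = n := (hF.n b hb).trans hn
      exact ⟨_, τ, .loopFalse (by simp [Test.holds, NExp.eval, hbn, hτ]),
        by simp [Test.cost, NExp.cost], hF, by simpa using hτ, by simpa using hIτ⟩
    | succ j ih =>
      intro hj τ hF hτ hIτ
      have hbn : τ.nreg b = n := (hF.n b hb).trans hn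
      obtain ⟨t, υ, h1, h2, h3⟩ := hI (n - (j + 1)) (by omega) τ.toC hF hτ hIτ τ rfl
      have hυv : υ.nreg v = n - (j + 1) := by rw [h1.frame.1 v hv, hτ]
      have e1 : n - (j + 1) + 1 = n - j := by omega
      have hset : (υ.setN v (n - j)).toC = υ.toC.setN v (n - j) := rfl
      have hx : Exec (.setN v (.add (.reg v) (.lit 1))) υ 4 (υ.setN v (n - j)) := by
        have := Exec.setN υ v (.add (.reg v) (.lit 1))
        simpa [NExp.eval, NExp.cost, hυv, e1] using this
      have hF' : Frame (.count v b p) s (υ.setN v (n - j)).toC := by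
        have hseq := (Exec.seq h1 hx).frame_toC
        refine hF.trans ⟨fun u hu => hseq.n u ?_, fun u hu => hseq.na u ?_,
          fun u hu => hseq.c u ?_, fun u hu => hseq.ca u ?_, fun hu => hseq.wd ?_⟩
        all_goals simp_all [Prog.count, Prog.modN, Prog.modNA, Prog.modC, Prog.modCA, Prog.modR,
          Prog.modRA]
      obtain ⟨t', υ', g1, g2, g3⟩ := ih (by omega) _ hF' (by simp [Mem.setN])
        (by rw [hset, ← e1]; exact h3)
      refine ⟨_, υ', .loopTrue ?_ (.seq h1 hx) g1, ?_, g3⟩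
      · simp only [Test.holds, NExp.eval, hbn, hτ]
        omega
      · simp only [Test.cost, NExp.cost]
        nlinarith
  have hx0 : Exec (.setN v (.lit 0)) σ 2 (σ.setN v 0) := by
    simpa [NExp.eval, NExp.cost] using Exec.setN σ v (.lit 0)
  have hF0 : Frame (.count v b p) s (σ.setN v 0).toC := by
    have hf := hx0.frame_toC
    rw [hσ] at hf
    refine ⟨fun u hu => hf.n u ?_, fun u hu => hf.na u ?_, fun u hu => hf.c u ?_,
      fun u hu => hf.ca u ?_, fun hu => hf.wd ?_⟩
    all_goals simp_all [Prog.count, Prog.modN, Prog.modNA, Prog.modC, Prog.modCA, Prog.modR,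
          Prog.modRA]
  obtain ⟨t, υ, h1, h2, h3, h4, h5⟩ := key n le_rfl (σ.setN v 0) hF0 (by simp [Mem.setN])
    (by
      have : (σ.setN v 0).toC = s.setN v 0 := by rw [← hσ]; rfl
      rw [this]; simpa using h0)
  exact ⟨_, υ, .seq hx0 h1, by nlinarith, hΦ _ h3 h4 h5⟩

end RealRAM

namespace RealRAM

/-! ## Notation for programs -/

/-- An index register. -/
abbrev nr (v : ℕ) : NExp := .reg v

/-- A complex register. -/
abbrev cr (r : ℕ) : CExp := .reg r

/-- A number as an index expression. -/
abbrev nl (v : ℕ) : NExp := .lit v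

/-- An index as a complex number. -/
abbrev cn (e : NExp) : CExp := .ofN e

instance : Add NExp := ⟨.add⟩
instance : Sub NExp := ⟨.sub⟩
instance : Mul NExp := ⟨.mul⟩
instance : Add CExp := ⟨.add⟩
instance : Sub CExp := ⟨.sub⟩
instance : Mul CExp := ⟨.mul⟩
instance : Div CExp := ⟨.div⟩

infixr:30 " ;; " => Prog.seq

/-! ### Evaluation rules and write sets for automation. -/

section
variable (s : CMem)

@[simp] theorem NExp.ev_lit (n : ℕ) : (NExp.lit n).ev s = n := rfl
@[simp] theorem NExp.ev_reg (v : ℕ) : (NExp.reg v).ev s = s.n v := rfl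
@[simp] theorem NExp.ev_get (a : ℕ) (e : NExp) : (NExp.get a e).ev s = s.na a (e.ev s) := rfl
@[simp] theorem NExp.ev_add (e f : NExp) : (e + f).ev s = e.ev s + f.ev s := rfl
@[simp] theorem NExp.ev_sub (e f : NExp) : (e - f).ev s = e.ev s - f.ev s := rfl
@[simp] theorem NExp.ev_mul (e f : NExp) : (e * f).ev s = e.ev s * f.ev s := rfl
@[simp] theorem CExp.ev_ofN (e : NExp) : (CExp.ofN e).ev s = (e.ev s : ℂ) := rfl
@[simp] theorem CExp.ev_wid (e : NExp) : (CExp.wid e).ev s = (s.wd (e.ev s) : ℂ) := rfl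
@[simp] theorem CExp.ev_unitI : CExp.unitI.ev s = Complex.I := rfl
@[simp] theorem CExp.ev_reg (r : ℕ) : (CExp.reg r).ev s = s.c r := rfl
@[simp] theorem CExp.ev_get (a : ℕ) (e : NExp) : (CExp.get a e).ev s = s.ca a (e.ev s) := rfl
@[simp] theorem CExp.ev_add (x y : CExp) : (x + y).ev s = x.ev s + y.ev s := rfl
@[simp] theorem CExp.ev_sub (x y : CExp) : (x - y).ev s = x.ev s - y.ev s := rfl
@[simp] theorem CExp.ev_mul (x y : CExp) : (x * y).ev s = x.ev s * y.ev s := rfl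
@[simp] theorem CExp.ev_div (x y : CExp) : (x / y).ev s = x.ev s / y.ev s := rfl
@[simp] theorem CExp.ev_conj (x : CExp) : (CExp.conj x).ev s = (starRingEnd ℂ) (x.ev s) := rfl

end

section
variable (p q : Prog) (u v b a r : ℕ) (i e : NExp) (x : CExp)

@[simp] theorem Prog.modN_setN : (Prog.setN v e).modN u = (v == u) := rfl
@[simp] theorem Prog.modN_putN : (Prog.putN a i e).modN u = false := rfl
@[simp] theorem Prog.modN_setC : (Prog.setC r x).modN u = false := rfl
@[simp] theorem Prog.modN_putC : (Prog.putC a i x).modN u = false := rfl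
@[simp] theorem Prog.modN_seq : (p ;; q).modN u = (p.modN u || q.modN u) := rfl
@[simp] theorem Prog.modN_count : (Prog.count v b p).modN u = (v == u || p.modN u) := by
  simp [Prog.count, Prog.modN, Bool.or_comm]
@[simp] theorem Prog.modNA_setN : (Prog.setN v e).modNA u = false := rfl
@[simp] theorem Prog.modNA_putN : (Prog.putN a i e).modNA u = (a == u) := rfl
@[simp] theorem Prog.modNA_setC : (Prog.setC r x).modNA u = false := rfl
@[simp] theorem Prog.modNA_putC : (Prog.putC a i x).modNA u = false := rfl
@[simp] theorem Prog.modNA_seq : (p ;; q).modNA u = (p.modNA u || q.modNA u) := rfl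
@[simp] theorem Prog.modNA_count : (Prog.count v b p).modNA u = p.modNA u := by
  simp [Prog.count, Prog.modNA]
@[simp] theorem Prog.modC_setN : (Prog.setN v e).modC u = false := rfl
@[simp] theorem Prog.modC_putN : (Prog.putN a i e).modC u = false := rfl
@[simp] theorem Prog.modC_setC : (Prog.setC r x).modC u = (r == u) := by
  rw [Bool.eq_iff_iff]
  simp [Prog.setC, Prog.modC, Prog.modR]
  omega
@[simp] theorem Prog.modC_putC : (Prog.putC a i x).modC u = false := by
  simp [Prog.putC, Prog.modC, Prog.modR]
@[simp] theorem Prog.modC_seq : (p ;; q).modC u = (p.modC u || q.modC u) := by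
  rw [Bool.eq_iff_iff]
  simp [Prog.modC, Prog.modR]
  tauto
@[simp] theorem Prog.modC_count : (Prog.count v b p).modC u = p.modC u := by
  simp [Prog.count, Prog.modC, Prog.modR]
@[simp] theorem Prog.modCA_setN : (Prog.setN v e).modCA u = false := rfl
@[simp] theorem Prog.modCA_putN : (Prog.putN a i e).modCA u = false := rfl
@[simp] theorem Prog.modCA_setC : (Prog.setC r x).modCA u = false := rfl
@[simp] theorem Prog.modCA_putC : (Prog.putC a i x).modCA u = (a == u) := by
  rw [Bool.eq_iff_iff]
  simp [Prog.putC, Prog.modCA, Prog.modRA]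
  omega
@[simp] theorem Prog.modCA_seq : (p ;; q).modCA u = (p.modCA u || q.modCA u) := by
  rw [Bool.eq_iff_iff]
  simp [Prog.modCA, Prog.modRA]
  tauto
@[simp] theorem Prog.modCA_count : (Prog.count v b p).modCA u = p.modCA u := by
  simp [Prog.count, Prog.modCA, Prog.modRA]
@[simp] theorem Prog.modRA_setN : (Prog.setN v e).modRA u = false := rfl
@[simp] theorem Prog.modRA_putN : (Prog.putN a i e).modRA u = false := rfl
@[simp] theorem Prog.modRA_setC : (Prog.setC r x).modRA u = false := rfl
@[simp] theorem Prog.modRA_putC : (Prog.putC a i x).modRA 0 = false := by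
  simp [Prog.putC, Prog.modRA]
@[simp] theorem Prog.modRA_seq : (p ;; q).modRA u = (p.modRA u || q.modRA u) := rfl
@[simp] theorem Prog.modRA_count : (Prog.count v b p).modRA u = p.modRA u := by
  simp [Prog.count, Prog.modRA]

end

/-- Every cell that `p` may write is one that `q` may write. -/
structure Prog.Sub (p q : Prog) : Prop where
  n : ∀ u, q.modN u = false → p.modN u = false
  na : ∀ u, q.modNA u = false → p.modNA u = false
  c : ∀ u, q.modC u = false → p.modC u = false
  ca : ∀ u, q.modCA u = false → p.modCA u = false
  wd : q.modRA 0 = false → p.modRA 0 = false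

theorem Frame.weaken {p q : Prog} {s s' : CMem} (h : Frame p s s') (hpq : p.Sub q) :
    Frame q s s' :=
  ⟨fun u hu => h.n u (hpq.n u hu), fun u hu => h.na u (hpq.na u hu),
    fun u hu => h.c u (hpq.c u hu), fun u hu => h.ca u (hpq.ca u hu), fun hu => h.wd (hpq.wd hu)⟩

theorem Frame.setN {v : ℕ} (e : NExp) (s : CMem) (z : ℕ) : Frame (.setN v e) s (s.setN v z) :=
  ⟨fun u hu => by
    have : v ≠ u := by simpa using hu
    simp [this.symm], fun _ _ => rfl, fun _ _ => rfl, fun _ _ => rfl, fun _ => rfl⟩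

theorem Frame.putN {a : ℕ} (i e : NExp) (s : CMem) (j z : ℕ) :
    Frame (.putN a i e) s (s.putN a j z) :=
  ⟨fun _ _ => rfl, fun u hu => by
    have : a ≠ u := by simpa using hu
    simp [this.symm], fun _ _ => rfl, fun _ _ => rfl, fun _ => rfl⟩

theorem Frame.setC {r : ℕ} (x : CExp) (s : CMem) (z : ℂ) : Frame (.setC r x) s (s.setC r z) :=
  ⟨fun _ _ => rfl, fun _ _ => rfl, fun u hu => by
    have : r ≠ u := by simpa using hu
    simp [this.symm], fun _ _ => rfl, fun _ => rfl⟩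

/-! ## Sums and tables -/

/-- Store in the complex register `r` the sum of the values of `x`, the register `v` running through
`0, …, n - 1`, where `n` is the value of the register `b`. -/
def Prog.sum (v b r : ℕ) (x : CExp) : Prog :=
  .setC r (cn (nl 0)) ;; .count v b (.setC r (cr r + x))

theorem Runs.sum {v b r n : ℕ} {x : CExp} {s : CMem} (f : ℕ → ℂ) (hn : s.n b = n) (hb : v ≠ b)
    (hx : ∀ i < n, ∀ s', Frame (.sum v b r x) s s' → s'.n v = i → x.ev s' = f i) :
    Runs (.sum v b r x) s ((n + 1) * (x.cost + 24)) fun s' =>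
      s'.c r = ∑ i ∈ Finset.range n, f i := by
  refine Runs.le ?_ (Runs.seq (Runs.setC (Runs.count n
    (fun i s' => s'.c r = ∑ i ∈ Finset.range i, f i) (T := (cr r + x).cost + 4) ?_ ?_ ?_ ?_ ?_ ?_)))
  · have : (cr r + x).cost = x.cost + 4 := by
      change (CExp.add _ _).cost = _
      simp only [CExp.cost, CExp.parts, RExp.cost]
      omega
    rw [this]
    simp only [CExp.cost, CExp.parts, RExp.cost, NExp.cost]
    nlinarith
  · exact hn
  · simp
  · simpa using hb
  · simp
  · intro i hi s' hF hv hI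
    refine Runs.setC ?_
    have := hx i hi s' (Frame.trans (s' := s.setC r ((cn (nl 0)).ev s)) ?_ (hF.weaken ?_)) hv
    · simp [this, hI, Finset.sum_range_succ]
    · exact (Frame.setC (cn (nl 0)) _ _).weaken (by constructor <;> simp +contextual [Prog.sum])
    · constructor <;> simp [Prog.sum]
  · intro s' _ _ h
    exact h

/-- Tabulate a matrix: for all `a` and `b` below the value of the register `1`, put the number that
`p` leaves in the complex register `4` into the entry `a * d + b` of the array `x`. -/
def Prog.fill (x : ℕ) (p : Prog) : Prog :=
  .count 15 1 (.count 16 1 (p ;; .putC x (nr 15 * nr 1 + nr 16) (cr 4)))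

/-- Uniqueness of quotient and remainder. It keeps the row-major addresses of different entries
apart. -/
theorem mul_add_inj {a b a' b' d : ℕ} (hb : b < d) (hb' : b' < d)
    (h : a * d + b = a' * d + b') : a = a' ∧ b = b' := by
  have hd : 0 < d := by omega
  have h1 := congrArg (· / d) h
  have h2 := congrArg (· % d) h
  simp only [Nat.mul_comm _ d] at h1 h2
  simp [Nat.mul_add_div hd, Nat.div_eq_of_lt hb, Nat.div_eq_of_lt hb',
    Nat.mod_eq_of_lt hb, Nat.mod_eq_of_lt hb'] at h1 h2
  exact ⟨h1, h2⟩

theorem Runs.fill {x d T : ℕ} {p : Prog} {s : CMem} (F : ℕ → ℕ → ℂ) (hd : s.n 1 = d)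
    (h1 : p.modN 1 = false) (h15 : p.modN 15 = false) (h16 : p.modN 16 = false)
    (hx : p.modCA x = false)
    (hp : ∀ a < d, ∀ b < d, ∀ s', Frame (.fill x p) s s' → s'.n 15 = a → s'.n 16 = b →
      Runs p s' T fun s'' => s''.c 4 = F a b) :
    Runs (.fill x p) s ((d + 1) * ((d + 1) * (T + 40) + 8)) fun s' =>
      ∀ a < d, ∀ b < d, s'.ca x (a * d + b) = F a b := by
  refine Runs.le ?_ (Runs.count d
    (fun i s' => ∀ a < i, ∀ b < d, s'.ca x (a * d + b) = F a b) hd ?_ ?_ ?_ ?_ ?_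
    (T := (d + 1) * (T + 26 + 8)))
  · nlinarith
  · simp [h15]
  · simp [h1]
  · simp
  · intro a ha s1 hF1 hv1 hI1
    have hd1 : s1.n 1 = d := (hF1.n 1 (by simp [h1])).trans hd
    refine Runs.le (by nlinarith) (Runs.count d
      (fun i s' => (∀ a' < a, ∀ b < d, s'.ca x (a' * d + b) = F a' b) ∧
        ∀ b < i, s'.ca x (a * d + b) = F a b) hd1 ?_ ?_ ?_ ?_ ?_ (T := T + 26))
    · simp [h16]
    · simp [h1]
    · simpa using hI1
    · intro b hb s2 hF2 hv2 hI2
      refine Runs.seq (T := T) (U := 26) (Runs.call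
        (hp a ha b hb s2 (hF1.trans (hF2.weaken ?_)) ?_ hv2) ?_)
      · constructor <;> simp
      · rw [hF2.n 15 (by simp [h15]), hv1]
      · intro s3 hF3 hc
        refine Runs.le (by decide) (Runs.putC ?_)
        have g1 : s3.n 1 = d := by rw [hF3.n 1 h1, hF2.n 1 (by simp [h1]), hd1]
        have g15 : s3.n 15 = a := by rw [hF3.n 15 h15, hF2.n 15 (by simp [h15]), hv1]
        have g16 : s3.n 16 = b := by rw [hF3.n 16 h16, hv2]
        have gx : s3.ca x = s2.ca x := hF3.ca x hx
        simp only [NExp.ev_add, NExp.ev_mul, NExp.ev_reg, CExp.ev_reg, CMem.setN_ca, CMem.putC_ca,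
          Function.update_self, g1, g15, g16, gx, hc]
        refine ⟨fun a' ha' b' hb' => ?_, fun b' hb' => ?_⟩
        · rw [Function.update_of_ne, hI2.1 a' ha' b' hb']
          intro h
          have := mul_add_inj hb' hb h
          omega
        · rcases eq_or_ne b' b with rfl | hne
          · simp
          · rw [Function.update_of_ne (by omega), hI2.2 b' (by omega)]
    · intro s2 hF2 hv2 hI2 a' ha' b hb
      simp only [CMem.setN_ca]
      rcases eq_or_ne a' a with rfl | hne
      · exact hI2.2 b hb
      · exact hI2.1 a' (by omega) b hb
  · intro s' _ _ h
    exact h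

end RealRAM

namespace RealRAM

/-! ## Matrix routines -/

/-- The `d × d` matrix that is stored, row by row, as the block `o` of an array. -/
def matAt (d : ℕ) (f : ℕ → ℂ) (o : ℕ) : Matrix (Fin d) (Fin d) ℂ :=
  Matrix.of fun a b => f ((o * d + a) * d + b)

theorem matAt_zero_eq {d : ℕ} {f : ℕ → ℂ} {B : Matrix (Fin d) (Fin d) ℂ}
    (h : ∀ (a : ℕ) (ha : a < d) (b : ℕ) (hb : b < d), f (a * d + b) = B ⟨a, ha⟩ ⟨b, hb⟩) :
    matAt d f 0 = B := by
  ext a b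
  simp [matAt, h a a.2 b b.2]

/-- The entry of the unit matrix for the row and column in the registers `15` and `16`. -/
def unitEntry : CExp := cn (nl 1 - (nr 15 - nr 16) - (nr 16 - nr 15))

/-- Under truncated subtraction `a - b` and `b - a` both vanish only for `a = b`, so the Kronecker
symbol needs no branching. -/
theorem unitEntry_ev {s : CMem} {a b : ℕ} (ha : s.n 15 = a) (hb : s.n 16 = b) :
    unitEntry.ev s = if a = b then 1 else 0 := by
  simp only [unitEntry, CExp.ev_ofN, NExp.ev_sub, NExp.ev_lit, NExp.ev_reg, ha, hb]
  split_ifs with h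
  · simp [h]
  · have : 1 - (a - b) - (b - a) = 0 := by omega
    simp [this]

/-- Store in the array `2` the matrix `r - G`, where `r` is the complex register `3` and `G` is the
Hermitian part of `∑ i, conj (x i) • B i`; here `x` is the array `5` and `B` are the operators of
the party in the register `10`. -/
def buildMat : Prog :=
  .fill 2 (.sum 14 2 4 ((.conj (.get 5 (nr 14)) *
        .get 0 (((nr 10 * nr 2 + nr 14) * nr 1 + nr 15) * nr 1 + nr 16) +
      .get 5 (nr 14) *
        .conj (.get 0 (((nr 10 * nr 2 + nr 14) * nr 1 + nr 16) * nr 1 + nr 15))) / cn (nl 2)) ;;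
    .setC 4 (cr 3 * unitEntry - cr 4))

theorem buildMat_runs {d M : ℕ} {s : CMem} (hd : s.n 1 = d) (hM : s.n 2 = M) :
    Runs buildMat s ((d + 1) * ((d + 1) * ((M + 1) * 400 + 100) + 8)) fun s' =>
      matAt d (s'.ca 2) 0 = s.c 3 • (1 : Matrix (Fin d) (Fin d) ℂ) -
        hermPart (∑ i : Fin M, (starRingEnd ℂ) (s.ca 5 i) •
          matAt d (s.ca 0) (s.n 10 * M + i)) := by
  refine (Runs.fill (T := (M + 1) * 400 + 60) (fun a b => s.c 3 * (if a = b then 1 else 0) -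
    ∑ i ∈ Finset.range M, ((starRingEnd ℂ) (s.ca 5 i) *
      s.ca 0 (((s.n 10 * M + i) * d + a) * d + b) + s.ca 5 i *
      (starRingEnd ℂ) (s.ca 0 (((s.n 10 * M + i) * d + b) * d + a))) / 2) hd (by decide) (by decide)
      (by decide) (by decide) ?_).mono (by gcongr) ?_
  · intro a ha b hb s1 hF ha1 hb1
    refine Runs.le ?_ (Runs.seq (Runs.call (Runs.sum (n := M) (fun i =>
      ((starRingEnd ℂ) (s.ca 5 i) *
      s.ca 0 (((s.n 10 * M + i) * d + a) * d + b) + s.ca 5 i *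
      (starRingEnd ℂ) (s.ca 0 (((s.n 10 * M + i) * d + b) * d + a))) / 2) ?_ (by decide) ?_) ?_)
      (U := 60))
    · gcongr
      decide
    · simpa (disch := decide) [hF.n] using hM
    · intro i hi s2 hF2 hi2
      simp (disch := decide) [hF2.n, hF2.ca, hF.n, hF.ca, hd, hM, hi2, ha1, hb1]
    · intro s2 hF2 h2
      refine Runs.le (by decide) (Runs.setC ?_)
      have := unitEntry_ev (s := s2) (a := a) (b := b)
        (by simpa (disch := decide) [hF2.n] using ha1)
        (by simpa (disch := decide) [hF2.n] using hb1)
      simp (disch := decide) [h2, this, hF2.c, hF.c]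
  · intro s' h
    refine matAt_zero_eq fun a ha b hb => ?_
    rw [h a ha b hb, Finset.sum_range]
    simp [hermPart, matAt, Matrix.sum_apply, Matrix.one_apply, Fin.ext_iff, Finset.mul_sum,
      ← Finset.sum_add_distrib]
    refine Finset.sum_congr rfl fun i _ => ?_
    ring

/-- Store the product of the matrices in the arrays `2` and `3` in the array `6`. -/
def mulMat : Prog :=
  .fill 6 (.sum 17 1 4 (.get 2 (nr 15 * nr 1 + nr 17) * .get 3 (nr 17 * nr 1 + nr 16)))

theorem mulMat_runs {d : ℕ} {s : CMem} (hd : s.n 1 = d) :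
    Runs mulMat s ((d + 1) * ((d + 1) * ((d + 1) * 100 + 40) + 8)) fun s' =>
      matAt d (s'.ca 6) 0 = matAt d (s.ca 2) 0 * matAt d (s.ca 3) 0 := by
  refine (Runs.fill (T := (d + 1) * 100) (fun a b =>
    ∑ i ∈ Finset.range d, s.ca 2 (a * d + i) * s.ca 3 (i * d + b)) hd (by decide) (by decide)
      (by decide) (by decide) ?_).mono le_rfl ?_
  · intro a ha b hb s1 hF ha1 hb1
    refine Runs.le ?_ (Runs.sum (n := d) _ ?_ (by decide) ?_)
    · gcongr
      decide
    · simpa (disch := decide) [hF.n] using hd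
    · intro i hi s2 hF2 hi2
      simp (disch := decide) [hF2.n, hF2.ca, hF.n, hF.ca, hd, hi2, ha1, hb1]
  · intro s' h
    refine matAt_zero_eq fun a ha b hb => ?_
    rw [h a ha b hb, Finset.sum_range]
    simp [matAt, Matrix.mul_apply]

/-- Copy the matrix in the array `6` to the array `3`. -/
def copyMat : Prog := .fill 3 (.setC 4 (.get 6 (nr 15 * nr 1 + nr 16)))

theorem copyMat_runs {d : ℕ} {s : CMem} (hd : s.n 1 = d) :
    Runs copyMat s ((d + 1) * ((d + 1) * 60 + 8)) fun s' =>
      matAt d (s'.ca 3) 0 = matAt d (s.ca 6) 0 := by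
  refine (Runs.fill (T := 20) (fun a b => s.ca 6 (a * d + b)) hd (by decide) (by decide)
      (by decide) (by decide) ?_).mono le_rfl ?_
  · intro a ha b hb s1 hF ha1 hb1
    refine Runs.le (by decide) (Runs.setC ?_)
    simp (disch := decide) [hF.n, hF.ca, hd, ha1, hb1]
  · intro s' h
    refine matAt_zero_eq fun a ha b hb => ?_
    rw [h a ha b hb]
    simp [matAt]

/-- Store the unit matrix in the array `3`. -/
def unitMat : Prog := .fill 3 (.setC 4 unitEntry)

theorem unitMat_runs {d : ℕ} {s : CMem} (hd : s.n 1 = d) :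
    Runs unitMat s ((d + 1) * ((d + 1) * 60 + 8)) fun s' => matAt d (s'.ca 3) 0 = 1 := by
  refine (Runs.fill (T := 20) (fun a b => if a = b then 1 else 0) hd (by decide) (by decide)
      (by decide) (by decide) ?_).mono le_rfl ?_
  · intro a ha b hb s1 hF ha1 hb1
    refine Runs.le (by decide) (Runs.setC ?_)
    simp [unitEntry_ev ha1 hb1]
  · intro s' h
    refine matAt_zero_eq fun a ha b hb => ?_
    rw [h a ha b hb]
    simp [Matrix.one_apply]

/-- Store in the array `3` the power of the matrix in the array `2` whose exponent is in the
register `19`. -/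
def powMat : Prog := unitMat ;; .count 18 19 (mulMat ;; copyMat)

/-- Plain repeated multiplication suffices: the exponents that occur are polynomial in the sizes, so
a cost linear in `N` is affordable. -/
theorem powMat_runs {d N : ℕ} {s : CMem} (hd : s.n 1 = d) (hN : s.n 19 = N) :
    Runs powMat s ((N + 2) * ((d + 1) * ((d + 1) * ((d + 1) * 100 + 100) + 24))) fun s' =>
      matAt d (s'.ca 3) 0 = matAt d (s.ca 2) 0 ^ N := by
  refine Runs.le ?_ (Runs.seq (Runs.call (unitMat_runs hd) fun s1 hF1 h1 => Runs.count N
    (T := (d + 1) * ((d + 1) * ((d + 1) * 100 + 100) + 16))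
    (fun i s' => matAt d (s'.ca 3) 0 = matAt d (s.ca 2) 0 ^ i) ?_ (by decide) (by decide) ?_ ?_ ?_))
  · have : (d + 1) * ((d + 1) * 60 + 8) ≤ (d + 1) * ((d + 1) * ((d + 1) * 100 + 100) + 24) := by
      gcongr <;> omega
    have : (N + 1) * ((d + 1) * ((d + 1) * ((d + 1) * 100 + 100) + 16) + 8) ≤
        (N + 1) * ((d + 1) * ((d + 1) * ((d + 1) * 100 + 100) + 24)) := by
      gcongr
      nlinarith
    linarith
  · simpa (disch := decide) [hF1.n] using hN
  · simpa using h1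
  · intro i hi s2 hF2 hi2 hI
    have hd2 : s2.n 1 = d := by simpa (disch := decide) [hF2.n, hF1.n] using hd
    refine Runs.le ?_ (Runs.seq (Runs.call (mulMat_runs hd2) fun s3 hF3 h3 =>
      Runs.call (copyMat_runs (d := d) ?_) fun s4 hF4 h4 => ?_))
    · nlinarith
    · simpa (disch := decide) [hF3.n] using hd2
    · simp (disch := decide) only [CMem.setN_ca, h4, h3, hF2.ca, hF1.ca, hI, pow_succ']
  · intro s2 _ _ h
    exact h

/-- Store the trace of the matrix in the array `3` in the complex register `5`. -/
def trMat : Prog := .sum 15 1 5 (.get 3 (nr 15 * nr 1 + nr 15))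

theorem trMat_runs {d : ℕ} {s : CMem} (hd : s.n 1 = d) :
    Runs trMat s ((d + 1) * 60) fun s' => s'.c 5 = (matAt d (s.ca 3) 0).trace := by
  refine (Runs.sum (fun i => s.ca 3 (i * d + i)) hd (by decide) ?_).mono ?_ ?_
  · intro i hi s2 hF2 hi2
    simp (disch := decide) [hF2.n, hF2.ca, hd, hi2]
  · gcongr
    decide
  · intro s' h
    rw [h, Finset.sum_range]
    simp [matAt, Matrix.trace]

/-- Store in the complex register `4` the trace of the product of two matrices: the block of the
array `x` whose number is in the register `25`, and the matrix in the array `3`. -/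
def trMulMat (x : ℕ) : Prog :=
  .setC 4 (cn (nl 0)) ;; .count 15 1
    (.sum 16 1 6 (.get x ((nr 25 * nr 1 + nr 15) * nr 1 + nr 16) * .get 3 (nr 16 * nr 1 + nr 15)) ;;
      .setC 4 (cr 4 + cr 6))

theorem trMulMat_runs {d : ℕ} {s : CMem} (x : ℕ) (hd : s.n 1 = d) :
    Runs (trMulMat x) s ((d + 1) * ((d + 1) * 120 + 40)) fun s' =>
      s'.c 4 = (matAt d (s.ca x) (s.n 25) * matAt d (s.ca 3) 0).trace := by
  refine Runs.le ?_ (Runs.seq (Runs.setC (Runs.count d (T := (d + 1) * 120 + 20)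
    (fun i s' => s'.c 4 = ∑ a ∈ Finset.range i, ∑ b ∈ Finset.range d,
      s.ca x ((s.n 25 * d + a) * d + b) * s.ca 3 (b * d + a)) ?_ ?_ ?_ ?_ ?_ ?_)))
  · change 8 + _ ≤ _
    nlinarith
  · exact hd
  · simp [Prog.sum]
  · simp [Prog.sum]
  · simp
  · intro a ha s1 hF1 ha1 hI
    have hd1 : s1.n 1 = d := by rw [hF1.n 1 (by simp [Prog.sum])]; exact hd
    refine Runs.le ?_ (Runs.seq (Runs.call (Runs.sum (n := d) (fun b =>
      s.ca x ((s.n 25 * d + a) * d + b) * s.ca 3 (b * d + a)) hd1 (by decide) ?_) ?_) (U := 20))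
    · gcongr
      exact Nat.le_of_ble_eq_true rfl
    · intro b hb s2 hF2 hb2
      have e1 : s2.n 1 = d := by rw [hF2.n 1 (by simp [Prog.sum]), hd1]
      have e2 : s2.n 15 = a := by rw [hF2.n 15 (by simp [Prog.sum]), ha1]
      have e3 : s2.n 25 = s.n 25 := by
        rw [hF2.n 25 (by simp [Prog.sum]), hF1.n 25 (by simp [Prog.sum])]
        rfl
      have e4 : ∀ x, s2.ca x = s.ca x := fun x => by
        rw [hF2.ca x (by simp [Prog.sum]), hF1.ca x (by simp [Prog.sum])]
        rfl
      simp [e1, e2, e3, e4, hb2]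
    · intro s2 hF2 h2
      refine Runs.le (by decide) (Runs.setC ?_)
      have e1 : s2.c 4 = s1.c 4 := hF2.c 4 (by simp [Prog.sum])
      simp [h2, e1, hI, Finset.sum_range_succ]
  · intro s' _ _ h
    rw [h, Finset.sum_range]
    simp [matAt, Matrix.trace, Matrix.mul_apply, Finset.sum_range]

end RealRAM

section

/-! ## Traces against density operators -/

open Matrix

open scoped ComplexOrder in
/-- A Hermitian matrix in diagonal form. -/
theorem Matrix.IsHermitian.exists_diagonal {d : ℕ} {H : Matrix (Fin d) (Fin d) ℂ}
    (hH : H.IsHermitian) :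
    ∃ U : Matrix (Fin d) (Fin d) ℂ, U * Uᴴ = 1 ∧ Uᴴ * U = 1 ∧
      H = U * diagonal (fun i => (hH.eigenvalues i : ℂ)) * Uᴴ := by
  refine ⟨hH.eigenvectorUnitary, ?_, ?_, ?_⟩
  · exact Matrix.mem_unitaryGroup_iff.1 hH.eigenvectorUnitary.2
  · exact Matrix.mem_unitaryGroup_iff'.1 hH.eigenvectorUnitary.2
  · conv_lhs => rw [hH.spectral_theorem]
    rfl

variable {d : ℕ}

open scoped ComplexOrder in
theorem isDensity_diagonal {U : Matrix (Fin d) (Fin d) ℂ} (hU : Uᴴ * U = 1) {p : Fin d → ℝ}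
    (h0 : ∀ i, 0 ≤ p i) (h1 : ∑ i, p i = 1) :
    IsDensity (U * diagonal (fun i => (p i : ℂ)) * Uᴴ) := by
  refine ⟨PosSemidef.mul_mul_conjTranspose_same (PosSemidef.diagonal fun i => ?_) U, ?_⟩
  · simpa using h0 i
  · rw [trace_mul_cycle, hU, one_mul, trace_diagonal]
    exact_mod_cast h1

open scoped ComplexOrder in
/-- The weights of a density operator in an orthonormal basis. -/
theorem IsDensity.exists_weights {ρ : Matrix (Fin d) (Fin d) ℂ} (hρ : IsDensity ρ)
    {U : Matrix (Fin d) (Fin d) ℂ} (hU : U * Uᴴ = 1) :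
    ∃ p : Fin d → ℝ, (∀ i, 0 ≤ p i) ∧ ∑ i, p i = 1 ∧
      ∀ f : Fin d → ℂ, (U * diagonal f * Uᴴ * ρ).trace = ∑ i, f i * p i := by
  have hps : (Uᴴ * ρ * U).PosSemidef := hρ.1.conjTranspose_mul_mul_same U
  have hre : ∀ i, (Uᴴ * ρ * U) i i = (((Uᴴ * ρ * U) i i).re : ℂ) := fun i => by
    have := hps.diag_nonneg (i := i)
    rw [Complex.nonneg_iff] at this
    exact Complex.ext rfl (by simp [← this.2])
  refine ⟨fun i => ((Uᴴ * ρ * U) i i).re, fun i => ?_, ?_, fun f => ?_⟩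
  · have := hps.diag_nonneg (i := i)
    rw [Complex.nonneg_iff] at this
    exact this.1
  · have : (Uᴴ * ρ * U).trace = 1 := by
      rw [trace_mul_cycle, hU, one_mul, hρ.2]
    rw [trace] at this
    have h2 := congrArg Complex.re this
    simpa using h2
  · have : (U * diagonal f * Uᴴ * ρ).trace = (diagonal f * (Uᴴ * ρ * U)).trace := by
      rw [mul_assoc, mul_assoc, trace_mul_comm, mul_assoc]
    rw [this, trace]
    refine Finset.sum_congr rfl fun i _ => ?_
    rw [diag_apply, diagonal_mul, hre]

open scoped ComplexOrder in
theorem IsDensity.isHermitian {ρ : Matrix (Fin d) (Fin d) ℂ} (hρ : IsDensity ρ) :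
    ρ.IsHermitian := hρ.1.isHermitian

open scoped ComplexOrder in
-- In an eigenbasis of `H` the trace is a convex combination of the eigenvalues.
theorem re_trace_mul_le_of_eigenvalues_le {H : Matrix (Fin d) (Fin d) ℂ} (hH : H.IsHermitian)
    {c : ℝ} (hc : ∀ i, hH.eigenvalues i ≤ c) {ρ : Matrix (Fin d) (Fin d) ℂ} (hρ : IsDensity ρ) :
    (H * ρ).trace.re ≤ c := by
  obtain ⟨U, hU, -, h⟩ := hH.exists_diagonal
  obtain ⟨p, h0, h1, h2⟩ := hρ.exists_weights hU
  conv_lhs => rw [h, h2]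
  rw [Complex.re_sum]
  calc ∑ i, ((hH.eigenvalues i : ℂ) * (p i : ℂ)).re ≤ ∑ i, c * p i := by
        refine Finset.sum_le_sum fun i _ => ?_
        simpa using mul_le_mul_of_nonneg_right (hc i) (h0 i)
    _ = c := by rw [← Finset.mul_sum, h1, mul_one]

/-- The state is the projector onto the `i`-th eigenvector, written as the diagonal weight
`Pi.single i 1` in the eigenbasis. -/
theorem exists_density_trace_eq_eigenvalue {H : Matrix (Fin d) (Fin d) ℂ} (hH : H.IsHermitian)
    (i : Fin d) : ∃ ρ, IsDensity ρ ∧ (H * ρ).trace = (hH.eigenvalues i : ℂ) := by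
  obtain ⟨U, hU, hU', h⟩ := hH.exists_diagonal
  refine ⟨_, isDensity_diagonal hU' (p := Pi.single i 1) (fun j => ?_) (by simp), ?_⟩
  · rcases eq_or_ne j i with rfl | hj <;> simp [*]
  · have : H * (U * diagonal (fun j => ((Pi.single i 1 : Fin d → ℝ) j : ℂ)) * Uᴴ) =
        U * (diagonal (fun j => (hH.eigenvalues j : ℂ)) *
          diagonal (fun j => ((Pi.single i 1 : Fin d → ℝ) j : ℂ))) * Uᴴ := by
      conv_lhs => rw [h]
      simp only [mul_assoc]
      rw [← mul_assoc Uᴴ U, hU', one_mul]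
    rw [this, trace_mul_cycle, hU', one_mul, diagonal_mul_diagonal, trace_diagonal,
      Finset.sum_eq_single i]
    · simp
    · intro j _ hj
      simp [hj]
    · simp

open scoped ComplexOrder in
-- In an eigenbasis of `ρ` the trace is a convex combination of the numbers `⟨v, B v⟩` with unit
-- vectors `v`, each of modulus at most the operator norm.
theorem norm_trace_mul_le (B : Matrix (Fin d) (Fin d) ℂ) {ρ : Matrix (Fin d) (Fin d) ℂ}
    (hρ : IsDensity ρ) : ‖(B * ρ).trace‖ ≤ opNorm B := by
  have hH := hρ.1.isHermitian
  set U : Matrix (Fin d) (Fin d) ℂ := hH.eigenvectorUnitary.1 with hUdef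
  have hU' : Uᴴ * U = 1 := Matrix.mem_unitaryGroup_iff'.1 hH.eigenvectorUnitary.2
  have h : ρ = U * diagonal (fun i => (hH.eigenvalues i : ℂ)) * Uᴴ := by
    conv_lhs => rw [hH.spectral_theorem]
    rfl
  have h1 : (B * ρ).trace = ∑ i, (Uᴴ * B * U) i i * (hH.eigenvalues i : ℂ) := by
    have : (B * ρ).trace = (Uᴴ * B * U * diagonal (fun i => (hH.eigenvalues i : ℂ))).trace := by
      conv_lhs => rw [h]
      rw [← mul_assoc, trace_mul_comm]
      simp only [mul_assoc]
    rw [this, trace]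
    refine Finset.sum_congr rfl fun i _ => ?_
    rw [diag_apply, mul_diagonal]
  have h2 : ∀ i, ‖(Uᴴ * B * U) i i‖ ≤ opNorm B := fun i => by
    have e : (Uᴴ * B * U) i i = inner ℂ (hH.eigenvectorBasis i)
        (Matrix.toEuclideanCLM (n := Fin d) (𝕜 := ℂ) B (hH.eigenvectorBasis i)) := by
      rw [EuclideanSpace.inner_eq_star_dotProduct, Matrix.ofLp_toEuclideanCLM, dotProduct_comm,
        mul_assoc, mul_apply, dotProduct]
      refine Finset.sum_congr rfl fun a _ => ?_
      simp [hUdef, conjTranspose_apply, mul_apply, mulVec, dotProduct]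
    rw [e]
    refine (norm_inner_le_norm _ _).trans ?_
    have hn : ‖hH.eigenvectorBasis i‖ = 1 := hH.eigenvectorBasis.orthonormal.1 i
    rw [hn, one_mul]
    refine (ContinuousLinearMap.le_opNorm _ _).trans ?_
    rw [hn, mul_one]
    rfl
  have h3 : ∑ i, hH.eigenvalues i = 1 := by
    have := hH.trace_eq_sum_eigenvalues
    rw [hρ.2] at this
    have h4 := congrArg Complex.re this
    simpa using h4.symm
  rw [h1]
  calc ‖∑ i, (Uᴴ * B * U) i i * (hH.eigenvalues i : ℂ)‖
      ≤ ∑ i, opNorm B * hH.eigenvalues i := by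
        refine (norm_sum_le _ _).trans (Finset.sum_le_sum fun i _ => ?_)
        rw [norm_mul, Complex.norm_real, Real.norm_of_nonneg (hρ.1.eigenvalues_nonneg i)]
        exact mul_le_mul_of_nonneg_right (h2 i) (hρ.1.eigenvalues_nonneg i)
    _ = opNorm B := by rw [← Finset.mul_sum, h3, mul_one]

theorem isHermitian_hermPart (B : Matrix (Fin d) (Fin d) ℂ) : (hermPart B).IsHermitian := by
  simp [hermPart, Matrix.IsHermitian, conjTranspose_smul, add_comm]

theorem re_trace_hermPart_mul (B : Matrix (Fin d) (Fin d) ℂ) {ρ : Matrix (Fin d) (Fin d) ℂ}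
    (hρ : ρ.IsHermitian) : (hermPart B * ρ).trace.re = (B * ρ).trace.re := by
  have h : (Bᴴ * ρ).trace.re = (B * ρ).trace.re := by
    have : (Bᴴ * ρ).trace = star ((B * ρ).trace) := by
      rw [← trace_conjTranspose, conjTranspose_mul, hρ.eq, trace_mul_comm]
    rw [this]
    simp
  have e : (hermPart B * ρ).trace = (1 / 2 : ℝ) * ((B * ρ).trace + (Bᴴ * ρ).trace) := by
    simp [hermPart, add_mul, mul_add]
  rw [e, Complex.re_ofReal_mul, Complex.add_re, h]
  ring

theorem lambdaMax_eq_iSup {H : Matrix (Fin d) (Fin d) ℂ} (hH : H.IsHermitian) :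
    lambdaMax H = ⨆ i, hH.eigenvalues i := by
  rw [lambdaMax, hH.spectrum_real_eq_range_eigenvalues, iSup]

theorem re_trace_mul_le_lambdaMax {H : Matrix (Fin d) (Fin d) ℂ} (hH : H.IsHermitian)
    {ρ : Matrix (Fin d) (Fin d) ℂ} (hρ : IsDensity ρ) : (H * ρ).trace.re ≤ lambdaMax H := by
  refine re_trace_mul_le_of_eigenvalues_le hH (fun i => ?_) hρ
  rw [lambdaMax_eq_iSup hH]
  exact le_ciSup (Set.finite_range _).bddAbove i

theorem exists_density_trace_eq_lambdaMax (hd : 0 < d) {H : Matrix (Fin d) (Fin d) ℂ}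
    (hH : H.IsHermitian) : ∃ ρ, IsDensity ρ ∧ (H * ρ).trace.re = lambdaMax H := by
  have : Nonempty (Fin d) := ⟨⟨0, hd⟩⟩
  obtain ⟨i, hi⟩ := exists_eq_ciSup_of_finite (f := hH.eigenvalues)
  obtain ⟨ρ, h1, h2⟩ := exists_density_trace_eq_eigenvalue hH i
  exact ⟨ρ, h1, by rw [h2, lambdaMax_eq_iSup hH, ← hi]; rfl⟩

/-! ## Powers of a positive matrix approximate its top eigenspace -/

/-- Replace each of the `N` copies of `x ^ N` by the larger `x ^ i` with `i < N`; the geometric sum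
times `1 - x` is `1 - x ^ N`. -/
theorem pow_mul_one_sub_le {x : ℝ} (h0 : 0 ≤ x) (h1 : x ≤ 1) (N : ℕ) :
    N * (x ^ N * (1 - x)) ≤ 1 := by
  have h : ∑ i ∈ Finset.range N, x ^ N * (1 - x) ≤ ∑ i ∈ Finset.range N, x ^ i * (1 - x) :=
    Finset.sum_le_sum fun i hi => mul_le_mul_of_nonneg_right
      (pow_le_pow_of_le_one h0 h1 (Finset.mem_range.1 hi).le) (by linarith)
  rw [Finset.sum_const, Finset.card_range, nsmul_eq_mul, ← Finset.sum_mul,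
    geom_sum_mul_of_le_one h1] at h
  have := pow_nonneg h0 N
  linarith

/-- The density operator that is proportional to the power `P ^ N`. -/
noncomputable def gibbs (P : Matrix (Fin d) (Fin d) ℂ) (N : ℕ) : Matrix (Fin d) (Fin d) ℂ :=
  (P ^ N).trace⁻¹ • P ^ N

/-- The state gives the eigenvalue `l i` a weight proportional to `l i ^ N`. With the top eigenvalue
`l j` and `x = l i / l j`, `pow_mul_one_sub_le` yields `l i ^ N * (l j - l i) ≤ l j ^ (N + 1) / N`.
Summing `d` such terms and dividing by `∑ l i ^ N ≥ l j ^ N` bounds the loss by `d * l j / N`. No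
spectral gap enters. -/
theorem gibbs_spec (hd : 0 < d) {P : Matrix (Fin d) (Fin d) ℂ} (hP : P.IsHermitian) {Λ : ℝ}
    (h0 : ∀ i, 0 < hP.eigenvalues i) (hΛ : ∀ i, hP.eigenvalues i ≤ Λ) {N : ℕ} (hN : 0 < N) :
    IsDensity (gibbs P N) ∧ ∀ ρ, IsDensity ρ →
      (P * ρ).trace.re ≤ (P * gibbs P N).trace.re + Λ * d / N := by
  have : Nonempty (Fin d) := ⟨⟨0, hd⟩⟩
  obtain ⟨U, hU, hU', h⟩ := hP.exists_diagonal
  set l := hP.eigenvalues with hl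
  have hpow : ∀ n : ℕ, P ^ n = U * diagonal (fun i => ((l i ^ n : ℝ) : ℂ)) * Uᴴ := by
    intro n
    induction n with
    | zero =>
      have : (fun i : Fin d => ((l i ^ 0 : ℝ) : ℂ)) = 1 := by ext; simp
      rw [this, diagonal_one', pow_zero, mul_one, hU]
    | succ n ih =>
      conv_lhs => rw [pow_succ, ih, h]
      simp only [mul_assoc]
      rw [← mul_assoc Uᴴ U, hU', one_mul, ← mul_assoc (diagonal _), diagonal_mul_diagonal]
      simp only [pow_succ, Complex.ofReal_mul]
  have htr : ∀ n : ℕ, (P ^ n).trace = ((∑ i, l i ^ n : ℝ) : ℂ) := by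
    intro n
    rw [hpow, trace_mul_cycle, hU', one_mul, trace_diagonal, Complex.ofReal_sum]
  have hpos : 0 < ∑ i, l i ^ N := Finset.sum_pos (fun i _ => pow_pos (h0 i) N) Finset.univ_nonempty
  have hden : IsDensity (gibbs P N) := by
    have : gibbs P N = U * diagonal (fun i => ((l i ^ N / ∑ j, l j ^ N : ℝ) : ℂ)) * Uᴴ := by
      rw [gibbs, htr, hpow, ← smul_mul_assoc, ← mul_smul_comm, ← diagonal_smul]
      congr 3
      ext i
      simp only [Pi.smul_apply, smul_eq_mul, Complex.ofReal_div]
      rw [div_eq_inv_mul]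
    rw [this]
    refine isDensity_diagonal hU' (fun i => ?_) ?_
    · exact div_nonneg (pow_nonneg (h0 i).le N) hpos.le
    · rw [← Finset.sum_div, div_self hpos.ne']
  refine ⟨hden, fun ρ hρ => ?_⟩
  have hval : (P * gibbs P N).trace.re = (∑ i, l i ^ (N + 1)) / ∑ i, l i ^ N := by
    rw [gibbs, mul_smul_comm, ← pow_succ', trace_smul, htr, htr, smul_eq_mul, ← Complex.ofReal_inv,
      ← Complex.ofReal_mul, Complex.ofReal_re, div_eq_inv_mul]
  obtain ⟨j, hj⟩ := exists_eq_ciSup_of_finite (f := l)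
  have hmax : ∀ i, l i ≤ l j := fun i => by
    rw [hj]
    exact le_ciSup (Set.finite_range _).bddAbove i
  refine (re_trace_mul_le_of_eigenvalues_le hP hmax hρ).trans ?_
  have hN' : (0 : ℝ) < N := by exact_mod_cast hN
  have hlj : 0 < l j := h0 j
  have hterm : ∀ i, l i ^ N * (l j - l i) ≤ l j ^ N * l j / N := fun i => by
    have h1 := pow_mul_one_sub_le (div_nonneg (h0 i).le hlj.le)
      ((div_le_one hlj).2 (hmax i)) N
    rw [le_div_iff₀ hN']
    have e : l i ^ N * (l j - l i) * N =
        (N * ((l i / l j) ^ N * (1 - l i / l j))) * (l j ^ N * l j) := by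
      rw [div_pow]
      field_simp
    rw [e]
    exact (mul_le_mul_of_nonneg_right h1 (by positivity)).trans_eq (one_mul _)
  have hsum : l j * ∑ i, l i ^ N - ∑ i, l i ^ (N + 1) ≤ d * (l j ^ N * l j / N) := by
    rw [Finset.mul_sum, ← Finset.sum_sub_distrib]
    calc ∑ i, (l j * l i ^ N - l i ^ (N + 1)) = ∑ i, l i ^ N * (l j - l i) := by
          refine Finset.sum_congr rfl fun i _ => ?_
          ring
      _ ≤ ∑ i : Fin d, l j ^ N * l j / N := Finset.sum_le_sum fun i _ => hterm i
      _ = _ := by simp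
  have hle : l j ^ N ≤ ∑ i, l i ^ N :=
    Finset.single_le_sum (f := fun i => l i ^ N) (fun i _ => (pow_nonneg (h0 i).le N))
      (Finset.mem_univ j)
  rw [hval, ← sub_le_iff_le_add', sub_le_iff_le_add', ← sub_le_iff_le_add]
  rw [le_div_iff₀ hpos, sub_mul]
  have h5 : (d : ℝ) * (l j ^ N * l j / N) ≤ Λ * d / N * ∑ i, l i ^ N := by
    have : (d : ℝ) * (l j ^ N * l j / N) = l j * d / N * l j ^ N := by ring
    rw [this]
    have hΛj := hΛ j
    have hΛ0 : 0 ≤ Λ := hlj.le.trans hΛj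
    gcongr
  linarith

/-- The same for `r - G`, where `G` is small. -/
theorem gibbs_sub_spec (hd : 0 < d) {G : Matrix (Fin d) (Fin d) ℂ} (hG : G.IsHermitian) {R : ℝ}
    (hR : 0 < R) (hb : ∀ ρ, IsDensity ρ → |(G * ρ).trace.re| ≤ R) {N : ℕ} (hN : 0 < N) :
    IsDensity (gibbs (((2 * R : ℝ) : ℂ) • 1 - G) N) ∧ ∀ ρ, IsDensity ρ →
      (G * gibbs (((2 * R : ℝ) : ℂ) • 1 - G) N).trace.re ≤ (G * ρ).trace.re + 3 * R * d / N := by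
  set P := ((2 * R : ℝ) : ℂ) • 1 - G with hPdef
  have hP : P.IsHermitian := by
    refine Matrix.IsHermitian.sub ?_ hG
    simp [Matrix.IsHermitian, conjTranspose_smul]
  have htr : ∀ ρ, IsDensity ρ → (P * ρ).trace.re = 2 * R - (G * ρ).trace.re := fun ρ hρ => by
    rw [hPdef, sub_mul, trace_sub, smul_mul_assoc, one_mul, trace_smul, hρ.2, Complex.sub_re,
      smul_eq_mul, mul_one, Complex.ofReal_re]
  -- Each eigenvalue is a value `2 R - Tr (G ρ)`. The lower bound supplies the positivity that
  -- `gibbs_spec` needs, the upper bound is its `Λ`.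
  have hev : ∀ i, R ≤ hP.eigenvalues i ∧ hP.eigenvalues i ≤ 3 * R := fun i => by
    obtain ⟨ρ, h1, h2⟩ := exists_density_trace_eq_eigenvalue hP i
    have h3 := htr ρ h1
    rw [h2, Complex.ofReal_re] at h3
    have := abs_le.1 (hb ρ h1)
    constructor <;> linarith
  obtain ⟨h1, h2⟩ := gibbs_spec hd hP (fun i => hR.trans_le (hev i).1) (fun i => (hev i).2) hN
  refine ⟨h1, fun ρ hρ => ?_⟩
  have := h2 ρ hρ
  rw [htr ρ hρ, htr _ h1] at this
  linarith

end

section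

/-! ## Product states and the last operator -/

open Matrix

theorem trace_tensorOp_mul {k d : ℕ} (B C : Fin k → Matrix (Fin d) (Fin d) ℂ) :
    (tensorOp B * tensorOp C).trace = ∏ t, (B t * C t).trace := by
  simp only [trace, diag_apply, mul_apply, tensorOp, of_apply]
  have h : ∀ a : Fin k → Fin d, ∑ b : Fin k → Fin d,
      (∏ t, B t (a t) (b t)) * ∏ t, C t (b t) (a t) =
        ∏ t, ∑ j, B t (a t) j * C t j (a t) := fun a => by
    rw [Finset.prod_univ_sum, Fintype.piFinset_univ]
    exact Finset.sum_congr rfl fun b _ => Finset.prod_mul_distrib.symm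
  simp only [h]
  rw [Finset.prod_univ_sum, Fintype.piFinset_univ]

section
variable {m d M : ℕ} {w : Fin (m + 1) → ℝ} {A : Fin (m + 1) → Fin M → Matrix (Fin d) (Fin d) ℂ}
  {Q : MultiOp (m + 1) d}

theorem trace_lastOp_mul (A : Fin (m + 1) → Fin M → Matrix (Fin d) (Fin d) ℂ)
    (q : Fin m → Fin M → ℂ) (ρ : Matrix (Fin d) (Fin d) ℂ) :
    (lastOp A q * ρ).trace = ∑ i, (∏ t, q t i) * (A (Fin.last m) i * ρ).trace := by
  simp [lastOp, Finset.sum_mul, trace_sum]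

theorem IsDecomposition.trace_eq (h : IsDecomposition w A Q)
    (ρ : Fin (m + 1) → Matrix (Fin d) (Fin d) ℂ) :
    (Q * tensorOp ρ).trace =
      (lastOp A (fun t => qVec (A t.castSucc) (ρ t.castSucc)) * ρ (Fin.last m)).trace := by
  rw [h.1, trace_lastOp_mul, Finset.sum_mul, trace_sum]
  refine Finset.sum_congr rfl fun i _ => ?_
  rw [trace_tensorOp_mul, Fin.prod_univ_castSucc]
  rfl

/-- Telescoping, one factor exchanged at a time. Measuring each change relative to `w t` lets all
factors contribute with the common weight `∏ w t`. -/
theorem norm_prod_sub_prod_le {ι : Type*} [DecidableEq ι] (s : Finset ι) {w : ι → ℝ}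
    {p q : ι → ℂ} (hw : ∀ t, 0 < w t) (hp : ∀ t, ‖p t‖ ≤ w t) (hq : ∀ t, ‖q t‖ ≤ w t) :
    ‖∏ t ∈ s, p t - ∏ t ∈ s, q t‖ ≤ (∏ t ∈ s, w t) * ∑ t ∈ s, ‖p t - q t‖ / w t := by
  induction s using Finset.induction_on with
  | empty => simp
  | insert a s ha ih =>
    rw [Finset.prod_insert ha, Finset.prod_insert ha, Finset.prod_insert ha, Finset.sum_insert ha]
    have hps : ‖∏ t ∈ s, p t‖ ≤ ∏ t ∈ s, w t := by
      rw [norm_prod]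
      exact Finset.prod_le_prod (fun _ _ => norm_nonneg _) fun t _ => hp t
    have e : p a * ∏ t ∈ s, p t - q a * ∏ t ∈ s, q t =
        (p a - q a) * ∏ t ∈ s, p t + q a * (∏ t ∈ s, p t - ∏ t ∈ s, q t) := by ring
    have hwa := hw a
    calc ‖p a * ∏ t ∈ s, p t - q a * ∏ t ∈ s, q t‖
        ≤ ‖p a - q a‖ * ∏ t ∈ s, w t + w a * ((∏ t ∈ s, w t) * ∑ t ∈ s, ‖p t - q t‖ / w t) := by
          rw [e]
          refine (norm_add_le _ _).trans ?_
          rw [norm_mul, norm_mul]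
          gcongr
          exact hq a
      _ = _ := by
          field_simp

theorem norm_qVec_le {B : Fin M → Matrix (Fin d) (Fin d) ℂ} {v : ℝ} (hB : ∀ i, opNorm (B i) ≤ v)
    {p : Fin M → ℂ} (hp : p ∈ qSpace B) (i : Fin M) : ‖p i‖ ≤ v := by
  obtain ⟨ρ, hρ, rfl⟩ := hp
  exact (norm_trace_mul_le _ hρ).trans (hB i)

/-- The telescoping bound is applied to every term `i`. Exchanging the sums over `i` and `t`
assembles the coordinates of each party into an `ℓ_1` distance, which is why this is the metric of
the nets. -/
theorem norm_trace_lastOp_sub_le (hw : ∀ t, 0 < w t)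
    (hA : ∀ i, opNorm (A (Fin.last m) i) ≤ w (Fin.last m))
    {p q : Fin m → Fin M → ℂ} (hp : ∀ t i, ‖p t i‖ ≤ w t.castSucc)
    (hq : ∀ t i, ‖q t i‖ ≤ w t.castSucc) {ρ : Matrix (Fin d) (Fin d) ℂ} (hρ : IsDensity ρ) :
    |(lastOp A p * ρ).trace.re - (lastOp A q * ρ).trace.re| ≤
      (∏ t, w t) * ∑ t, l1Dist (p t) (q t) / w t.castSucc := by
  rw [← Complex.sub_re]
  refine (Complex.abs_re_le_norm _).trans ?_
  rw [trace_lastOp_mul, trace_lastOp_mul, ← Finset.sum_sub_distrib]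
  calc ‖∑ i, ((∏ t, p t i) * (A (Fin.last m) i * ρ).trace -
        (∏ t, q t i) * (A (Fin.last m) i * ρ).trace)‖
      ≤ ∑ i, ((∏ t : Fin m, w t.castSucc) * ∑ t, ‖p t i - q t i‖ / w t.castSucc) *
          w (Fin.last m) := by
        refine (norm_sum_le _ _).trans (Finset.sum_le_sum fun i _ => ?_)
        rw [← sub_mul, norm_mul]
        have h1 := norm_prod_sub_prod_le Finset.univ (w := fun t : Fin m => w t.castSucc)
          (p := fun t => p t i) (q := fun t => q t i) (fun t => hw _) (fun t => hp t i)
          fun t => hq t i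
        have h2 := (norm_trace_mul_le _ hρ).trans (hA i)
        gcongr
        exact (norm_nonneg _).trans h1
    _ = (∏ t, w t) * ∑ t, l1Dist (p t) (q t) / w t.castSucc := by
        rw [Fin.prod_univ_castSucc, ← Finset.sum_mul, ← Finset.mul_sum, Finset.sum_comm]
        simp only [l1Dist, Finset.sum_div]
        ring

theorem norm_trace_lastOp_le (hw : ∀ t, 0 < w t)
    (hA : ∀ i, opNorm (A (Fin.last m) i) ≤ w (Fin.last m)) {q : Fin m → Fin M → ℂ}
    (hq : ∀ t i, ‖q t i‖ ≤ w t.castSucc) {ρ : Matrix (Fin d) (Fin d) ℂ} (hρ : IsDensity ρ) :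
    ‖(lastOp A q * ρ).trace‖ ≤ M * ∏ t, w t := by
  rw [trace_lastOp_mul]
  calc ‖∑ i, (∏ t, q t i) * (A (Fin.last m) i * ρ).trace‖
      ≤ ∑ i : Fin M, (∏ t : Fin m, w t.castSucc) * w (Fin.last m) := by
        refine (norm_sum_le _ _).trans (Finset.sum_le_sum fun i _ => ?_)
        rw [norm_mul, norm_prod]
        have h2 := (norm_trace_mul_le _ hρ).trans (hA i)
        have h3 : ∀ t : Fin m, 0 ≤ w t.castSucc := fun t => (hw _).le
        gcongr
        · exact Finset.prod_nonneg fun t _ => h3 t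
        · exact hq _ i
    _ = _ := by simp [Fin.prod_univ_castSucc]

end

/-! ## Compactness -/

open scoped ComplexOrder in
-- An entry is the trace of `ρ` against a matrix unit, whose operator norm is at most one.
theorem IsDensity.norm_apply_le {d : ℕ} {ρ : Matrix (Fin d) (Fin d) ℂ} (hρ : IsDensity ρ)
    (a b : Fin d) : ‖ρ a b‖ ≤ 1 := by
  have h := norm_trace_mul_le (Matrix.single b a (1 : ℂ)) hρ
  have e : (Matrix.single b a (1 : ℂ) * ρ).trace = ρ a b := by
    simp [Matrix.trace_single_mul]
  rw [e] at h
  refine h.trans (ContinuousLinearMap.opNorm_le_bound _ zero_le_one fun x => ?_)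
  have : Matrix.toEuclideanCLM (n := Fin d) (𝕜 := ℂ) (Matrix.single b a (1 : ℂ)) x =
      EuclideanSpace.single b (x a) := by
    ext j
    rw [Matrix.ofLp_toEuclideanCLM, Matrix.single_mulVec]
    simp [Function.update_apply]
  rw [this, PiLp.norm_single, one_mul]
  exact PiLp.norm_apply_le x a

open scoped ComplexOrder in
theorem isCompact_setOf_isDensity (d : ℕ) :
    IsCompact {ρ : Matrix (Fin d) (Fin d) ℂ | IsDensity ρ} := by
  have hK : IsCompact (Set.pi Set.univ fun _ : Fin d => Set.pi Set.univ fun _ : Fin d =>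
      Metric.closedBall (0 : ℂ) 1) :=
    isCompact_univ_pi fun _ => isCompact_univ_pi fun _ => isCompact_closedBall 0 1
  refine IsCompact.of_isClosed_subset hK ?_ fun ρ hρ => ?_
  · have : {ρ : Matrix (Fin d) (Fin d) ℂ | IsDensity ρ} =
        ({ρ | ρᴴ = ρ} ∩ ⋂ x : Fin d → ℂ, {ρ | 0 ≤ star x ⬝ᵥ (ρ *ᵥ x)}) ∩ {ρ | ρ.trace = 1} := by
      ext ρ
      simp [IsDensity, Matrix.posSemidef_iff_dotProduct_mulVec, Matrix.IsHermitian]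
    rw [this]
    refine ((isClosed_eq (by fun_prop) continuous_id).inter (isClosed_iInter fun x => ?_)).inter
      (isClosed_eq (by fun_prop) continuous_const)
    exact isClosed_le continuous_const (by fun_prop)
  · exact fun a _ b _ => mem_closedBall_zero_iff.2 (IsDensity.norm_apply_le hρ a b)

theorem exists_isDensity {d : ℕ} (hd : 0 < d) : ∃ ρ : Matrix (Fin d) (Fin d) ℂ, IsDensity ρ :=
  -- With `G = 0` and `N = 1` this is the maximally mixed state.
  ⟨_, (gibbs_sub_spec hd (G := 0) isHermitian_zero one_pos (by simp) one_pos).1⟩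

theorem isGreatest_optSep {k d : ℕ} (hd : 0 < d) (Q : MultiOp k d) :
    IsGreatest (productValues Q) (optSep Q) := by
  have himg : productValues Q =
      (fun ρ : Fin k → Matrix (Fin d) (Fin d) ℂ => (Q * tensorOp ρ).trace.re) ''
        Set.pi Set.univ fun _ => {ρ | IsDensity ρ} := by
    ext v
    simp [productValues, Set.mem_pi, eq_comm]
  have hcont : Continuous fun ρ : Fin k → Matrix (Fin d) (Fin d) ℂ =>
      (Q * tensorOp ρ).trace.re := by
    have : Continuous fun ρ : Fin k → Matrix (Fin d) (Fin d) ℂ => tensorOp ρ := by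
      refine continuous_matrix fun a b => ?_
      simp only [tensorOp, of_apply]
      exact continuous_finsetProd _ fun t _ => (continuous_apply t).matrix_elem _ _
    fun_prop
  have hc : IsCompact (productValues Q) := by
    rw [himg]
    exact (isCompact_univ_pi fun _ => isCompact_setOf_isDensity d).image hcont
  refine hc.isGreatest_sSup ?_
  obtain ⟨ρ, hρ⟩ := exists_isDensity hd
  exact ⟨_, fun _ => ρ, fun _ => hρ, rfl⟩

section
variable {d M : ℕ} {B : Fin M → Matrix (Fin d) (Fin d) ℂ}

theorem continuous_qVec (B : Fin M → Matrix (Fin d) (Fin d) ℂ) : Continuous (qVec B) := by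
  unfold qVec
  fun_prop

theorem qSpace_nonempty (hd : 0 < d) (B : Fin M → Matrix (Fin d) (Fin d) ℂ) :
    (qSpace B).Nonempty :=
  let ⟨ρ, hρ⟩ := exists_isDensity hd
  ⟨_, ρ, hρ, rfl⟩

theorem dis_le {p q : Fin M → ℂ} (hq : q ∈ qSpace B) : dis B p ≤ l1Dist p q :=
  csInf_le ⟨0, by
    rintro _ ⟨r, -, rfl⟩
    exact Finset.sum_nonneg fun _ _ => norm_nonneg _⟩ ⟨q, hq, rfl⟩

/-- By compactness the infimum is attained, so a selected point has an actual vector of a state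
within exactly the allowed distance. -/
theorem exists_l1Dist_eq_dis (hd : 0 < d) (p : Fin M → ℂ) :
    ∃ q ∈ qSpace B, l1Dist p q = dis B p := by
  have himg : qSpace B = qVec B '' {ρ | IsDensity ρ} := by
    ext v
    simp [qSpace, eq_comm]
  have hc : IsCompact (l1Dist p '' qSpace B) := by
    rw [himg]
    refine ((isCompact_setOf_isDensity d).image (continuous_qVec B)).image ?_
    unfold l1Dist
    fun_prop
  exact hc.sInf_mem ((qSpace_nonempty hd B).image _)

end

/-! ## Correctness of the enumeration -/

section
variable {m d M : ℕ} {w : Fin (m + 1) → ℝ} {A : Fin (m + 1) → Fin M → Matrix (Fin d) (Fin d) ℂ}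
  {Q : MultiOp (m + 1) d} {δ : ℝ}

theorem re_trace_lastOp_le_optSep (hd : 0 < d) (hQ : IsDecomposition w A Q)
    {p : Fin m → Fin M → ℂ} (hp : ∀ t, p t ∈ qSpace (A t.castSucc))
    {ρ : Matrix (Fin d) (Fin d) ℂ} (hρ : IsDensity ρ) :
    (lastOp A p * ρ).trace.re ≤ optSep Q := by
  choose σ h1 h2 using hp
  refine (isGreatest_optSep hd Q).2 ⟨Fin.snoc (α := fun _ => Matrix (Fin d) (Fin d) ℂ) σ ρ,
    fun t => ?_, ?_⟩
  · refine Fin.lastCases ?_ (fun t => ?_) t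
    · simpa using hρ
    · simpa using h1 t
  · rw [hQ.trace_eq]
    simp only [Fin.snoc_castSucc, Fin.snoc_last]
    simp only [← h2]

/-- The relative precision `ε_t / w_t` is `δ / (m W)` for every party, so the `m` contributions to
the perturbation bound exhaust `δ`. -/
theorem mul_sum_netEps (hm : 1 ≤ m) (hw : ∀ t, 0 < w t) (δ : ℝ) :
    (∏ t, w t) * ∑ t : Fin m, netEps w δ t / w t.castSucc = δ := by
  have hW : (∏ t, w t) ≠ 0 := (Finset.prod_pos fun t _ => hw t).ne'
  have hm' : (m : ℝ) ≠ 0 := by exact_mod_cast (by omega : m ≠ 0)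
  have : ∀ t : Fin m, netEps w δ t / w t.castSucc = δ / (m * ∏ t, w t) := fun t => by
    have := (hw t.castSucc).ne'
    rw [netEps]
    field_simp
  simp only [this, Finset.sum_const, Finset.card_univ, Fintype.card_fin, nsmul_eq_mul]
  field_simp

theorem abs_trace_lastOp_sub_le (hm : 1 ≤ m) (hw : ∀ t, 0 < w t)
    (hA : ∀ i, opNorm (A (Fin.last m) i) ≤ w (Fin.last m))
    {p q : Fin m → Fin M → ℂ} (hp : ∀ t i, ‖p t i‖ ≤ w t.castSucc)
    (hq : ∀ t i, ‖q t i‖ ≤ w t.castSucc) (hpq : ∀ t, l1Dist (p t) (q t) ≤ netEps w δ t)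
    {ρ : Matrix (Fin d) (Fin d) ℂ} (hρ : IsDensity ρ) :
    |(lastOp A p * ρ).trace.re - (lastOp A q * ρ).trace.re| ≤ δ := by
  refine (norm_trace_lastOp_sub_le hw hA hp hq hρ).trans ?_
  rw [← mul_sum_netEps hm hw δ]
  refine mul_le_mul_of_nonneg_left (Finset.sum_le_sum fun t _ => ?_)
    (Finset.prod_nonneg fun t _ => (hw t).le)
  exact div_le_div_of_nonneg_right (hpq t) (hw _).le

/-- The maximum over the product of the nets is attained. -/
theorem isGreatest_enumOpt (A : Fin (m + 1) → Fin M → Matrix (Fin d) (Fin d) ℂ)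
    {N : Fin m → Finset (Fin M → ℂ)} (hN : ∀ t, (N t).Nonempty) :
    IsGreatest ((fun q => lambdaMax (hermPart (lastOp A q))) ''
      {q : Fin m → Fin M → ℂ | ∀ t, q t ∈ N t}) (enumOpt A N) := by
  have hfin : {q : Fin m → Fin M → ℂ | ∀ t, q t ∈ N t}.Finite := by
    have := Set.Finite.pi (fun t => (N t).finite_toSet)
    refine this.subset fun q hq => ?_
    simpa [Set.mem_pi] using hq
  choose q hq using hN
  exact ⟨Set.Nonempty.csSup_mem ⟨_, q, hq, rfl⟩ (hfin.image _),
    fun x hx => le_csSup (hfin.image _).bddAbove hx⟩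

theorem IsSelectedNet.nonempty {B : Fin M → Matrix (Fin d) (Fin d) ℂ} {v ε : ℝ}
    {N : Finset (Fin M → ℂ)} (hd : 0 < d) (h : IsSelectedNet B v ε N) : N.Nonempty :=
  let ⟨_, hp⟩ := qSpace_nonempty hd B
  let ⟨q, hq, _⟩ := h.covers _ hp
  ⟨q, hq⟩

theorem abs_enumOpt_sub_optSep_le (hm : 1 ≤ m) (hd : 1 ≤ d) (hw : ∀ t, 0 < w t)
    (hQ : IsDecomposition w A Q) {N : Fin m → Finset (Fin M → ℂ)}
    (hN : ∀ t, IsSelectedNet (A t.castSucc) (w t.castSucc) (netEps w δ t) (N t)) :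
    |enumOpt A N - optSep Q| ≤ δ := by
  have hg := isGreatest_enumOpt A fun t => (hN t).nonempty hd
  rw [abs_le]
  constructor
  -- Lower bound: the vectors of an optimal product state are rounded to net points, and its last
  -- state is kept as a test state for `lambdaMax`.
  · obtain ⟨ρ, hρ, hv⟩ := (isGreatest_optSep hd Q).1
    have hp : ∀ t : Fin m, qVec (A t.castSucc) (ρ t.castSucc) ∈ qSpace (A t.castSucc) :=
      fun t => ⟨_, hρ _, rfl⟩
    choose q hq hd' using fun t => (hN t).covers _ (hp t)
    have h1 : lambdaMax (hermPart (lastOp A q)) ≤ enumOpt A N := hg.2 ⟨q, hq, rfl⟩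
    have h2 := re_trace_mul_le_lambdaMax (isHermitian_hermPart (lastOp A q)) (hρ (Fin.last m))
    rw [re_trace_hermPart_mul _ (hρ _).isHermitian] at h2
    have h3 := abs_trace_lastOp_sub_le hm hw (hQ.2 _)
      (fun t i => norm_qVec_le (hQ.2 t.castSucc) (hp t) i) (fun t i => (hN t).raw _ (hq t) i) hd'
      (hρ (Fin.last m))
    rw [← hQ.trace_eq, ← hv] at h3
    have := (abs_le.1 h3).2
    linarith
  -- Upper bound: the maximising net points are replaced by nearest vectors of states, which
  -- together with a top eigenstate form a product state. The net points need not lie in `qSpace`,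
  -- so the telescoping bound relies on `raw`.
  · obtain ⟨q, hq, hqv⟩ := hg.1
    obtain ⟨ρ, hρ, hv⟩ := exists_density_trace_eq_lambdaMax hd (isHermitian_hermPart (lastOp A q))
    rw [re_trace_hermPart_mul _ hρ.isHermitian] at hv
    choose p hp hpd using fun t => exists_l1Dist_eq_dis (B := A t.castSucc) hd (q t)
    have h3 := abs_trace_lastOp_sub_le hm hw (hQ.2 _) (fun t i => (hN t).raw _ (hq t) i)
      (fun t i => norm_qVec_le (hQ.2 t.castSucc) (hp t) i)
      (fun t => (hpd t).le.trans ((hN t).selected _ (hq t))) hρ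
    have h4 := re_trace_lastOp_le_optSep hd hQ hp hρ
    have := (abs_le.1 h3).2
    dsimp only at hqv
    linarith

end

end

section

/-! ## Selection of net points -/

open Matrix

section
variable {d M : ℕ} {B : Fin M → Matrix (Fin d) (Fin d) ℂ} {w ε : ℝ} {q : Fin M → ℂ}

/-- The Hermitian operator `ρ ↦ Re ⟨S, qVec B ρ⟩`. -/
noncomputable def dirOp (B : Fin M → Matrix (Fin d) (Fin d) ℂ) (S : Fin M → ℂ) :
    Matrix (Fin d) (Fin d) ℂ :=
  hermPart (∑ i, (starRingEnd ℂ) (S i) • B i)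

theorem re_trace_dirOp_mul (B : Fin M → Matrix (Fin d) (Fin d) ℂ) (S : Fin M → ℂ)
    {ρ : Matrix (Fin d) (Fin d) ℂ} (hρ : IsDensity ρ) :
    (dirOp B S * ρ).trace.re = ∑ i, ((starRingEnd ℂ) (S i) * qVec B ρ i).re := by
  rw [dirOp, re_trace_hermPart_mul _ hρ.isHermitian]
  simp [Finset.sum_mul, trace_sum, qVec]

theorem abs_re_trace_dirOp_mul_le (hB : ∀ i, opNorm (B i) ≤ w) {S : Fin M → ℂ} {v : ℝ}
    (hS : ∀ i, ‖S i‖ ≤ v) {ρ : Matrix (Fin d) (Fin d) ℂ} (hρ : IsDensity ρ) :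
    |(dirOp B S * ρ).trace.re| ≤ M * (v * w) := by
  rw [re_trace_dirOp_mul B S hρ]
  calc |∑ i, ((starRingEnd ℂ) (S i) * qVec B ρ i).re|
      ≤ ∑ i : Fin M, v * w := by
        refine (Finset.abs_sum_le_sum_abs _ _).trans (Finset.sum_le_sum fun i _ => ?_)
        refine (Complex.abs_re_le_norm _).trans ?_
        rw [norm_mul, RCLike.norm_conj]
        exact mul_le_mul (hS i) ((norm_trace_mul_le _ hρ).trans (hB i)) (norm_nonneg _)
          ((norm_nonneg _).trans (hS i))
    _ = _ := by simp

/-- `S` is a possible value of the accumulated differences `∑ (qVec B σ - q)` after `n` rounds of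
the selection test, each of which takes a near minimizer `σ` of the linear form given by the
accumulated differences so far. -/
inductive Rounds (B : Fin M → Matrix (Fin d) (Fin d) ℂ) (w : ℝ) (q : Fin M → ℂ) :
    ℕ → (Fin M → ℂ) → Prop
  | zero : Rounds B w q 0 0
  | succ {n : ℕ} {S : Fin M → ℂ} {σ : Matrix (Fin d) (Fin d) ℂ} : Rounds B w q n S →
      IsDensity σ → (∀ ρ, IsDensity ρ →
        (dirOp B S * σ).trace.re ≤ (dirOp B S * ρ).trace.re + w ^ 2 * (M + 1)) →
      Rounds B w q (n + 1) fun i => S i + (qVec B σ i - q i)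

open scoped ComplexOrder in
theorem IsDensity.convex_comb {ρ σ : Matrix (Fin d) (Fin d) ℂ} (hρ : IsDensity ρ)
    (hσ : IsDensity σ) {s t : ℝ} (hs : 0 ≤ s) (ht : 0 ≤ t) (hst : s + t = 1) :
    IsDensity ((s : ℂ) • ρ + (t : ℂ) • σ) := by
  refine ⟨(hρ.1.smul ?_).add (hσ.1.smul ?_), ?_⟩
  · exact_mod_cast hs
  · exact_mod_cast ht
  · rw [trace_add, trace_smul, trace_smul, hρ.2, hσ.2, smul_eq_mul, smul_eq_mul, mul_one, mul_one]
    exact_mod_cast hst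

/-- The point is the vector of the running average of the states chosen so far; the density
operators are convex, and one more round averages with weights `n / (n + 1)` and `1 / (n + 1)`. -/
theorem Rounds.exists_mem_qSpace {n : ℕ} {S : Fin M → ℂ} (h : Rounds B w q n S) (hn : 0 < n) :
    ∃ p ∈ qSpace B, ∀ i, S i = n * (p i - q i) := by
  induction h with
  | zero => omega
  | @succ n S σ hR hσ _ ih =>
    rcases Nat.eq_zero_or_pos n with rfl | hn'
    · cases hR
      exact ⟨_, ⟨σ, hσ, rfl⟩, fun i => by simp⟩
    · obtain ⟨_, ⟨ρ, hρ, rfl⟩, hS⟩ := ih hn'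
      have hn1 : ((n : ℝ) + 1) ≠ 0 := by positivity
      have hn2 : ((n : ℂ) + 1) ≠ 0 := by exact_mod_cast hn1
      refine ⟨_, ⟨_, hρ.convex_comb hσ (s := n / (n + 1)) (t := 1 / (n + 1)) (by positivity)
        (by positivity) (by field_simp), rfl⟩, fun i => ?_⟩
      have e : qVec B (((n / (n + 1) : ℝ) : ℂ) • ρ + ((1 / (n + 1) : ℝ) : ℂ) • σ) i =
          (n / (n + 1) : ℂ) * qVec B ρ i + (1 / (n + 1) : ℂ) * qVec B σ i := by
        simp [qVec, mul_add]
      simp only [e, hS i]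
      push_cast
      field_simp
      ring

theorem Rounds.norm_le {n : ℕ} {S : Fin M → ℂ} (h : Rounds B w q n S)
    (hB : ∀ i, opNorm (B i) ≤ w) (hq : ∀ i, ‖q i‖ ≤ w) (i : Fin M) : ‖S i‖ ≤ n * (2 * w) := by
  induction h with
  | zero => simp
  | @succ n S σ _ hσ _ ih =>
    have h1 := (norm_trace_mul_le (B i) hσ).trans (hB i)
    have h2 := hq i
    calc ‖S i + (qVec B σ i - q i)‖ ≤ ‖S i‖ + (‖qVec B σ i‖ + ‖q i‖) :=
          (norm_add_le _ _).trans (by gcongr; exact norm_sub_le _ _)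
      _ ≤ n * (2 * w) + (w + w) := by
          gcongr
          exact h1
      _ = _ := by push_cast; ring

theorem sum_norm_sq_add (S v : Fin M → ℂ) :
    ∑ i, ‖S i + v i‖ ^ 2 =
      ∑ i, ‖S i‖ ^ 2 + 2 * ∑ i, ((starRingEnd ℂ) (S i) * v i).re + ∑ i, ‖v i‖ ^ 2 := by
  rw [Finset.mul_sum, ← Finset.sum_add_distrib, ← Finset.sum_add_distrib]
  refine Finset.sum_congr rfl fun i _ => ?_
  rw [← Complex.normSq_eq_norm_sq, ← Complex.normSq_eq_norm_sq, ← Complex.normSq_eq_norm_sq]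
  simp [Complex.normSq_apply]
  ring

theorem sum_norm_le_sqrt (S : Fin M → ℂ) :
    ∑ i, ‖S i‖ ≤ √M * √(∑ i, ‖S i‖ ^ 2) := by
  rw [← Real.sqrt_mul (Nat.cast_nonneg M)]
  refine Real.le_sqrt_of_sq_le ?_
  have := sq_sum_le_card_mul_sum_sq (s := Finset.univ) (f := fun i => ‖S i‖)
  simpa using this

/-- A perceptron estimate. Near minimality makes the component of the new difference along `S` at
most what the close point `p` would give, that is `η √M` up to slack. Thus one round changes the
norm `a` to at most `√((a + e) ^ 2 + D ^ 2)`: the drift `e` accumulates linearly, the bounded steps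
only in square. -/
theorem Rounds.sqrt_sum_le {n : ℕ} {S : Fin M → ℂ} (h : Rounds B w q n S) (hw : 0 ≤ w)
    (hB : ∀ i, opNorm (B i) ≤ w) (hq : ∀ i, ‖q i‖ ≤ w) {η : ℝ} (hη : 0 ≤ η) {p : Fin M → ℂ}
    (hp : p ∈ qSpace B) (hpq : ∀ i, ‖p i - q i‖ ≤ η) :
    √(∑ i, ‖S i‖ ^ 2) ≤ n * (η * √M) + √n * (4 * w * √M) := by
  rcases Nat.eq_zero_or_pos M with rfl | hM
  · simp
  induction h with
  | zero => simp
  | @succ n S σ hR hσ hmin ih =>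
    obtain ⟨ρ, hρ, rfl⟩ := hp
    have hM1 : (1 : ℝ) ≤ M := by exact_mod_cast hM
    set a := √(∑ i, ‖S i‖ ^ 2) with ha
    have ha0 : 0 ≤ a := Real.sqrt_nonneg _
    have ha2 : a ^ 2 = ∑ i, ‖S i‖ ^ 2 := Real.sq_sqrt (Finset.sum_nonneg fun _ _ => sq_nonneg _)
    -- Compare `σ` with the state behind the close point and use Cauchy-Schwarz. The slack `w ^ 2 *
    -- (M + 1)` of the oracle is at most `2 * w ^ 2 * M`, since `M ≥ 1`.
    have h1 : ∑ i, ((starRingEnd ℂ) (S i) * (qVec B σ i - q i)).re ≤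
        η * √M * a + 2 * w ^ 2 * M := by
      have e := hmin ρ hρ
      rw [re_trace_dirOp_mul B S hσ, re_trace_dirOp_mul B S hρ] at e
      have e2 : ∑ i, ((starRingEnd ℂ) (S i) * (qVec B ρ i - q i)).re ≤ η * √M * a := by
        calc ∑ i, ((starRingEnd ℂ) (S i) * (qVec B ρ i - q i)).re ≤ ∑ i, ‖S i‖ * η := by
              refine Finset.sum_le_sum fun i _ => (Complex.re_le_norm _).trans ?_
              rw [norm_mul, RCLike.norm_conj]
              exact mul_le_mul_of_nonneg_left (hpq i) (norm_nonneg _)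
          _ = η * ∑ i, ‖S i‖ := by rw [← Finset.sum_mul, mul_comm]
          _ ≤ η * (√M * a) := mul_le_mul_of_nonneg_left (sum_norm_le_sqrt S) hη
          _ = _ := by ring
      have e3 : ∀ x : Fin M → ℂ, ∑ i, ((starRingEnd ℂ) (S i) * (x i - q i)).re =
          ∑ i, ((starRingEnd ℂ) (S i) * x i).re - ∑ i, ((starRingEnd ℂ) (S i) * q i).re := by
        intro x
        rw [← Finset.sum_sub_distrib]
        exact Finset.sum_congr rfl fun i _ => by rw [mul_sub, Complex.sub_re]
      rw [e3] at e2 ⊢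
      nlinarith [sq_nonneg w]
    have h2 : ∑ i, ‖qVec B σ i - q i‖ ^ 2 ≤ 4 * w ^ 2 * M := by
      calc ∑ i, ‖qVec B σ i - q i‖ ^ 2 ≤ ∑ i : Fin M, (w + w) ^ 2 := by
            refine Finset.sum_le_sum fun i _ => ?_
            have h1 := (norm_trace_mul_le (B i) hσ).trans (hB i)
            have h2 := hq i
            gcongr
            exact (norm_sub_le _ _).trans (add_le_add h1 h2)
        _ = _ := by simp; ring
    set e := η * √M with he
    have he0 : 0 ≤ e := by positivity
    set D := 4 * w * √M with hD
    have hD0 : 0 ≤ D := by positivity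
    have hD2 : D ^ 2 = 16 * w ^ 2 * M := by
      rw [hD, mul_pow, Real.sq_sqrt (Nat.cast_nonneg M)]
      ring
    refine Real.sqrt_le_left (by positivity) |>.2 ?_
    rw [sum_norm_sq_add, ← ha2]
    have hn0 : 0 ≤ √(n : ℝ) := Real.sqrt_nonneg _
    have hn2 : √(n : ℝ) ^ 2 = n := Real.sq_sqrt (Nat.cast_nonneg n)
    have hm2 : √((n + 1 : ℕ) : ℝ) ^ 2 = n + 1 := by
      rw [Real.sq_sqrt (Nat.cast_nonneg _)]
      push_cast
      ring
    have hmn : √(n : ℝ) ≤ √((n + 1 : ℕ) : ℝ) := Real.sqrt_le_sqrt (by push_cast; linarith)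
    set x := √(n : ℝ)
    set y := √((n + 1 : ℕ) : ℝ)
    -- Twice the slack and the squared step add up to `8 * w ^ 2 * M`, half of `D ^ 2`.
    have hstep : a ^ 2 + 2 * ∑ i, ((starRingEnd ℂ) (S i) * (qVec B σ i - q i)).re +
        ∑ i, ‖qVec B σ i - q i‖ ^ 2 ≤ (a + e) ^ 2 + D ^ 2 := by
      rw [hD2]
      nlinarith [sq_nonneg e, mul_nonneg (sq_nonneg w) (Nat.cast_nonneg (α := ℝ) M)]
    refine hstep.trans ?_
    have h3 : (a + e) ^ 2 ≤ (n * e + x * D + e) ^ 2 := by gcongr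
    -- After expansion, the two sides of the induction step differ only in the cross term, where
    -- `√n` meets `√(n + 1)`.
    have h4 : (n * e + x * D + e) ^ 2 + D ^ 2 =
        ((n + 1) * e) ^ 2 + 2 * ((n + 1) * e) * (x * D) + (n + 1) * D ^ 2 := by
      linear_combination D ^ 2 * hn2
    have h5 : (((n + 1 : ℕ) : ℝ) * e + y * D) ^ 2 =
        ((n + 1) * e) ^ 2 + 2 * ((n + 1) * e) * (y * D) + (n + 1) * D ^ 2 := by
      push_cast
      linear_combination D ^ 2 * hm2
    rw [h5]
    have h6 : 2 * ((n + 1) * e) * (x * D) ≤ 2 * ((n + 1) * e) * (y * D) := by gcongr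
    linarith

/-- The selection test is sound. -/
theorem Rounds.dis_le {n : ℕ} {S : Fin M → ℂ} (h : Rounds B w q n S) (hn : 0 < n) (hε : 0 ≤ ε)
    (ht : M * ∑ i, ‖S i‖ ^ 2 ≤ (n * ε) ^ 2) : dis B q ≤ ε := by
  obtain ⟨p, hp, hS⟩ := h.exists_mem_qSpace hn
  refine (_root_.dis_le hp).trans ?_
  have hn' : (0 : ℝ) < n := by exact_mod_cast hn
  have h1 : n * l1Dist q p = ∑ i, ‖S i‖ := by
    rw [l1Dist, Finset.mul_sum]
    refine Finset.sum_congr rfl fun i _ => ?_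
    rw [hS i, norm_mul, norm_sub_rev]
    simp
  have h2 : ∑ i, ‖S i‖ ≤ n * ε := by
    refine (sum_norm_le_sqrt S).trans ?_
    rw [← Real.sqrt_mul (Nat.cast_nonneg M)]
    exact Real.sqrt_le_iff.2 ⟨by positivity, ht⟩
  exact le_of_mul_le_mul_left (h1.trans_le h2) hn'

/-- The selection test keeps all points that are close to the set. -/
theorem Rounds.test_of_close {L : ℕ} {S : Fin M → ℂ} (h : Rounds B w q ((L + 1) ^ 2) S)
    (hw : 0 ≤ w) (hB : ∀ i, opNorm (B i) ≤ w) (hq : ∀ i, ‖q i‖ ≤ w) (hε : 0 ≤ ε)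
    (hL : 8 * w * (M + 1) ≤ (L + 1) * ε) {p : Fin M → ℂ} (hp : p ∈ qSpace B)
    (hpq : ∀ i, ‖p i - q i‖ ≤ ε / (4 * (M + 1))) :
    M * ∑ i, ‖S i‖ ^ 2 ≤ (((L + 1) ^ 2 : ℕ) * ε) ^ 2 := by
  have h1 := h.sqrt_sum_le hw hB hq (by positivity) hp hpq
  have hM2 : √(M : ℝ) * √(M : ℝ) = M := Real.mul_self_sqrt (Nat.cast_nonneg M)
  -- The number of rounds is a perfect square so that its root is `L + 1`, the quantity in `hL`.
  have hL2 : √(((L + 1) ^ 2 : ℕ) : ℝ) = L + 1 := by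
    push_cast
    exact Real.sqrt_sq (by positivity)
  rw [hL2] at h1
  have e0 : (M : ℝ) * ∑ i, ‖S i‖ ^ 2 = (√M * √(∑ i, ‖S i‖ ^ 2)) ^ 2 := by
    rw [mul_pow, Real.sq_sqrt (Nat.cast_nonneg M),
      Real.sq_sqrt (Finset.sum_nonneg fun _ _ => sq_nonneg _)]
  rw [e0]
  have h2 : √M * √(∑ i, ‖S i‖ ^ 2) ≤ ((L + 1) ^ 2 : ℕ) * ε := by
    refine (mul_le_mul_of_nonneg_left h1 (Real.sqrt_nonneg _)).trans ?_
    have e1 : √(M : ℝ) * (((L + 1) ^ 2 : ℕ) * (ε / (4 * (M + 1)) * √M) + (L + 1) * (4 * w * √M)) =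
        (L + 1) ^ 2 * ε / 4 * (M / (M + 1)) + (L + 1) * (4 * w * M) := by
      push_cast
      field_simp
      linear_combination ((L + 1) * ε + 16 * (M + 1) * w) * hM2
    rw [e1]
    have h3 : (M : ℝ) / (M + 1) ≤ 1 := by
      rw [div_le_one (by positivity)]
      linarith
    have h4 : 4 * w * M ≤ (L + 1) * ε / 2 := by linarith
    -- Of the budget `n * ε`, the drift uses at most a quarter and the fluctuation at most a half.
    calc (L + 1 : ℝ) ^ 2 * ε / 4 * (M / (M + 1)) + (L + 1) * (4 * w * M)
        ≤ (L + 1) ^ 2 * ε / 4 * 1 + (L + 1) * ((L + 1) * ε / 2) := by gcongr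
      _ ≤ ((L + 1) ^ 2 : ℕ) * ε := by
          push_cast
          nlinarith [mul_nonneg (sq_nonneg (L + 1 : ℝ)) hε]
  gcongr

end

/-! ## The grid -/

/-- The point of the grid with the integer coordinates `a - L` and `b - L`, the grid having mesh
`w / L`; the points outside the disc of radius `w` are moved to the centre. -/
noncomputable def gridPoint (w : ℝ) (L a b : ℕ) : ℂ :=
  let z := (w : ℂ) * (((a : ℂ) - L) + Complex.I * ((b : ℂ) - L)) / L
  if ‖z‖ ^ 2 ≤ w ^ 2 then z else 0

theorem norm_gridPoint_le {w : ℝ} (hw : 0 ≤ w) (L a b : ℕ) : ‖gridPoint w L a b‖ ≤ w := by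
  simp only [gridPoint]
  split_ifs with h
  · exact (sq_le_sq₀ (norm_nonneg _) hw).1 h
  · simpa using hw

/-- Rounding goes towards zero, so that absolute values do not increase and a rounded point of the
disc stays in the disc. -/
theorem exists_grid_coord {w : ℝ} (hw : 0 < w) {L : ℕ} (hL : 0 < L) {x : ℝ} (hx : |x| ≤ w) :
    ∃ a ≤ 2 * L, |x - w * ((a : ℝ) - L) / L| ≤ w / L ∧ |w * ((a : ℝ) - L) / L| ≤ |x| := by
  have hL' : (0 : ℝ) < L := by exact_mod_cast hL
  set y := |x| * L / w with hy
  have hy0 : 0 ≤ y := by positivity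
  have hyL : y ≤ L := by
    rw [hy, div_le_iff₀ hw, mul_comm]
    gcongr
  have hf1 : (⌊y⌋₊ : ℝ) ≤ y := Nat.floor_le hy0
  have hf2 : y < ⌊y⌋₊ + 1 := Nat.lt_floor_add_one y
  have hf3 : ⌊y⌋₊ ≤ L := Nat.floor_le_of_le hyL
  have hxy : |x| = w * y / L := by
    rw [hy]
    field_simp
  have key : |x| - w * ⌊y⌋₊ / L ≤ w / L ∧ w * ⌊y⌋₊ / L ≤ |x| := by
    rw [hxy]
    constructor
    · rw [← sub_div, ← mul_sub]
      gcongr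
      nlinarith
    · gcongr
  have hk0 : 0 ≤ w * (⌊y⌋₊ : ℝ) / L := by positivity
  rcases le_total 0 x with h | h
  · refine ⟨L + ⌊y⌋₊, by omega, ?_⟩
    have e : w * (((L + ⌊y⌋₊ : ℕ) : ℝ) - L) / L = w * ⌊y⌋₊ / L := by push_cast; ring
    rw [e, abs_of_nonneg hk0]
    refine ⟨?_, key.2⟩
    rw [abs_of_nonneg h] at key
    rw [abs_of_nonneg (by linarith)]
    exact key.1
  · refine ⟨L - ⌊y⌋₊, by omega, ?_⟩
    have e : w * (((L - ⌊y⌋₊ : ℕ) : ℝ) - L) / L = -(w * ⌊y⌋₊ / L) := by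
      rw [Nat.cast_sub hf3]
      ring
    rw [e, abs_neg, abs_of_nonneg hk0]
    refine ⟨?_, key.2⟩
    rw [abs_of_nonpos h] at key
    rw [sub_neg_eq_add, abs_of_nonpos (by linarith)]
    linarith [key.1]

theorem exists_gridPoint {w η : ℝ} (hw : 0 < w) {L : ℕ} (hη : 2 * w ≤ max (L : ℝ) 1 * η) {p : ℂ}
    (hp : ‖p‖ ≤ w) :
    ∃ a b, a < 2 * L + 1 ∧ b < 2 * L + 1 ∧ ‖p - gridPoint w L a b‖ ≤ η := by
  rcases Nat.eq_zero_or_pos L with rfl | hL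
  -- For `L = 0` the division by zero makes the only grid point the centre, and the hypothesis reads
  -- `2 * w ≤ η`.
  · refine ⟨0, 0, by omega, by omega, ?_⟩
    have : gridPoint w 0 0 0 = 0 := by simp [gridPoint]
    rw [this, sub_zero]
    simp at hη
    linarith
  · have hL' : (1 : ℝ) ≤ L := by exact_mod_cast hL
    rw [max_eq_left hL'] at hη
    obtain ⟨a, ha, ha1, ha2⟩ := exists_grid_coord hw hL ((Complex.abs_re_le_norm p).trans hp)
    obtain ⟨b, hb, hb1, hb2⟩ := exists_grid_coord hw hL ((Complex.abs_im_le_norm p).trans hp)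
    refine ⟨a, b, by omega, by omega, ?_⟩
    set z : ℂ := (w : ℂ) * (((a : ℂ) - L) + Complex.I * ((b : ℂ) - L)) / L with hz
    have hzz : z = ⟨w * ((a : ℝ) - L) / L, w * ((b : ℝ) - L) / L⟩ := by
      rw [Complex.mk_eq_add_mul_I, hz]
      push_cast
      ring
    have hzw : ‖z‖ ^ 2 ≤ w ^ 2 := by
      have h1 : ‖z‖ ^ 2 ≤ ‖p‖ ^ 2 := by
        rw [← Complex.normSq_eq_norm_sq, ← Complex.normSq_eq_norm_sq, Complex.normSq_apply,
          Complex.normSq_apply, hzz]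
        have := sq_le_sq.2 ha2
        have := sq_le_sq.2 hb2
        dsimp only
        nlinarith
      exact h1.trans (by gcongr)
    have hg : gridPoint w L a b = z := by
      rw [gridPoint]
      exact if_pos hzw
    rw [hg]
    calc ‖p - z‖ ≤ |(p - z).re| + |(p - z).im| := Complex.norm_le_abs_re_add_abs_im _
      _ ≤ w / L + w / L := by
          rw [Complex.sub_re, Complex.sub_im, hzz]
          exact add_le_add ha1 hb1
      _ ≤ η := by
          rw [← add_div, div_le_iff₀ (by linarith)]
          linarith

/-- Every tuple of digits has a code, so one counter enumerates all tuples. The induction prepends a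
digit as `f 0 + b * l`. -/
theorem exists_digits {b n : ℕ} (f : ℕ → ℕ) (hf : ∀ j < n, f j < b) :
    ∃ l < b ^ n, ∀ j < n, l / b ^ j % b = f j := by
  induction n generalizing f with
  | zero => exact ⟨0, by simp, by simp⟩
  | succ n ih =>
    obtain ⟨l, hl, h⟩ := ih (fun j => f (j + 1)) fun j hj => hf (j + 1) (by omega)
    have h0 := hf 0 (by omega)
    refine ⟨f 0 + b * l, ?_, fun j hj => ?_⟩
    · rw [pow_succ']
      nlinarith
    · rcases j with _ | j
      · simp [Nat.mod_eq_of_lt h0]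
      · have hb : 0 < b := by omega
        rw [pow_succ', ← Nat.div_div_eq_div_mul, Nat.add_mul_div_left _ _ hb,
          Nat.div_eq_of_lt h0, zero_add, h j (by omega)]

/-- The vector of grid points whose coordinates are the digits of `l`. -/
noncomputable def gridVec (w : ℝ) (L l : ℕ) (i : ℕ) : ℂ :=
  gridPoint w L (l / (2 * L + 1) ^ (2 * i) % (2 * L + 1))
    (l / (2 * L + 1) ^ (2 * i + 1) % (2 * L + 1))

theorem exists_gridVec {M : ℕ} {w η : ℝ} (hw : 0 < w) {L : ℕ} (hη : 2 * w ≤ max (L : ℝ) 1 * η)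
    {p : Fin M → ℂ} (hp : ∀ i, ‖p i‖ ≤ w) :
    ∃ l < (2 * L + 1) ^ (2 * M), ∀ i : Fin M, ‖p i - gridVec w L l i‖ ≤ η := by
  choose a b ha hb hab using fun i => exists_gridPoint hw hη (hp i)
  -- The digits in positions `2 i` and `2 i + 1` encode the real and the imaginary part of
  -- coordinate `i`.
  obtain ⟨l, hl, h⟩ := exists_digits (b := 2 * L + 1) (n := 2 * M)
    (fun j => if hj : j / 2 < M then (if j % 2 = 0 then a ⟨j / 2, hj⟩ else b ⟨j / 2, hj⟩) else 0)
    fun j hj => by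
      split_ifs
      · exact ha _
      · exact hb _
      · omega
  refine ⟨l, hl, fun i => ?_⟩
  have h1 := h (2 * i) (by omega)
  have h2 := h (2 * i + 1) (by omega)
  have e1 : 2 * (i : ℕ) / 2 = i := by omega
  have e2 : (2 * (i : ℕ) + 1) / 2 = i := by omega
  simp only [e1, i.2, dif_pos, Nat.mul_mod_right, if_true] at h1
  have e3 : (2 * (i : ℕ) + 1) % 2 ≠ 0 := by omega
  simp only [e2, i.2, dif_pos, e3, if_false] at h2
  rw [gridVec, h1, h2]
  exact hab i

end

namespace RealRAM

/-! ## The selection test on the machine -/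

open Matrix

section
variable {m d M : ℕ} {w : Fin (m + 1) → ℝ} {A : Fin (m + 1) → Fin M → Matrix (Fin d) (Fin d) ℂ}

/-- The store holds the sizes, the widths and the operators. -/
structure Env (w : Fin (m + 1) → ℝ) (A : Fin (m + 1) → Fin M → Matrix (Fin d) (Fin d) ℂ)
    (s : CMem) : Prop where
  dim : s.n 1 = d
  terms : s.n 2 = M
  parties : s.n 3 = m
  wid : ∀ t : Fin (m + 1), s.wd t = w t
  op : ∀ (t : Fin (m + 1)) (i : Fin M), matAt d (s.ca 0) (t * M + i) = A t i

/-- The program does not write to the cells that `Env` refers to. -/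
def Prog.keepsEnv (p : Prog) : Bool :=
  !p.modN 1 && !p.modN 2 && !p.modN 3 && !p.modRA 0 && !p.modCA 0

theorem Env.frame {p : Prog} {s s' : CMem} (h : Env w A s) (hF : Frame p s s')
    (hp : p.keepsEnv = true) : Env w A s' := by
  simp only [Prog.keepsEnv, Bool.and_eq_true, Bool.not_eq_true'] at hp
  obtain ⟨⟨⟨⟨h1, h2⟩, h3⟩, h4⟩, h5⟩ := hp
  exact ⟨(hF.n 1 h1).trans h.dim, (hF.n 2 h2).trans h.terms, (hF.n 3 h3).trans h.parties,
    fun t => by rw [hF.wd h4]; exact h.wid t, fun t i => by rw [hF.ca 0 h5]; exact h.op t i⟩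

/-- Compute the power of the matrix of the current direction, and its trace. -/
def oracle : Prog := buildMat ;; powMat ;; trMat

theorem oracle_runs {s : CMem} (hE : Env w A s) {t : Fin (m + 1)} (ht : s.n 10 = t) {U V : ℕ}
    (hd : d + 1 ≤ U) (hM : M + 1 ≤ U) (hN : s.n 19 + 2 ≤ V) :
    Runs oracle s (800 * V * U ^ 3) fun s' =>
      matAt d (s'.ca 2) 0 = s.c 3 • 1 - dirOp (A t) (fun i => s.ca 5 i) ∧
      matAt d (s'.ca 3) 0 = (s.c 3 • 1 - dirOp (A t) (fun i => s.ca 5 i)) ^ s.n 19 ∧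
      s'.c 5 = ((s.c 3 • 1 - dirOp (A t) (fun i => s.ca 5 i)) ^ s.n 19).trace := by
  refine Runs.le ?_ (Runs.seq (Runs.call (buildMat_runs hE.dim hE.terms) fun s1 hF1 h1 =>
    Runs.seq (Runs.call (powMat_runs (N := s.n 19) (d := d) ?_ ?_) fun s2 hF2 h2 =>
    Runs.call (trMat_runs (d := d) ?_) fun s3 hF3 h3 => ?_)))
  · have h1 : (d + 1) * ((d + 1) * ((M + 1) * 400 + 100) + 8) ≤ U * (U * (U * 400 + 100) + 8) := by
      gcongr
    have h2 : (s.n 19 + 2) * ((d + 1) * ((d + 1) * ((d + 1) * 100 + 100) + 24)) ≤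
        V * (U * (U * (U * 100 + 100) + 24)) := by gcongr
    have h3 : (d + 1) * 60 ≤ U * 60 := by gcongr
    have hU : 1 ≤ U := by omega
    have hV : 1 ≤ V := by omega
    have p1 : U ≤ U ^ 3 := Nat.le_self_pow (by norm_num) U
    have p2 : U ^ 2 ≤ U ^ 3 := Nat.pow_le_pow_right hU (by norm_num)
    have q1 := Nat.mul_le_mul_left V p1
    have q2 := Nat.mul_le_mul_left V p2
    have q3 := Nat.mul_le_mul_right (U ^ 3) hV
    linarith
  · simpa (disch := decide) [hF1.n] using hE.dim
  · simp (disch := decide) [hF1.n]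
  · simpa (disch := decide) [hF1.n, hF2.n] using hE.dim
  · have e : hermPart (∑ i : Fin M, (starRingEnd ℂ) (s.ca 5 i) •
        matAt d (s.ca 0) (s.n 10 * M + i)) = dirOp (A t) (fun i => s.ca 5 i) := by
      simp only [ht, hE.op, dirOp]
    rw [e] at h1
    rw [h1] at h2
    refine ⟨?_, ?_, ?_⟩
    · rw [hF3.ca 2 (by decide), hF2.ca 2 (by decide), h1]
    · rw [hF3.ca 3 (by decide), h2]
    · rw [h3, h2]

/-- One round of the selection test for the point in the array `4`; the round is counted by the
register `20`. -/
def roundProg : Prog :=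
  .setN 19 (nl 6 * (nr 20 + nl 1) * nr 1) ;;
  .setC 3 (cn (nl 4 * (nr 20 + nl 1) * (nr 2 + nl 1)) * (.wid (nr 10) * .wid (nr 10))) ;;
  oracle ;;
  .count 14 2 (.setN 25 (nr 10 * nr 2 + nr 14) ;; trMulMat 0 ;;
    .putC 5 (nr 14) (.get 5 (nr 14) + (cr 4 / cr 5 - .get 4 (nr 14))))

/-- The power oracle supplies the near minimiser required by `Rounds.succ`. Only the traces of its
state against the operators are needed, each a quotient of two traces. -/
theorem roundProg_runs {s : CMem} (hE : Env w A s) {t : Fin (m + 1)} (ht : s.n 10 = t) {U r : ℕ}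
    (hd : d + 1 ≤ U) (hM : M + 1 ≤ U) (hr : s.n 20 = r) (hrU : r + 1 ≤ U ^ 2) (hd0 : 0 < d)
    (hw : 0 < w t) (hA : ∀ i, opNorm (A t i) ≤ w t) (hq : ∀ i : Fin M, ‖s.ca 4 i‖ ≤ w t)
    (hS : Rounds (A t) (w t) (fun i => s.ca 4 i) r fun i => s.ca 5 i) :
    Runs roundProg s (8000 * U ^ 6) fun s' =>
      Rounds (A t) (w t) (fun i => s.ca 4 i) (r + 1) fun i => s'.ca 5 i := by
  set S : Fin M → ℂ := fun i => s.ca 5 i with hSdef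
  -- After `r` rounds `‖S i‖ ≤ 2 r w`, so `R` bounds the linear form. The exponent `6 (r + 1) d`
  -- makes the oracle error `3 R d / N` equal to the slack `w ^ 2 * (M + 1)` in `Rounds`.
  set R : ℝ := 2 * w t ^ 2 * (r + 1) * (M + 1) with hR
  set N := 6 * (r + 1) * d with hNdef
  have hN0 : 0 < N := by positivity
  have hR0 : 0 < R := by positivity
  have hb : ∀ ρ, IsDensity ρ → |(dirOp (A t) S * ρ).trace.re| ≤ R := fun ρ hρ => by
    refine (abs_re_trace_dirOp_mul_le hA (hS.norm_le hA hq) hρ).trans ?_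
    have : (M : ℝ) * r ≤ (M + 1) * (r + 1) := by
      nlinarith [Nat.cast_nonneg (α := ℝ) M, Nat.cast_nonneg (α := ℝ) r]
    have h2 := mul_le_mul_of_nonneg_left this (by positivity : 0 ≤ 2 * w t ^ 2)
    rw [hR]
    linarith
  obtain ⟨hσ, hmin⟩ := gibbs_sub_spec hd0 (G := dirOp (A t) S) (isHermitian_hermPart _) hR0 hb hN0
  set P := ((2 * R : ℝ) : ℂ) • 1 - dirOp (A t) S with hP
  refine Runs.le ?_ (Runs.seq (Runs.setN (Runs.seq (Runs.setC (Runs.seq (Runs.call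
    (oracle_runs (w := w) (A := A) (t := t) (U := U) (V := 8 * U ^ 3) ?_ ?_ hd hM ?_)
    fun s1 hF1 h1 =>
    Runs.count M (T := U * (U * 120 + 40) + 100) (fun j s' => ∀ i : Fin M, s'.ca 5 i =
      if (i : ℕ) < j then S i + (qVec (A t) (gibbs P N) i - s.ca 4 i) else S i)
      ?_ (by decide) (by decide) ?_ ?_ ?_))))))
  · have c1 : (nl 6 * (nr 20 + nl 1) * nr 1).cost + 1 ≤ 20 := by decide
    have c2 : (cn (nl 4 * (nr 20 + nl 1) * (nr 2 + nl 1)) *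
      (.wid (nr 10) * .wid (nr 10))).cost + 4 ≤ 100 := by decide
    have hU : 1 ≤ U := by omega
    have h3 : (M + 1) * (U * (U * 120 + 40) + 100 + 8) ≤ U * (U * (U * 120 + 40) + 100 + 8) := by
      gcongr
    have p0 : 1 ≤ U ^ 6 := Nat.one_le_pow _ _ hU
    have p1 : U ≤ U ^ 6 := Nat.le_self_pow (by norm_num) U
    have p2 : U ^ 2 ≤ U ^ 6 := Nat.pow_le_pow_right hU (by norm_num)
    have p3 : U ^ 3 ≤ U ^ 6 := Nat.pow_le_pow_right hU (by norm_num)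
    linarith
  · exact ⟨by simpa using hE.dim, by simpa using hE.terms, by simpa using hE.parties,
      by simpa using hE.wid, by simpa using hE.op⟩
  · simpa using ht
  · have h1 : d ≤ U := by omega
    have h2 : 6 * (r + 1) * d ≤ 6 * U ^ 2 * U := by gcongr
    have p3 : 1 ≤ U ^ 3 := Nat.one_le_pow _ _ (by omega)
    simp [hr, hE.dim]
    linarith
  · simpa (disch := decide) [hF1.n] using hE.terms
  · intro i
    simp (disch := decide) [hF1.ca, hSdef]
  · intro j hj s2 hF2 hj2 hI
    have hE2 : Env w A s2 := by
      have hE0 : Env w A s1 := Env.frame (p := oracle) (s := ((s.setN 19 _).setC 3 _))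
        ⟨by simpa using hE.dim, by simpa using hE.terms, by simpa using hE.parties,
        by simpa using hE.wid, by simpa using hE.op⟩ hF1 (by decide)
      exact hE0.frame hF2 (by decide)
    have g3 : matAt d (s2.ca 3) 0 = P ^ N ∧ s2.c 5 = (P ^ N).trace := by
      rw [hF2.ca 3 (by decide), hF2.c 5 (by decide), h1.2.1, h1.2.2]
      have e1 : 4 * ((r : ℂ) + 1) * (M + 1) * ((w t : ℂ) * w t) = ((2 * R : ℝ) : ℂ) := by
        rw [hR]
        push_cast
        ring
      simp [hr, hE.dim, hE.terms, ht, hE.wid, e1, hP, hNdef, hSdef]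
    have g4 : s2.ca 4 = s.ca 4 := by simp (disch := decide) [hF2.ca, hF1.ca]
    have g10 : s2.n 10 = t := by simpa (disch := decide) [hF2.n, hF1.n] using ht
    refine Runs.le ?_ (Runs.seq (Runs.setN (Runs.seq (Runs.call (trMulMat_runs (d := d) 0 ?_)
      fun s3 hF3 h3 => Runs.putC ?_))))
    · have c1 : (nr 10 * nr 2 + nr 14).cost + 1 ≤ 10 := by decide
      have c2 : (CExp.get 5 (nr 14) + (cr 4 / cr 5 - .get 4 (nr 14))).cost + 2 * (nr 14).cost + 4 ≤
        90 := by decide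
      have h3 : (d + 1) * ((d + 1) * 120 + 40) ≤ U * (U * 120 + 40) := by gcongr
      linarith
    · simpa using hE2.dim
    · have e4 : s3.c 4 / s3.c 5 = qVec (A t) (gibbs P N) ⟨j, hj⟩ := by
        rw [h3, hF3.c 5 (by decide)]
        simp only [NExp.ev_add, NExp.ev_mul, NExp.ev_reg, CMem.setN_n, Function.update_self,
          CMem.setN_ca, CMem.setN_c, g10, hE2.terms, hj2]
        have := hE2.op t ⟨j, hj⟩
        rw [this, g3.1, g3.2, qVec, gibbs, mul_smul_comm, trace_smul, smul_eq_mul, div_eq_inv_mul]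
      have e5 : s3.ca 5 = s2.ca 5 := by simp (disch := decide) [hF3.ca]
      have e6 : s3.ca 4 = s.ca 4 := by simp (disch := decide) [hF3.ca, g4]
      have e14 : s3.n 14 = j := by simp (disch := decide) [hF3.n, hj2]
      intro i
      simp only [CMem.setN_ca, CMem.putC_ca, Function.update_self, NExp.ev_reg, CExp.ev_add,
        CExp.ev_sub, CExp.ev_div, CExp.ev_get, CExp.ev_reg, e4, e5, e6, e14]
      rcases eq_or_ne (i : ℕ) j with hij | hij
      · have hi : i = ⟨j, hj⟩ := Fin.ext hij
        have := hI ⟨j, hj⟩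
        simp at this
        simp [hi, this]
      · rw [Function.update_of_ne hij, hI i]
        have : (i : ℕ) < j ↔ (i : ℕ) < j + 1 := by omega
        simp only [this]
  · intro s2 hF2 _ hI
    have : (fun i : Fin M => s2.ca 5 i) =
        fun i => S i + (qVec (A t) (gibbs P N) i - s.ca 4 i) := by
      ext i
      rw [hI i, if_pos i.2]
    rw [this]
    refine Rounds.succ hS hσ fun ρ hρ => (hmin ρ hρ).trans_eq ?_
    have hd' : (d : ℝ) ≠ 0 := by positivity
    have hr' : (r : ℝ) + 1 ≠ 0 := by positivity
    rw [hR, hNdef]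
    push_cast
    field_simp
    ring

/-- Run the selection test for the point in the array `4`: the rounds, whose number is in the
register `9`, and then the square sum of the accumulated differences, to the complex register
`6`. -/
def testProg : Prog :=
  .count 14 2 (.putC 5 (nr 14) (cn (nl 0))) ;; .count 20 9 roundProg ;;
  .sum 14 2 6 (.get 5 (nr 14) * .conj (.get 5 (nr 14)))

theorem testProg_runs {s : CMem} (hE : Env w A s) {t : Fin (m + 1)} (ht : s.n 10 = t) {U r : ℕ}
    (hd : d + 1 ≤ U) (hM : M + 1 ≤ U) (hr : s.n 9 = r) (hrU : r ≤ U ^ 2) (hd0 : 0 < d)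
    (hw : 0 < w t) (hA : ∀ i, opNorm (A t i) ≤ w t) (hq : ∀ i : Fin M, ‖s.ca 4 i‖ ≤ w t) :
    Runs testProg s (17000 * U ^ 8) fun s' => ∃ S : Fin M → ℂ,
      Rounds (A t) (w t) (fun i => s.ca 4 i) r S ∧ s'.c 6 = ((∑ i, ‖S i‖ ^ 2 : ℝ) : ℂ) := by
  refine Runs.le ?_ (Runs.seq (Runs.count M (T := 20) (fun j s' => ∀ i < j, s'.ca 5 i = 0) hE.terms
    (by decide) (by decide) ?_ ?_ fun s1 hF1 _ h1 =>
    Runs.seq (Runs.count r (T := 8000 * U ^ 6) (fun j s' => Rounds (A t) (w t)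
      (fun i => s.ca 4 i) j fun i => s'.ca 5 i) ?_ (by decide) (by decide) ?_ ?_
      fun s2 hF2 _ h2 => Runs.call (Runs.sum (n := M) (fun i => s2.ca 5 i *
        (starRingEnd ℂ) (s2.ca 5 i)) ?_ (by decide) ?_) fun s3 _ h3 => ?_)))
  · have c1 : (CExp.get 5 (nr 14) * .conj (.get 5 (nr 14))).cost + 24 ≤ 60 := by decide
    have hU : 1 ≤ U := by omega
    have h1 : (M + 1) * (20 + 8) ≤ U * 28 := by gcongr
    have h2 : (M + 1) * ((CExp.get 5 (nr 14) * .conj (.get 5 (nr 14))).cost + 24) ≤ U * 60 := by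
      gcongr
    have h3 : (r + 1) * (8000 * U ^ 6 + 8) ≤ (U ^ 2 + 1) * (8000 * U ^ 6 + 8) := by gcongr
    have p0 : 1 ≤ U ^ 8 := Nat.one_le_pow _ _ hU
    have p1 : U ≤ U ^ 8 := Nat.le_self_pow (by norm_num) U
    have p2 : U ^ 2 ≤ U ^ 8 := Nat.pow_le_pow_right hU (by norm_num)
    have p3 : U ^ 6 ≤ U ^ 8 := Nat.pow_le_pow_right hU (by norm_num)
    linarith
  · simp
  · intro j hj s2 _ hj2 hI
    refine Runs.le (by decide) (Runs.putC fun i hi => ?_)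
    simp only [CMem.setN_ca, CMem.putC_ca, Function.update_self, NExp.ev_reg, hj2, CExp.ev_ofN,
      NExp.ev_lit, Nat.cast_zero]
    rcases eq_or_ne i j with rfl | hij
    · simp
    · rw [Function.update_of_ne hij, hI i (by omega)]
  · simpa (disch := decide) [hF1.n] using hr
  · have : (fun i : Fin M => (s1.setN 20 0).ca 5 i) = 0 := by
      ext i
      simpa using h1 i i.2
    rw [this]
    exact Rounds.zero
  · intro j hj s2 hF2 hj2 hI
    have g4 : s2.ca 4 = s.ca 4 := by simp (disch := decide) [hF2.ca, hF1.ca]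
    have hE2 : Env w A s2 := (hE.frame hF1 (by decide)).frame hF2 (by decide)
    have := roundProg_runs hE2 (t := t) (U := U) (r := j)
      (by simpa (disch := decide) [hF2.n, hF1.n] using ht) hd hM hj2 (by omega) hd0 hw hA
      (by simpa [g4] using hq) (by simpa only [g4] using hI)
    simpa only [g4, CMem.setN_ca] using this
  · simpa (disch := decide) [hF2.n, hF1.n] using hE.terms
  · intro i hi s3 hF3 hi3
    simp (disch := decide) [hF3.ca, hi3]
  · refine ⟨_, h2, ?_⟩
    rw [h3, Finset.sum_range]
    simp [Complex.mul_conj, Complex.normSq_eq_norm_sq]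

end

end RealRAM

namespace RealRAM

/-! ## Generation of the nets on the machine -/

open Matrix

@[simp] theorem Prog.modN_ite (p q : Prog) (b : Test) (u : ℕ) :
    (Prog.ite b p q).modN u = (p.modN u || q.modN u) := rfl

@[simp] theorem Prog.modN_skip (u : ℕ) : Prog.skip.modN u = false := rfl

/-- Tabulate the quotients and the remainders by the register `bs` of the numbers below the register
`sz` in the index arrays `da` and `ma`. -/
def tableProg (bs sz da ma : ℕ) : Prog :=
  .setN 22 (nl 0) ;; .setN 23 (nl 0) ;; .count 21 sz
    (.putN da (nr 21) (nr 22) ;; .putN ma (nr 21) (nr 23) ;; .setN 23 (nr 23 + nl 1) ;;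
      .ite (.nle (nr bs) (nr 23)) (.setN 23 (nl 0) ;; .setN 22 (nr 22 + nl 1)) .skip)

/-- The machine has no integer division. Quotient and remainder are maintained by two counters while
the argument runs upwards, the remainder being reset when it reaches the base. -/
theorem tableProg_runs {s : CMem} {bs sz da ma b n : ℕ} (hb : s.n bs = b) (hn : s.n sz = n)
    (hb0 : 0 < b) (hda : da ≠ ma) (h1 : bs ≠ 21 ∧ bs ≠ 22 ∧ bs ≠ 23)
    (h2 : sz ≠ 21 ∧ sz ≠ 22 ∧ sz ≠ 23) :
    Runs (tableProg bs sz da ma) s ((n + 1) * 60) fun s' =>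
      ∀ x < n, s'.na da x = x / b ∧ s'.na ma x = x % b := by
  refine Runs.le ?_ (Runs.seq (Runs.setN (Runs.seq (Runs.setN (Runs.count n (T := 40)
    (fun j s' => s'.n 22 = j / b ∧ s'.n 23 = j % b ∧
      ∀ x < j, s'.na da x = x / b ∧ s'.na ma x = x % b) ?_ ?_ ?_ ?_ ?_ ?_)))))
  · simp only [NExp.cost]
    omega
  · simp [h2.2.1, h2.2.2, hn]
  · simp
  · simp [h2.1.symm, h2.2.1.symm, h2.2.2.symm]
  · simp
  · intro j hj s1 hF1 hj1 ⟨hq, hr, hI⟩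
    have eb : s1.n bs = b := by
      rw [hF1.n bs (by simp [h1.1.symm, h1.2.1.symm, h1.2.2.symm])]
      simp [h1.2.1, h1.2.2, hb]
    have key : (b ≤ j % b + 1 → (j + 1) / b = j / b + 1 ∧ (j + 1) % b = 0) ∧
        (¬ b ≤ j % b + 1 → (j + 1) / b = j / b ∧ (j + 1) % b = j % b + 1) := by
      have h3 := Nat.div_add_mod j b
      have h4 := Nat.mod_lt j hb0
      constructor
      · intro h
        have e : j + 1 = b * (j / b + 1) := by
          have : j % b + 1 = b := by omega
          linarith
        rw [e]
        simp [Nat.mul_div_cancel_left _ hb0]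
      · intro h
        have e : j + 1 = b * (j / b) + (j % b + 1) := by omega
        have hlt : j % b + 1 < b := by omega
        have e1 : (j + 1) / b = j / b := by
          conv_lhs => rw [e]
          rw [Nat.mul_add_div hb0, Nat.div_eq_of_lt hlt, add_zero]
        have e2 : (j + 1) % b = j % b + 1 := by
          conv_lhs => rw [e]
          rw [Nat.mul_add_mod, Nat.mod_eq_of_lt hlt]
        exact ⟨e1, e2⟩
    have hI' : ∀ x < j + 1, (Function.update (s1.na da) j (j / b) x = x / b) ∧
        (Function.update (s1.na ma) j (j % b) x = x % b) := by
      intro x hx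
      rcases eq_or_ne x j with rfl | hxj
      · simp
      · rw [Function.update_of_ne hxj, Function.update_of_ne hxj]
        exact hI x (by omega)
    refine Runs.le (T := 3 + (3 + (4 + (3 + 9)))) (by norm_num) (Runs.seq (Runs.putN (Runs.seq
      (Runs.putN (Runs.seq (Runs.setN ?_))))))
    refine Runs.iteN (fun h => ?_) fun h => ?_
    · have h' : b ≤ j % b + 1 := by simpa [h1.2.2, eb, hr] using h
      refine Runs.le (T := 2 + 4) (by norm_num) (Runs.seq (Runs.setN (Runs.setN ?_)))
      have := key.1 h'
      simpa [hj1, hq, hr, this, hda, hda.symm] using hI'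
    · have h' : ¬ b ≤ j % b + 1 := by simpa [h1.2.2, eb, hr] using h
      refine Runs.le (by norm_num) (Runs.skip ?_)
      have := key.2 h'
      simpa [hj1, hq, hr, this, hda, hda.symm] using hI'
  · intro s' _ _ h
    exact h.2.2

/-- The store holds the grid size, the numbers derived from it, the tables for the digits, the
precision and the product of the widths. -/
structure Sizes (m M L : ℕ) (δ W : ℝ) (s : CMem) : Prop where
  mesh : s.n 4 = L
  base : s.n 5 = 2 * L + 1
  grid : s.n 6 = (2 * L + 1) ^ (2 * M)
  total : s.n 7 = ((2 * L + 1) ^ (2 * M)) ^ m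
  coords : s.n 8 = 2 * M
  rounds : s.n 9 = (L + 1) ^ 2
  precision : s.c 0 = δ
  width : s.c 1 = W
  digit : ∀ x < (2 * L + 1) ^ (2 * M), s.na 1 x = x / (2 * L + 1) ∧ s.na 2 x = x % (2 * L + 1)
  index : ∀ x < ((2 * L + 1) ^ (2 * M)) ^ m, s.na 3 x = x / (2 * L + 1) ^ (2 * M) ∧
    s.na 4 x = x % (2 * L + 1) ^ (2 * M)

/-- The program does not write to the cells that `Sizes` refers to. -/
def Prog.keepsSizes (p : Prog) : Bool :=
  [4, 5, 6, 7, 8, 9].all (fun v => !p.modN v) && [0, 1].all (fun r => !p.modC r) &&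
    [1, 2, 3, 4].all (fun a => !p.modNA a)

theorem Sizes.frame {m M L : ℕ} {δ W : ℝ} {p : Prog} {s s' : CMem} (h : Sizes m M L δ W s)
    (hF : Frame p s s') (hp : p.keepsSizes = true) : Sizes m M L δ W s' := by
  simp only [Prog.keepsSizes, List.all_cons, List.all_nil, Bool.and_eq_true, Bool.not_eq_true',
    and_true] at hp
  obtain ⟨⟨⟨h4, h5, h6, h7, h8, h9⟩, c0, c1⟩, a1, a2, a3, a4⟩ := hp
  exact ⟨(hF.n 4 h4).trans h.mesh, (hF.n 5 h5).trans h.base, (hF.n 6 h6).trans h.grid,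
    (hF.n 7 h7).trans h.total, (hF.n 8 h8).trans h.coords, (hF.n 9 h9).trans h.rounds,
    (hF.c 0 c0).trans h.precision, (hF.c 1 c1).trans h.width,
    by rw [hF.na 1 a1, hF.na 2 a2]; exact h.digit, by rw [hF.na 3 a3, hF.na 4 a4]; exact h.index⟩

/-- Store the digits of the register `11` in the index array `5`. -/
def digitProg : Prog :=
  .setN 12 (nr 11) ;; .count 13 8 (.putN 5 (nr 13) (.get 2 (nr 12)) ;; .setN 12 (.get 1 (nr 12)))

/-- Each division by the base is a table lookup; iterated quotients of `l` never exceed `l`, so the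
lookups stay inside the table. -/
theorem digitProg_runs {m M L l : ℕ} {δ W : ℝ} {s : CMem} (hs : Sizes m M L δ W s)
    (hl : s.n 11 = l) (hlt : l < (2 * L + 1) ^ (2 * M)) :
    Runs digitProg s ((M + 1) * 50) fun s' =>
      ∀ j < 2 * M, s'.na 5 j = l / (2 * L + 1) ^ j % (2 * L + 1) := by
  refine Runs.le ?_ (Runs.seq (Runs.setN (Runs.count (2 * M) (T := 10)
    (fun j s' => s'.n 12 = l / (2 * L + 1) ^ j ∧
      ∀ i < j, s'.na 5 i = l / (2 * L + 1) ^ i % (2 * L + 1)) ?_ (by decide) (by decide) ?_ ?_ ?_)))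
  · simp only [NExp.cost]
    omega
  · simpa using hs.coords
  · simp [hl]
  · intro j hj s1 hF1 hj1 ⟨hq, hI⟩
    have hs0 : Sizes m M L δ W (s.setN 12 (NExp.ev s (nr 11))) :=
      hs.frame (Frame.setN (v := 12) (nr 11) s _) (by decide)
    have hs1 := hs0.frame hF1 (by decide)
    have hd := hs1.digit (l / (2 * L + 1) ^ j) ((Nat.div_le_self _ _).trans_lt hlt)
    refine Runs.le (by decide) (Runs.seq (Runs.putN (Runs.setN ⟨?_, ?_⟩)))
    · simp [hq, hd.1, Nat.div_div_eq_div_mul, pow_succ]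
    · intro i hi
      rcases eq_or_ne i j with rfl | hij
      · simp [hj1, hq, hd.2]
      · simp [hj1, hij, hI i (by omega)]
  · intro s1 _ _ h
    exact h.2

/-- Store in the array `4` the grid point whose digits are in the index array `5`. -/
def pointProg : Prog :=
  .count 14 2 (
    .setC 6 (.wid (nr 10) * ((cn (.get 5 (nl 2 * nr 14)) - cn (nr 4)) +
      .unitI * (cn (.get 5 (nl 2 * nr 14 + nl 1)) - cn (nr 4))) / cn (nr 4)) ;;
    .ite (.cle (cr 6 * .conj (cr 6)) (.wid (nr 10) * .wid (nr 10)))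
      (.putC 4 (nr 14) (cr 6)) (.putC 4 (nr 14) (cn (nl 0))))

/-- The disc is tested on squared moduli, as the machine has no roots. Machine division by zero
agrees with `gridPoint` at `L = 0`. -/
theorem pointProg_runs {m M L l : ℕ} {δ W v : ℝ} {s : CMem} (hs : Sizes m M L δ W s)
    (hM : s.n 2 = M) (hv : s.wd (s.n 10) = v)
    (hd : ∀ j < 2 * M, s.na 5 j = l / (2 * L + 1) ^ j % (2 * L + 1)) :
    Runs pointProg s ((M + 1) * 600) fun s' => ∀ i < M, s'.ca 4 i = gridVec v L l i := by
  refine Runs.le ?_ (Runs.count M (T := 580) (fun j s' => ∀ i < j, s'.ca 4 i = gridVec v L l i)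
    hM (by decide) (by decide) (by simp) ?_ ?_)
  · gcongr
    norm_num
  · intro j hj s1 hF1 hj1 hI
    have e4 : s1.n 4 = L := (hF1.n 4 (by decide)).trans hs.mesh
    have e10 : s1.n 10 = s.n 10 := hF1.n 10 (by decide)
    have ew : s1.wd = s.wd := hF1.wd (by decide)
    have e5 : s1.na 5 = s.na 5 := hF1.na 5 (by decide)
    have key : ∀ z : ℂ, z = gridVec v L l j → ∀ i < j + 1,
        Function.update (s1.ca 4) j z i = gridVec v L l i := by
      intro z hz i hi
      rcases eq_or_ne i j with rfl | hij
      · simpa using hz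
      · rw [Function.update_of_ne hij, hI i (by omega)]
    set z : ℂ := (v : ℂ) * (((l / (2 * L + 1) ^ (2 * j) % (2 * L + 1) : ℕ) - (L : ℂ)) +
      Complex.I * ((l / (2 * L + 1) ^ (2 * j + 1) % (2 * L + 1) : ℕ) - (L : ℂ))) / L with hz
    have hev : (.wid (nr 10) * ((cn (.get 5 (nl 2 * nr 14)) - cn (nr 4)) +
      .unitI * (cn (.get 5 (nl 2 * nr 14 + nl 1)) - cn (nr 4))) / cn (nr 4) : CExp).ev s1 = z := by
      simp only [CExp.ev_mul, CExp.ev_wid, NExp.ev_reg, CExp.ev_div, CExp.ev_add, CExp.ev_sub,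
        CExp.ev_ofN, NExp.ev_get, NExp.ev_mul, NExp.ev_lit, NExp.ev_add, CExp.ev_unitI, e4, e10, ew,
        e5, hj1, hv]
      rw [hd _ (by omega), hd _ (by omega)]
    have hc : ((cr 6 * .conj (cr 6) : CExp).ev (s1.setC 6 z)).re ≤
        ((.wid (nr 10) * .wid (nr 10) : CExp).ev (s1.setC 6 z)).re ↔ ‖z‖ ^ 2 ≤ v ^ 2 := by
      simp only [CExp.ev_mul, CExp.ev_reg, CExp.ev_conj, CExp.ev_wid, NExp.ev_reg, CMem.setC_c,
        CMem.setC_n, CMem.setC_wd, Function.update_self, e10, ew, hv]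
      rw [Complex.mul_conj, Complex.normSq_eq_norm_sq, ← Complex.ofReal_mul, Complex.ofReal_re,
        Complex.ofReal_re, sq v]
    refine Runs.le (T := 520 + 50) (by norm_num) (Runs.seq (Runs.le (by decide) (Runs.setC ?_)))
    rw [hev]
    refine Runs.le (by decide) (Runs.iteC (T := 20) (fun h => ?_) fun h => ?_)
    · have : gridVec v L l j = z := if_pos (hc.1 h)
      refine Runs.le (by decide) (Runs.putC ?_)
      simpa [hj1] using key z this.symm
    · have : gridVec v L l j = 0 := if_neg fun h' => h (hc.2 h')
      refine Runs.le (by decide) (Runs.putC ?_)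
      simpa [hj1] using key 0 this.symm
  · intro s' _ _ h
    exact h

end RealRAM

namespace RealRAM

open Matrix

/-! ### From tested grid points to stored nets. -/

section
variable {m d M L : ℕ} {w : Fin (m + 1) → ℝ}
  {A : Fin (m + 1) → Fin M → Matrix (Fin d) (Fin d) ℂ} {δ W : ℝ}

/-- Append the point in the array `4` to the net of the current party. -/
def storeProg : Prog :=
  .count 14 2 (.putC 1 ((.get 0 (nr 10) * nr 3 + nr 10) * nr 2 + nr 14) (.get 4 (nr 14))) ;;
  .putN 0 (nr 10) (.get 0 (nr 10) + nl 1)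

/-- The address determines point number, party and coordinate, so appending leaves earlier points
and the nets of other parties intact. -/
theorem storeProg_runs {s : CMem} {t : ℕ} (ht : s.n 10 = t) (htm : t < m) (hM : s.n 2 = M)
    (hm : s.n 3 = m) :
    Runs storeProg s ((M + 1) * 60) fun s' =>
      s'.na 0 = Function.update (s.na 0) t (s.na 0 t + 1) ∧
      ∀ c, ∀ t' < m, ∀ i < M, s'.ca 1 ((c * m + t') * M + i) =
        if c = s.na 0 t ∧ t' = t then s.ca 4 i else s.ca 1 ((c * m + t') * M + i) := by
  refine Runs.le ?_ (Runs.seq (Runs.count M (T := 40) (fun j s' => ∀ c, ∀ t' < m, ∀ i < M,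
    s'.ca 1 ((c * m + t') * M + i) = if (c = s.na 0 t ∧ t' = t) ∧ i < j then s.ca 4 i
      else s.ca 1 ((c * m + t') * M + i)) hM (by decide) (by decide) ?_ ?_ ?_))
    (T := (M + 1) * (40 + 8) + 9)
  · omega
  · simp
  · intro j hj s1 hF1 hj1 hI
    have e10 : s1.n 10 = t := (hF1.n 10 (by decide)).trans ht
    have e2 : s1.n 2 = M := (hF1.n 2 (by decide)).trans hM
    have e3 : s1.n 3 = m := (hF1.n 3 (by decide)).trans hm
    have e0 : s1.na 0 = s.na 0 := hF1.na 0 (by decide)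
    have e4 : s1.ca 4 = s.ca 4 := hF1.ca 4 (by decide)
    refine Runs.le (by decide) (Runs.putC fun c t' ht' i hi => ?_)
    simp only [CMem.setN_ca, CMem.putC_ca, Function.update_self, NExp.ev_add, NExp.ev_mul,
      NExp.ev_get, NExp.ev_reg, CExp.ev_get, e10, e2, e3, e0, e4, hj1]
    by_cases h : (c * m + t') * M + i = (s.na 0 t * m + t) * M + j
    · obtain ⟨h1, h2⟩ := mul_add_inj hi hj h
      obtain ⟨h3, h4⟩ := mul_add_inj ht' htm h1
      subst h2 h3 h4
      simp
    · rw [Function.update_of_ne h, hI c t' ht' i hi]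
      have : ((c = s.na 0 t ∧ t' = t) ∧ i < j) ↔ ((c = s.na 0 t ∧ t' = t) ∧ i < j + 1) := by
        constructor
        · rintro ⟨h1, h2⟩
          exact ⟨h1, by omega⟩
        · rintro ⟨⟨rfl, rfl⟩, h2⟩
          refine ⟨⟨rfl, rfl⟩, ?_⟩
          rcases eq_or_ne i j with rfl | hij
          · exact absurd rfl h
          · omega
      simp only [this]
  · intro s1 hF1 _ hI
    have e10 : s1.n 10 = t := (hF1.n 10 (by decide)).trans ht
    have e0 : s1.na 0 = s.na 0 := hF1.na 0 (by decide)
    refine Runs.le (by decide) (Runs.putN ⟨?_, fun c t' ht' i hi => ?_⟩)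
    · simp [e10, e0]
    · have := hI c t' ht' i hi
      simpa [hi] using this

/-- Test one grid point, and store it when it passes. -/
def candProg : Prog :=
  digitProg ;; pointProg ;; testProg ;;
  .ite (.cle (cn (nr 2) * cr 6) ((cn (nr 9) * cr 7) * (cn (nr 9) * cr 7))) storeProg .skip

/-- Rejection is proved harmless by `Rounds.test_of_close`, acceptance by `Rounds.dis_le`. Between
the two thresholds the outcome is undetermined, which does not matter for an admissible net. -/
theorem candProg_runs {s : CMem} (hE : Env w A s) (hs : Sizes m M L δ W s) {t : Fin m} {l : ℕ}
    {ε : ℝ} (ht : s.n 10 = t) (hl : s.n 11 = l) (hlt : l < (2 * L + 1) ^ (2 * M))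
    (hε : s.c 7 = ε) {U : ℕ} (hd : d + 1 ≤ U) (hM : M + 1 ≤ U) (hLU : L + 1 ≤ U) (hd0 : 0 < d)
    (hw : 0 < w t.castSucc) (hA : ∀ i, opNorm (A t.castSucc i) ≤ w t.castSucc) (hε0 : 0 ≤ ε)
    (hL : 8 * w t.castSucc * (M + 1) ≤ (L + 1) * ε) :
    Runs candProg s (20000 * U ^ 8) fun s' =>
      (s'.na 0 = s.na 0 ∧ s'.ca 1 = s.ca 1 ∧ ¬ ∃ p ∈ qSpace (A t.castSucc), ∀ i : Fin M,
        ‖p i - gridVec (w t.castSucc) L l i‖ ≤ ε / (4 * (M + 1))) ∨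
      (dis (A t.castSucc) (fun i => gridVec (w t.castSucc) L l i) ≤ ε ∧
        s'.na 0 = Function.update (s.na 0) t (s.na 0 t + 1) ∧
        ∀ c, ∀ t' < m, ∀ i < M, s'.ca 1 ((c * m + t') * M + i) =
          if c = s.na 0 t ∧ t' = t then gridVec (w t.castSucc) L l i
          else s.ca 1 ((c * m + t') * M + i)) := by
  refine Runs.le (T := (M + 1) * 50 + ((M + 1) * 600 + (17000 * U ^ 8 + (200 + (M + 1) * 60)))) ?_
    (Runs.seq (Runs.call (digitProg_runs hs hl hlt) fun s1 hF1 h1 => Runs.seq (Runs.call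
      (pointProg_runs (L := L) (l := l) (v := w t.castSucc) (hs.frame hF1 (by decide)) ?_ ?_ h1)
      fun s2 hF2 h2 => Runs.seq (Runs.call
      (testProg_runs (w := w) (A := A) (t := t.castSucc) (r := (L + 1) ^ 2) (U := U)
        ((hE.frame hF1 (by decide)).frame hF2 (by decide)) ?_ hd hM ?_ ?_ hd0 hw hA ?_)
      fun s3 hF3 h3 => ?_))))
  · have hU : 1 ≤ U := by omega
    have p0 : 1 ≤ U ^ 8 := Nat.one_le_pow _ _ hU
    have p1 : U ≤ U ^ 8 := Nat.le_self_pow (by norm_num) U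
    linarith
  · exact (hF1.n 2 (by decide)).trans hE.terms
  · rw [hF1.n 10 (by decide), hF1.wd (by decide), ht]
    exact hE.wid t.castSucc
  · simpa (disch := decide) [hF1.n, hF2.n] using ht
  · simpa (disch := decide) [hF1.n, hF2.n] using hs.rounds
  · gcongr
  · intro i
    rw [h2 i i.2]
    exact norm_gridPoint_le hw.le _ _ _
  · obtain ⟨S, hS, hc6⟩ := h3
    have hg : (fun i : Fin M => s2.ca 4 i) = fun i : Fin M => gridVec (w t.castSucc) L l i := by
      ext i
      exact h2 i i.2
    have hq : ∀ i : Fin M, ‖gridVec (w t.castSucc) L l i‖ ≤ w t.castSucc := fun i =>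
      norm_gridPoint_le hw.le _ _ _
    rw [hg] at hS
    have e2 : s3.n 2 = M := by
      rw [hF3.n 2 (by decide), hF2.n 2 (by decide), hF1.n 2 (by decide), hE.terms]
    have e9 : s3.n 9 = (L + 1) ^ 2 := by
      rw [hF3.n 9 (by decide), hF2.n 9 (by decide), hF1.n 9 (by decide), hs.rounds]
    have e7 : s3.c 7 = ε := by
      rw [hF3.c 7 (by decide), hF2.c 7 (by decide), hF1.c 7 (by decide), hε]
    have hna : s3.na 0 = s.na 0 := by simp (disch := decide) [hF3.na, hF2.na, hF1.na]
    have hca : s3.ca 1 = s.ca 1 := by simp (disch := decide) [hF3.ca, hF2.ca, hF1.ca]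
    have hiff : ((cn (nr 2) * cr 6 : CExp).ev s3).re ≤
        (((cn (nr 9) * cr 7) * (cn (nr 9) * cr 7) : CExp).ev s3).re ↔
        M * ∑ i, ‖S i‖ ^ 2 ≤ (((L + 1) ^ 2 : ℕ) * ε) ^ 2 := by
      simp only [CExp.ev_mul, CExp.ev_ofN, NExp.ev_reg, CExp.ev_reg, e2, e9, e7, hc6]
      have h1 : ((M : ℂ) * ((∑ i, ‖S i‖ ^ 2 : ℝ) : ℂ)).re = M * ∑ i, ‖S i‖ ^ 2 := by
        rw [← Complex.ofReal_natCast, ← Complex.ofReal_mul, Complex.ofReal_re]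
      have h2 : (((((L + 1) ^ 2 : ℕ) : ℂ) * (ε : ℂ)) * ((((L + 1) ^ 2 : ℕ) : ℂ) * (ε : ℂ))).re =
          (((L + 1) ^ 2 : ℕ) * ε) ^ 2 := by
        rw [← Complex.ofReal_natCast, ← Complex.ofReal_mul, ← Complex.ofReal_mul,
          Complex.ofReal_re]
        exact (sq _).symm
      rw [h1, h2]
    refine Runs.le (T := 100 + (M + 1) * 60) (by omega) (Runs.le ?_ (Runs.iteC
      (T := (M + 1) * 60) (fun h => ?_) fun h => ?_))
    · gcongr
      decide
    · refine (storeProg_runs (m := m) (M := M) (t := t) ?_ t.2 e2 ?_).mono le_rfl ?_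
      · simpa (disch := decide) [hF3.n, hF2.n, hF1.n] using ht
      · simpa (disch := decide) [hF3.n, hF2.n, hF1.n] using hE.parties
      · rintro s4 ⟨h4, h5⟩
        refine Or.inr ⟨hS.dis_le (by positivity) hε0 (hiff.1 h), by rw [h4, hna], ?_⟩
        intro c t' ht' i hi
        rw [h5 c t' ht' i hi, hna, hca, hF3.ca 4 (by decide), h2 i hi]
    · refine Runs.le (by omega) (Runs.skip (Or.inl ⟨hna, hca, ?_⟩))
      rintro ⟨p, hp, hpq⟩
      exact h (hiff.2 (hS.test_of_close hw.le hA hq hε0 hL hp hpq))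

/-- The part of the net of the party `t` that comes from the first `l` grid points is stored. -/
structure NetUpTo (w : Fin (m + 1) → ℝ) (A : Fin (m + 1) → Fin M → Matrix (Fin d) (Fin d) ℂ)
    (L : ℕ) (ε : ℝ) (t : Fin m) (l : ℕ) (s : CMem) : Prop where
  le : s.na 0 t ≤ l
  sound : ∀ c < s.na 0 t, ∃ l', (∀ i : Fin M, s.ca 1 ((c * m + t) * M + i) =
    gridVec (w t.castSucc) L l' i) ∧
    dis (A t.castSucc) (fun i => gridVec (w t.castSucc) L l' i) ≤ ε
  complete : ∀ l' < l, (∃ p ∈ qSpace (A t.castSucc), ∀ i : Fin M,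
    ‖p i - gridVec (w t.castSucc) L l' i‖ ≤ ε / (4 * (M + 1))) →
    ∃ c < s.na 0 t, ∀ i : Fin M, s.ca 1 ((c * m + t) * M + i) = gridVec (w t.castSucc) L l' i

theorem NetUpTo.congr {ε : ℝ} {t : Fin m} {l : ℕ} {s s' : CMem} (h : NetUpTo w A L ε t l s)
    (h0 : s'.na 0 t = s.na 0 t) (h1 : ∀ c, ∀ i < M, s'.ca 1 ((c * m + t) * M + i) =
      s.ca 1 ((c * m + t) * M + i)) : NetUpTo w A L ε t l s' := by
  have h1' : ∀ c, ∀ i : Fin M, s'.ca 1 ((c * m + t) * M + i) =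
      s.ca 1 ((c * m + t) * M + i) := fun c i => h1 c i i.2
  refine ⟨?_, ?_, ?_⟩
  · rw [h0]; exact h.le
  · rw [h0]; simp only [h1']; exact h.sound
  · rw [h0]; simp only [h1']; exact h.complete

/-- Generate the nets of all parties but the last. -/
def netProg : Prog :=
  .count 10 3 (.setC 7 (.wid (nr 10) * cr 0 / (cn (nr 3) * cr 1)) ;; .putN 0 (nr 10) (nl 0) ;;
    .count 11 6 candProg)

theorem netProg_runs {s : CMem} (hE : Env w A s) (hs : Sizes m M L δ (∏ t, w t) s) {U : ℕ}
    (hd : d + 1 ≤ U) (hM : M + 1 ≤ U) (hLU : L + 1 ≤ U) (hmU : m + 1 ≤ U) (hd0 : 0 < d)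
    (hw : ∀ t, 0 < w t) (hA : ∀ t i, opNorm (A t i) ≤ w t) (hδ : 0 ≤ δ)
    (hL : ∀ t : Fin m, 8 * w t.castSucc * (M + 1) ≤ (L + 1) * netEps w δ t) :
    Runs netProg s (50000 * U ^ 9 * (2 * L + 1) ^ (2 * M)) fun s' =>
      ∀ t : Fin m, NetUpTo w A L (netEps w δ t) t ((2 * L + 1) ^ (2 * M)) s' := by
  set K := (2 * L + 1) ^ (2 * M) with hK
  have hK1 : 1 ≤ K := Nat.one_le_pow _ _ (by omega)
  refine Runs.le ?_ (Runs.count m (T := 300 + (10 + (K + 1) * (20000 * U ^ 8 + 8)))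
    (fun j s' => ∀ t : Fin m, (t : ℕ) < j → NetUpTo w A L (netEps w δ t) t K s')
    hE.parties (by decide) (by decide) ?_ ?_ ?_)
  · have hU : 1 ≤ U := by omega
    have h1 : (m + 1) * (300 + (10 + (K + 1) * (20000 * U ^ 8 + 8)) + 8) ≤
        U * (300 + (10 + (K + K) * (20000 * U ^ 8 + 8)) + 8) := by gcongr
    have p0 : U * 1 ≤ U * (K * U ^ 8) :=
      Nat.mul_le_mul_left U (Nat.mul_le_mul hK1 (Nat.one_le_pow _ _ hU))
    have p1 : U * K * 1 ≤ U * K * U ^ 8 := Nat.mul_le_mul_left _ (Nat.one_le_pow _ _ hU)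
    calc _ ≤ _ := h1
      _ ≤ _ := by nlinarith
  · simp
  · intro j hj s1 hF1 hj1 hI
    set t : Fin m := ⟨j, hj⟩ with ht
    have hE1 := hE.frame hF1 (by decide)
    have hs1 := hs.frame hF1 (by decide)
    -- The inner invariant tracks the net under construction; every other party either has its
    -- finished net or has an index at least `j`, about which nothing is claimed yet.
    refine Runs.seq (Runs.le (by decide) (Runs.setC (Runs.seq (Runs.le (by decide) (Runs.putN
      (Runs.count K (fun l s' => NetUpTo w A L (netEps w δ t) t l s' ∧
        ∀ t' : Fin m, t' ≠ t → NetUpTo w A L (netEps w δ t') t' K s' ∨ j ≤ t')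
        ?_ (by decide) (by decide) ?_ ?_ ?_))))))
    · simpa using hs1.grid
    · refine ⟨⟨?_, ?_, ?_⟩, ?_⟩
      · simp [hj1, ht]
      · simp [hj1, ht]
      · simp
      · intro t' ht'
        by_cases h : (t' : ℕ) < j
        · have hne : (t' : ℕ) ≠ j := by omega
          exact Or.inl ((hI t' h).congr (by simp [hj1, hne]) (by simp))
        · exact Or.inr (by omega)
    · intro l hl s2 hF2 hl2 ⟨hN, hO⟩
      have hE2 : Env w A s2 := by
        refine Env.frame ?_ hF2 (by decide)
        refine Env.frame (Env.frame hE1 (Frame.setC (r := 7) (cn (nl 0)) _ _) (by decide))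
          (Frame.putN (a := 0) (nr 10) (nl 0) _ _ _) (by decide)
      have hs2 : Sizes m M L δ (∏ t, w t) s2 := by
        refine Sizes.frame ?_ hF2 (by decide)
        refine Sizes.frame (Sizes.frame hs1 (Frame.setC (r := 7) (cn (nl 0)) _ _) (by decide))
          (Frame.putN (a := 0) (nr 10) (nl 0) _ _ _) (by decide)
      have h10 : s2.n 10 = t := by
        rw [hF2.n 10 (by decide)]
        simpa using hj1
      have h7 : s2.c 7 = (netEps w δ t : ℝ) := by
        rw [hF2.c 7 (by decide)]
        have := hE1.wid t.castSucc
        simp only [Fin.val_castSucc, ht] at this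
        simp [hj1, this, hs1.precision, hs1.width, hE1.parties, netEps, ht]
      refine (candProg_runs hE2 hs2 (t := t) h10 hl2 hl h7 hd hM hLU hd0 (hw _) (hA _) ?_
        (hL t)).mono le_rfl ?_
      · have := hw t.castSucc
        have := Finset.prod_pos fun t (_ : t ∈ Finset.univ) => hw t
        rw [netEps]
        positivity
      · rintro s3 (⟨h0, h1, h2⟩ | ⟨h0, h1, h2⟩)
        · refine ⟨⟨?_, ?_, ?_⟩, ?_⟩
          · simp only [CMem.setN_na, h0]
            have := hN.le
            omega
          · simpa only [CMem.setN_na, CMem.setN_ca, h0, h1] using hN.sound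
          · simp only [CMem.setN_na, CMem.setN_ca, h0, h1]
            intro l' hl' hg
            rcases eq_or_ne l' l with rfl | hne
            · exact absurd hg h2
            · exact hN.complete l' (by omega) hg
          · intro t' ht'
            refine (hO t' ht').imp (fun h => h.congr ?_ ?_) id
            · simp [h0]
            · simp [h1]
        · have hnew : ∀ i : Fin M, s3.ca 1 ((s2.na 0 t * m + t) * M + i) =
              gridVec (w t.castSucc) L l i := fun i => by
            rw [h2 _ t t.2 i i.2, if_pos ⟨rfl, rfl⟩]
          have hold : ∀ c < s2.na 0 t, ∀ i : Fin M, s3.ca 1 ((c * m + t) * M + i) =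
              s2.ca 1 ((c * m + t) * M + i) := fun c hc i => by
            rw [h2 _ t t.2 i i.2, if_neg (by omega)]
          refine ⟨⟨?_, ?_, ?_⟩, ?_⟩
          · simp only [CMem.setN_na, h1, Function.update_self]
            have := hN.le
            omega
          · simp only [CMem.setN_na, CMem.setN_ca, h1, Function.update_self]
            intro c hc
            rcases eq_or_ne c (s2.na 0 t) with rfl | hne
            · exact ⟨l, hnew, h0⟩
            · obtain ⟨l', g1, g2⟩ := hN.sound c (by omega)
              exact ⟨l', fun i => (hold c (by omega) i).trans (g1 i), g2⟩
          · simp only [CMem.setN_na, CMem.setN_ca, h1, Function.update_self]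
            intro l' hl' hg
            rcases eq_or_ne l' l with rfl | hne
            · exact ⟨_, Nat.lt_succ_self _, hnew⟩
            · obtain ⟨c, hc, g⟩ := hN.complete l' (by omega) hg
              exact ⟨c, by omega, fun i => (hold c hc i).trans (g i)⟩
          · intro t' ht'
            have hne : (t' : ℕ) ≠ t := fun h => ht' (Fin.ext h)
            refine (hO t' ht').imp (fun h => h.congr ?_ ?_) id
            · simp [h1, hne]
            · intro c i hi
              have := h2 c t' t'.2 i hi
              rw [if_neg (by tauto)] at this
              simpa using this
    · intro s2 _ _ ⟨hN, hO⟩ t' ht'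
      rcases eq_or_ne t' t with rfl | hne
      · exact hN.congr (by simp) (by simp)
      · rcases hO t' hne with h | h
        · exact h.congr (by simp) (by simp)
        · have : (t' : ℕ) ≠ t := fun h => hne (Fin.ext h)
          simp only [ht] at this
          omega
  · intro s' _ _ h t
    exact h t t.2

end

end RealRAM

namespace RealRAM

theorem Runs.setN_seq {q : Prog} {s : CMem} {T U v : ℕ} {e : NExp} {Φ : CMem → Prop}
    (hT : e.cost + 1 ≤ T) (h : Runs q (s.setN v (e.ev s)) U Φ) :
    Runs (.setN v e ;; q) s (T + U) Φ :=
  Runs.seq (Runs.le hT (Runs.setN h))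

theorem Runs.setC_seq {q : Prog} {s : CMem} {T U r : ℕ} {x : CExp} {Φ : CMem → Prop}
    (hT : x.cost + 4 ≤ T) (h : Runs q (s.setC r (x.ev s)) U Φ) :
    Runs (.setC r x ;; q) s (T + U) Φ :=
  Runs.seq (Runs.le hT (Runs.setC h))

theorem Runs.call_seq {p q : Prog} {s : CMem} {T U : ℕ} {Ψ Φ : CMem → Prop} (hp : Runs p s T Ψ)
    (h : ∀ s', Frame p s s' → Ψ s' → Runs q s' U Φ) : Runs (p ;; q) s (T + U) Φ :=
  Runs.seq (Runs.call hp h)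

/-! ## The final enumeration on the machine -/

open Matrix

section
variable {m d M L : ℕ} {w : Fin (m + 1) → ℝ}
  {A : Fin (m + 1) → Fin M → Matrix (Fin d) (Fin d) ℂ} {δ : ℝ}

/-- The number of the point of the net `t` that is selected by the digits of `l` in base `K`. -/
def enumIdx (s : CMem) (K l t : ℕ) : ℕ :=
  if l / K ^ t % K < s.na 0 t then l / K ^ t % K else 0

/-- The tuple of net points that is selected by `l`. -/
def enumPt (m M : ℕ) (s : CMem) (K l : ℕ) : Fin m → Fin M → ℂ :=
  fun t i => s.ca 1 ((enumIdx s K l t * m + t) * M + i)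

/-- The indices of the net points. -/
def indexProg : Prog :=
  .setN 12 (nr 11) ;; .count 26 3 (
    .ite (.nle (.get 4 (nr 12) + nl 1) (.get 0 (nr 26)))
      (.putN 6 (nr 26) (.get 4 (nr 12))) (.putN 6 (nr 26) (nl 0)) ;;
    .setN 12 (.get 3 (nr 12)))

theorem indexProg_runs {W : ℝ} {s : CMem} {l : ℕ} (hm : s.n 3 = m) (hs : Sizes m M L δ W s)
    (hl : s.n 11 = l) (hlt : l < ((2 * L + 1) ^ (2 * M)) ^ m) :
    Runs indexProg s ((m + 1) * 60) fun s' =>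
      ∀ t < m, s'.na 6 t = enumIdx s ((2 * L + 1) ^ (2 * M)) l t := by
  set K := (2 * L + 1) ^ (2 * M) with hK
  refine Runs.le ?_ (Runs.seq (Runs.setN (Runs.count m (T := 30) (fun j s' => s'.n 12 = l / K ^ j ∧
      ∀ t < j, s'.na 6 t = enumIdx s K l t) ?_ (by decide) (by decide) ?_ ?_ ?_)))
  · simp only [NExp.cost]
    omega
  · simpa using hm
  · simp [hl]
  · intro j hj s1 hF1 hj1 ⟨hq, hI⟩
    have hs0 : Sizes m M L δ W (s.setN 12 (NExp.ev s (nr 11))) :=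
      hs.frame (Frame.setN (v := 12) (nr 11) s _) (by decide)
    have hs1 := hs0.frame hF1 (by decide)
    have hd := hs1.index (l / K ^ j) ((Nat.div_le_self _ _).trans_lt hlt)
    have e0 : s1.na 0 = s.na 0 := by simp (disch := decide) [hF1.na]
    have key : ∀ x, x = enumIdx s K l j → l / K ^ j / K = l / K ^ (j + 1) ∧
        ∀ t < j + 1, Function.update (s1.na 6) j x t = enumIdx s K l t := by
      intro x hx
      refine ⟨by rw [Nat.div_div_eq_div_mul, pow_succ], fun t ht => ?_⟩
      rcases eq_or_ne t j with rfl | hij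
      · simpa using hx
      · rw [Function.update_of_ne hij, hI t (by omega)]
    refine Runs.le (T := 20 + 4) (by norm_num) (Runs.seq (Runs.le (by decide) (Runs.iteN (T := 6)
      (fun h => ?_) fun h => ?_)))
    · refine Runs.le (by decide) (Runs.putN (Runs.le (by decide) (Runs.setN ?_)))
      have h' : l / K ^ j % K < s.na 0 j := by simpa [hj1, hq, hd.2, e0] using h
      have := key (l / K ^ j % K) (by rw [enumIdx, if_pos h'])
      simpa [hj1, hq, hd.1, hd.2] using this
    · refine Runs.le (by decide) (Runs.putN (Runs.le (by decide) (Runs.setN ?_)))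
      have h' : ¬ l / K ^ j % K < s.na 0 j := by simpa [hj1, hq, hd.2, e0] using h
      have := key 0 (by rw [enumIdx, if_neg h'])
      simpa [hj1, hq, hd.1] using this
  · intro s1 _ _ h
    exact h.2

/-- The coefficients `-conj (∏ q)`. -/
def coefProg : Prog :=
  .count 14 2 (.setC 6 (cn (nl 1)) ;;
    .count 26 3 (.setC 6 (cr 6 *
      .get 1 ((.get 6 (nr 26) * nr 3 + nr 26) * nr 2 + nr 14))) ;;
    .putC 5 (nr 14) (cn (nl 0) - .conj (cr 6)))

theorem coefProg_runs {s : CMem} (hm : s.n 3 = m) (hM : s.n 2 = M) :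
    Runs coefProg s ((M + 1) * ((m + 1) * 100 + 60)) fun s' => ∀ i : Fin M, s'.ca 5 i =
      -(starRingEnd ℂ) (∏ t : Fin m, s.ca 1 ((s.na 6 t * m + t) * M + i)) := by
  refine Runs.le (T := (M + 1) * ((m + 1) * (90 + 8) + 50 + 8)) (Nat.mul_le_mul_left _ (by omega))
    (Runs.count M
    (fun j s' => ∀ i < j, s'.ca 5 i =
      -(starRingEnd ℂ) (∏ t ∈ Finset.range m, s.ca 1 ((s.na 6 t * m + t) * M + i)))
    hM (by decide) (by decide) ?_ ?_ ?_)
  · simp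
  · intro j hj s1 hF1 hj1 hI
    refine Runs.le (T := 10 + ((m + 1) * (90 + 8) + 40)) (by omega) (Runs.seq (Runs.le (by decide)
      (Runs.setC (Runs.seq (Runs.count m (fun u s' => s'.c 6 =
        ∏ t ∈ Finset.range u, s.ca 1 ((s.na 6 t * m + t) * M + j)) ?_ (by decide) (by decide)
        ?_ ?_ ?_)))))
    · simpa (disch := decide) [hF1.n] using hm
    · simp
    · intro u hu s2 hF2 hu2 hc
      refine Runs.le (by decide) (Runs.setC ?_)
      have e1 : s2.ca 1 = s.ca 1 := by simp (disch := decide) [hF2.ca, hF1.ca]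
      have e6 : s2.na 6 = s.na 6 := by simp (disch := decide) [hF2.na, hF1.na]
      have e2 : s2.n 2 = M := by simpa (disch := decide) [hF2.n, hF1.n] using hM
      have e3 : s2.n 3 = m := by simpa (disch := decide) [hF2.n, hF1.n] using hm
      have e14 : s2.n 14 = j := by simpa (disch := decide) [hF2.n] using hj1
      simp [hc, e1, e6, e2, e3, e14, hu2, Finset.prod_range_succ]
    · intro s2 hF2 _ hc
      refine Runs.le (by decide) (Runs.putC fun i hi => ?_)
      have e14 : s2.n 14 = j := by simpa (disch := decide) [hF2.n] using hj1
      have e5 : s2.ca 5 = s1.ca 5 := by simp (disch := decide) [hF2.ca]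
      rcases eq_or_ne i j with rfl | hij
      · simp [e14, hc]
      · simp [e14, hij, e5, hI i (by omega)]
  · intro s1 _ _ h i
    rw [h i i.2, Finset.prod_range]

/-- Evaluate the tuple of net points that belongs to the register `11`, and update the maximum in
the complex register `8`. -/
def evalProg : Prog :=
  indexProg ;; coefProg ;; oracle ;; trMulMat 2 ;; .setC 6 (cr 4 / cr 5 - cr 3) ;;
  .ite (.cle (cr 8) (cr 6)) (.setC 8 (cr 6)) .skip

/-- The oracle minimises linear forms, so with these coefficients it maximises the trace against the
Hermitian part of `lastOp`. -/
theorem dirOp_neg_conj_prod (q : Fin m → Fin M → ℂ) :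
    dirOp (A (Fin.last m)) (fun i => -(starRingEnd ℂ) (∏ t, q t i)) = -hermPart (lastOp A q) := by
  have : ∑ i, (starRingEnd ℂ) (-(starRingEnd ℂ) (∏ t, q t i)) • A (Fin.last m) i = -lastOp A q := by
    simp [lastOp]
  rw [dirOp, this, hermPart, hermPart, conjTranspose_neg, ← neg_add, smul_neg]

theorem evalProg_runs {s : CMem} (hE : Env w A s) (hs : Sizes m M L δ (∏ t, w t) s) {l : ℕ}
    (hl : s.n 11 = l) (hlt : l < ((2 * L + 1) ^ (2 * M)) ^ m) (h10 : s.n 10 = m)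
    (h19 : s.n 19 = (L + 1) * d) (h25 : s.n 25 = 0)
    (h3 : s.c 3 = ((2 * ((M + 1) * ∏ t, w t) : ℝ) : ℂ)) {U : ℕ}
    (hd : d + 1 ≤ U) (hM : M + 1 ≤ U) (hLU : L + 1 ≤ U) (hmU : m + 1 ≤ U) (hd0 : 0 < d)
    (hw : ∀ t, 0 < w t) (hA : ∀ t i, opNorm (A t i) ≤ w t)
    (hq : ∀ t i, ‖enumPt m M s ((2 * L + 1) ^ (2 * M)) l t i‖ ≤ w t.castSucc)
    (herr : 3 * ((M + 1) * ∏ t, w t) ≤ (L + 1) * δ) :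
    Runs evalProg s (4000 * U ^ 5) fun s' => ∃ v : ℝ,
      v ≤ lambdaMax (hermPart (lastOp A (enumPt m M s ((2 * L + 1) ^ (2 * M)) l))) ∧
      lambdaMax (hermPart (lastOp A (enumPt m M s ((2 * L + 1) ^ (2 * M)) l))) ≤ v + δ ∧
      (s'.c 8).re = max (s.c 8).re v := by
  set K := (2 * L + 1) ^ (2 * M) with hK
  set q := enumPt m M s K l with hqdef
  set R : ℝ := (M + 1) * ∏ t, w t with hR
  have hW : 0 < ∏ t, w t := Finset.prod_pos fun t _ => hw t
  have hR0 : 0 < R := by positivity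
  set H := hermPart (lastOp A q) with hH
  have hHh : H.IsHermitian := isHermitian_hermPart _
  have hb : ∀ ρ, IsDensity ρ → |(-H * ρ).trace.re| ≤ R := fun ρ hρ => by
    rw [neg_mul, trace_neg, Complex.neg_re, abs_neg, hH, re_trace_hermPart_mul _ hρ.isHermitian]
    refine (Complex.abs_re_le_norm _).trans ((norm_trace_lastOp_le hw (hA _) hq hρ).trans ?_)
    rw [hR]
    gcongr
    linarith
  -- With this exponent the oracle error `3 R d / N` is `3 R / (L + 1)`, at most `δ` by `herr`.
  have hN0 : 0 < (L + 1) * d := by positivity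
  obtain ⟨hσ, hmin⟩ := gibbs_sub_spec hd0 hHh.neg hR0 hb hN0
  set P := ((2 * R : ℝ) : ℂ) • 1 - -H with hP
  set σ := gibbs P ((L + 1) * d) with hσdef
  -- Since `P = 2 R + H` and `σ` has trace one, subtracting the shift recovers the value of `H`.
  have hval : ((P * P ^ ((L + 1) * d)).trace / (P ^ ((L + 1) * d)).trace - ((2 * R : ℝ) : ℂ)).re =
      (H * σ).trace.re := by
    have e1 : (P * P ^ ((L + 1) * d)).trace / (P ^ ((L + 1) * d)).trace = (P * σ).trace := by
      rw [hσdef, gibbs, mul_smul_comm, trace_smul, smul_eq_mul, div_eq_inv_mul]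
    rw [e1]
    nth_rewrite 1 [hP]
    rw [sub_neg_eq_add, add_mul, trace_add, smul_mul_assoc, one_mul, trace_smul, hσ.2]
    simp
  refine Runs.le (T := (m + 1) * 60 + ((M + 1) * ((m + 1) * 100 + 60) + (800 * (3 * U ^ 2) * U ^ 3 +
    ((d + 1) * ((d + 1) * 120 + 40) + (100 + 40))))) ?_
    (Runs.seq (Runs.call (indexProg_runs hE.parties hs hl hlt) fun s1 hF1 h1 =>
    Runs.seq (Runs.call (coefProg_runs (m := m) (M := M) ?_ ?_) fun s2 hF2 h2 =>
    Runs.seq (Runs.call (oracle_runs (w := w) (A := A) (t := Fin.last m) (U := U) (V := 3 * U ^ 2)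
      ((hE.frame hF1 (by decide)).frame hF2 (by decide)) ?_ hd hM ?_) fun s3 hF3 h4 =>
    Runs.seq (Runs.call (trMulMat_runs (d := d) 2 ?_) fun s4 hF4 h5 =>
    Runs.seq (Runs.le (by decide) (Runs.setC ?_)))))))
  · have hU : 1 ≤ U := by omega
    have p1 : U ≤ U ^ 5 := Nat.le_self_pow (by norm_num) U
    have p2 : U ^ 2 ≤ U ^ 5 := Nat.pow_le_pow_right hU (by norm_num)
    have p0 : 1 ≤ U ^ 5 := Nat.one_le_pow _ _ hU
    have c1 : (M + 1) * ((m + 1) * 100 + 60) ≤ U * (U * 100 + 60) := by gcongr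
    have c2 : (d + 1) * ((d + 1) * 120 + 40) ≤ U * (U * 120 + 40) := by gcongr
    linarith
  · simpa (disch := decide) [hF1.n] using hE.parties
  · simpa (disch := decide) [hF1.n] using hE.terms
  · simpa (disch := decide) [hF1.n, hF2.n] using h10
  · have e : s2.n 19 = (L + 1) * d := by simpa (disch := decide) [hF1.n, hF2.n] using h19
    have : (L + 1) * d ≤ U * U := by
      gcongr
      omega
    have hU : 1 ≤ U := by omega
    rw [e]
    nlinarith
  · simpa (disch := decide) [hF1.n, hF2.n, hF3.n] using hE.dim
  · have e3 : s2.c 3 = ((2 * R : ℝ) : ℂ) := by simpa (disch := decide) [hF1.c, hF2.c] using h3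
    have e19 : s2.n 19 = (L + 1) * d := by simpa (disch := decide) [hF1.n, hF2.n] using h19
    have e25 : s3.n 25 = 0 := by simpa (disch := decide) [hF1.n, hF2.n, hF3.n] using h25
    have e5 : (fun i : Fin M => s2.ca 5 i) = fun i => -(starRingEnd ℂ) (∏ t, q t i) := by
      ext i
      rw [h2 i, hF1.ca 1 (by decide)]
      congr 2
      refine Finset.prod_congr rfl fun t _ => ?_
      rw [h1 t t.2, hqdef, enumPt]
    rw [e3, e5, dirOp_neg_conj_prod, e19] at h4
    obtain ⟨g1, g2, g3⟩ := h4
    have e43 : s4.c 3 = ((2 * R : ℝ) : ℂ) := by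
      rw [hF4.c 3 (by decide), hF3.c 3 (by decide), e3]
    have hz : (cr 4 / cr 5 - cr 3 : CExp).ev s4 =
        (P * P ^ ((L + 1) * d)).trace / (P ^ ((L + 1) * d)).trace - ((2 * R : ℝ) : ℂ) := by
      simp only [CExp.ev_sub, CExp.ev_div, CExp.ev_reg, h5, e25, g1, g2, e43, hF4.c 5 (by decide),
        g3]
      rfl
    have e8 : s4.c 8 = s.c 8 := by
      simp (disch := decide) [hF1.c, hF2.c, hF3.c, hF4.c]
    rw [hz]
    set z := (P * P ^ ((L + 1) * d)).trace / (P ^ ((L + 1) * d)).trace - ((2 * R : ℝ) : ℂ)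
    have hv1 : (H * σ).trace.re ≤ lambdaMax H := re_trace_mul_le_lambdaMax hHh hσ
    have hv2 : lambdaMax H ≤ (H * σ).trace.re + δ := by
      obtain ⟨ρ, hρ, hρl⟩ := exists_density_trace_eq_lambdaMax hd0 hHh
      have := hmin ρ hρ
      rw [neg_mul, neg_mul, trace_neg, trace_neg, Complex.neg_re, Complex.neg_re, hρl] at this
      have h6 : 3 * R * d / (((L + 1) * d : ℕ) : ℝ) ≤ δ := by
        have hd' : (0 : ℝ) < d := by exact_mod_cast hd0
        rw [div_le_iff₀ (by positivity)]
        push_cast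
        nlinarith
      linarith
    refine Runs.le (by decide) (Runs.iteC (T := 20) (fun h => ?_) fun h => ?_)
    · refine Runs.le (by decide) (Runs.setC ⟨_, hv1, hv2, ?_⟩)
      have h' : (s.c 8).re ≤ z.re := by simpa [e8] using h
      rw [← hval, max_eq_right h']
      simp
    · refine Runs.le (by decide) (Runs.skip ⟨_, hv1, hv2, ?_⟩)
      have h' : ¬ (s.c 8).re ≤ z.re := by simpa [e8] using h
      rw [← hval, max_eq_left (not_le.1 h').le]
      simp [e8]

/-- Enumerate all tuples of net points. -/
def finalProg : Prog :=
  .setC 8 (cn (nl 0) - cn (nr 2 + nl 1) * cr 1) ;; .setN 10 (nr 3) ;;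
  .setN 19 ((nr 4 + nl 1) * nr 1) ;; .setN 25 (nl 0) ;;
  .setC 3 (cn (nl 2 * (nr 2 + nl 1)) * cr 1) ;; .count 11 7 evalProg

/-- The net of the party `t` that is held in the store. -/
noncomputable def netOf (m M : ℕ) (s : CMem) (t : Fin m) : Finset (Fin M → ℂ) :=
  open Classical in (Finset.range (s.na 0 t)).image fun c i => s.ca 1 ((c * m + t) * M + i)

/-- A digit beyond the size of the net falls back to point 0. Thus every code below `K ^ m` gives a
valid tuple once the nets are nonempty, and repetitions do not change the maximum. -/
theorem enumPt_mem {s : CMem} {K l : ℕ} (h : ∀ t : Fin m, 0 < s.na 0 t) (t : Fin m) :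
    enumPt m M s K l t ∈ netOf m M s t := by
  classical
  refine Finset.mem_image.2 ⟨enumIdx s K l t, Finset.mem_range.2 ?_, rfl⟩
  rw [enumIdx]
  split_ifs with h'
  · exact h'
  · exact h t

theorem exists_enumPt_eq {s : CMem} {K : ℕ} (h : ∀ t : Fin m, s.na 0 t ≤ K)
    {q : Fin m → Fin M → ℂ} (hq : ∀ t, q t ∈ netOf m M s t) :
    ∃ l < K ^ m, enumPt m M s K l = q := by
  classical
  choose c hc hcq using fun t => Finset.mem_image.1 (hq t)
  simp only [Finset.mem_range] at hc
  obtain ⟨l, hl, hdig⟩ := exists_digits (b := K) (n := m)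
    (fun j => if hj : j < m then c ⟨j, hj⟩ else 0) fun j hj => by
      simp only [hj, dif_pos]
      exact (hc _).trans_le (h _)
  refine ⟨l, hl, ?_⟩
  funext t
  rw [← hcq t]
  funext i
  have := hdig t t.2
  simp only [t.2, dif_pos] at this
  simp only [enumPt, enumIdx, this, hc t, if_true]

/-- Each computed value is at most the true `lambdaMax` and at most `δ` below it; a running maximum
inherits both bounds. -/
theorem finalProg_runs {s : CMem} (hE : Env w A s) (hs : Sizes m M L δ (∏ t, w t) s)
    {U : ℕ} (hd : d + 1 ≤ U) (hM : M + 1 ≤ U) (hLU : L + 1 ≤ U) (hmU : m + 1 ≤ U) (hd0 : 0 < d)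
    (hw : ∀ t, 0 < w t) (hA : ∀ t i, opNorm (A t i) ≤ w t) (hδ : 0 ≤ δ)
    (hq : ∀ t, ∀ q ∈ netOf m M s t, ∀ i, ‖q i‖ ≤ w t.castSucc)
    (hpos : ∀ t : Fin m, 0 < s.na 0 t) (hle : ∀ t : Fin m, s.na 0 t ≤ (2 * L + 1) ^ (2 * M))
    (herr : 3 * ((M + 1) * ∏ t, w t) ≤ (L + 1) * δ) :
    Runs finalProg s (10000 * U ^ 5 * ((2 * L + 1) ^ (2 * M)) ^ m) fun s' =>
      s'.na 0 = s.na 0 ∧ s'.ca 1 = s.ca 1 ∧ |(s'.c 8).re - enumOpt A (netOf m M s)| ≤ δ := by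
  set K := (2 * L + 1) ^ (2 * M) with hK
  have hK1 : 1 ≤ K ^ m := Nat.one_le_pow _ _ (Nat.pow_pos (by omega))
  set E := enumOpt A (netOf m M s) with hEdef
  have hgr := isGreatest_enumOpt A (N := netOf m M s) fun t =>
    ⟨_, enumPt_mem (K := K) (l := 0) hpos t⟩
  -- The initial value of the running maximum must not exceed the result; any value of `lastOp` at a
  -- state is at least `-M W`.
  have hlow : -((M + 1) * ∏ t, w t) ≤ E := by
    obtain ⟨q, hqN, hqE⟩ := hgr.1
    obtain ⟨ρ, hρ⟩ := exists_isDensity hd0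
    have h1 := re_trace_mul_le_lambdaMax (isHermitian_hermPart (lastOp A q)) hρ
    rw [re_trace_hermPart_mul _ hρ.isHermitian] at h1
    have h2 := (Complex.abs_re_le_norm _).trans
      (norm_trace_lastOp_le hw (hA _) (fun t i => hq t _ (hqN t) i) hρ)
    have h3 := (abs_le.1 h2).1
    have hW : 0 < ∏ t, w t := Finset.prod_pos fun t _ => hw t
    have h4 : lambdaMax (hermPart (lastOp A q)) = E := hqE
    linarith
  refine Runs.le (T := 50 + (20 + (20 + (20 + (50 + (K ^ m + 1) * (4000 * U ^ 5 + 8)))))) ?_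
    (Runs.setC_seq (by decide) (Runs.setN_seq (by decide) (Runs.setN_seq (by decide)
    (Runs.setN_seq (by decide) (Runs.setC_seq (by decide)
      (Runs.count (K ^ m) (T := 4000 * U ^ 5) (fun l s' => (s'.c 8).re ≤ E ∧ ∀ l' < l,
        lambdaMax (hermPart (lastOp A (enumPt m M s K l'))) ≤ (s'.c 8).re + δ)
        ?_ (by decide) (by decide) ?_ ?_ ?_))))))
  · have hU : 1 ≤ U := by omega
    have p0 : 1 ≤ U ^ 5 := Nat.one_le_pow _ _ hU
    have p1 : 1 * 1 ≤ K ^ m * U ^ 5 := Nat.mul_le_mul hK1 p0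
    have p2 : 1 * U ^ 5 ≤ K ^ m * U ^ 5 := Nat.mul_le_mul_right _ hK1
    have p3 : K ^ m * 1 ≤ K ^ m * U ^ 5 := Nat.mul_le_mul_left _ p0
    linarith
  · simpa using hs.total
  · simpa [hE.terms, hs.width, ← Complex.ofReal_prod, -Complex.ofReal_prod] using hlow
  · intro l hl s1 hF1 hl1 ⟨hI1, hI2⟩
    have hE1 : Env w A s1 := by
      refine Env.frame ?_ hF1 (by decide)
      exact ⟨by simpa using hE.dim, by simpa using hE.terms, by simpa using hE.parties,
        by simpa using hE.wid, by simpa using hE.op⟩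
    have hs1 : Sizes m M L δ (∏ t, w t) s1 := by
      refine Sizes.frame ?_ hF1 (by decide)
      exact ⟨by simpa using hs.mesh, by simpa using hs.base, by simpa using hs.grid,
        by simpa using hs.total, by simpa using hs.coords, by simpa using hs.rounds,
        by simpa using hs.precision, by simpa using hs.width, by simpa using hs.digit,
        by simpa using hs.index⟩
    have e1 : ∀ l', enumPt m M s1 K l' = enumPt m M s K l' := fun l' => by
      have h0 : s1.na 0 = s.na 0 := by simp (disch := decide) [hF1.na]
      have h1 : s1.ca 1 = s.ca 1 := by simp (disch := decide) [hF1.ca]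
      funext t i
      simp only [enumPt, enumIdx, h0, h1]
    have hmem : ∀ t, enumPt m M s K l t ∈ netOf m M s t := enumPt_mem hpos
    refine (evalProg_runs (l := l) hE1 hs1 hl1 hl ?_ ?_ ?_ ?_ hd hM hLU hmU hd0 hw hA ?_
      herr).mono le_rfl ?_
    · rw [hF1.n 10 (by decide)]
      simpa using hE.parties
    · rw [hF1.n 19 (by decide)]
      simp [hs.mesh, hE.dim]
    · rw [hF1.n 25 (by decide)]
      simp
    · rw [hF1.c 3 (by decide)]
      simp [hE.terms, hs.width]
      ring
    · intro t i
      rw [e1]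
      exact hq t _ (hmem t) i
    · rintro s2 ⟨v, hv1, hv2, hv⟩
      rw [e1] at hv1 hv2
      have hvE : v ≤ E := hv1.trans (hgr.2 ⟨_, hmem, rfl⟩)
      simp only [CMem.setN_c, hv]
      refine ⟨max_le hI1 hvE, fun l' hl' => ?_⟩
      rcases eq_or_ne l' l with rfl | hne
      · linarith [le_max_right (s1.c 8).re v]
      · linarith [hI2 l' (by omega), le_max_left (s1.c 8).re v]
  · rintro s1 hF1 _ ⟨h1, h2⟩
    refine ⟨by simp (disch := decide) [hF1.na], by simp (disch := decide) [hF1.ca], ?_⟩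
    obtain ⟨q, hqN, hqE⟩ := hgr.1
    obtain ⟨l, hl, hlq⟩ := exists_enumPt_eq hle hqN
    have h3 := h2 l hl
    rw [hlq] at h3
    have h4 : lambdaMax (hermPart (lastOp A q)) = E := hqE
    rw [abs_le]
    constructor <;> linarith

end

end RealRAM

namespace RealRAM

/-! ## The whole algorithm on the machine -/

open Matrix

/-- The mesh of the grids, as a function of the ratio of the scale to the precision. -/
noncomputable def meshSize (y : ℝ) : ℕ := if y ≤ 1 then 0 else ⌈y⌉₊

/-- The cutoff at `y ≤ 1` keeps the grid at one point there. A plain ceiling would give `(2 L + 1) ^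
2 = 9` for `0 < y ≤ 1` and spoil the factor `max 1 _` of the running time. -/
theorem le_max_meshSize (y : ℝ) : y ≤ max (meshSize y : ℝ) 1 := by
  unfold meshSize
  split_ifs with h
  · exact h.trans (le_max_right _ _)
  · exact (Nat.le_ceil y).trans (le_max_left _ _)

theorem meshSize_lt {y : ℝ} (hy : 0 < y) : (meshSize y : ℝ) < y + 1 := by
  unfold meshSize
  split_ifs with h
  · push_cast
    linarith
  · exact Nat.ceil_lt_add_one hy.le

/-- Put the mesh for the real part of the complex register `2` into the register `4`. -/
def meshProg : Prog :=
  .setN 4 (nl 0) ;; .ite (.cle (cr 2) (cn (nl 1))) .skip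
    (.loop (.neg (.cle (cr 2) (cn (nr 4)))) (.setN 4 (nr 4 + nl 1)))

/-- Reals cannot be converted to indices, so the ceiling is found by counting upwards, at a cost
linear in the mesh parameter. -/
theorem meshProg_runs (s : CMem) :
    Runs meshProg s (40 * (meshSize (s.c 2).re + 1)) fun s' => s'.n 4 = meshSize (s.c 2).re := by
  set y := (s.c 2).re with hy
  have key : ∀ j ≤ ⌈y⌉₊, ∀ τ : Mem, (τ.toC.c 2).re = y → τ.nreg 4 = ⌈y⌉₊ - j →
      ∃ (t : ℕ) (υ : Mem), Exec (.loop (.neg (.cle (cr 2) (cn (nr 4)))) (.setN 4 (nr 4 + nl 1)))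
        τ t υ ∧ t ≤ j * 20 + 10 ∧ υ.nreg 4 = ⌈y⌉₊ := by
    have hcost : (Test.neg (.cle (cr 2) (cn (nr 4)))).cost = 5 := by decide
    have htest : ∀ τ : Mem, (τ.toC.c 2).re = y →
        ((Test.neg (.cle (cr 2) (cn (nr 4)))).holds τ ↔ τ.nreg 4 < ⌈y⌉₊) := by
      intro τ hτ
      simp only [Test.holds, Test.cle, CExp.eval_parts, CExp.ev_reg, CExp.ev_ofN, NExp.ev_reg, hτ,
        Complex.natCast_re, not_le, Nat.lt_ceil]
      rfl
    intro j
    induction j with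
    | zero =>
      intro _ τ hτ h4
      exact ⟨_, τ, .loopFalse (by rw [htest τ hτ]; omega), by rw [hcost]; omega, by simpa using h4⟩
    | succ j ih =>
      intro hj τ hτ h4
      obtain ⟨t, υ, h1, h2, h3⟩ := ih (by omega) (τ.setN 4 (⌈y⌉₊ - j)) hτ (by simp [Mem.setN])
      have hx : Exec (.setN 4 (nr 4 + nl 1)) τ 4 (τ.setN 4 (⌈y⌉₊ - j)) := by
        have := Exec.setN τ 4 (nr 4 + nl 1)
        rwa [show (nr 4 + nl 1 : NExp).eval τ = ⌈y⌉₊ - j by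
          change τ.nreg 4 + 1 = _
          omega] at this
      exact ⟨_, υ, .loopTrue ((htest τ hτ).2 (by omega)) hx h1, by rw [hcost]; omega, h3⟩
  have hcost : (Test.cle (cr 2) (cn (nl 1))).cost = 4 := by decide
  refine Runs.le (T := 2 + ((Test.cle (cr 2) (cn (nl 1))).cost + (meshSize y * 20 + 10)))
    (by omega) (Runs.setN_seq (by decide) ?_)
  refine Runs.iteC (fun h => ?_) fun h => ?_
  · have h' : y ≤ 1 := by simpa using h
    exact Runs.le (by omega) (Runs.skip (by simp [meshSize, h']))
  · have h' : ¬ y ≤ 1 := by simpa using h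
    have e : meshSize y = ⌈y⌉₊ := if_neg h'
    rw [e]
    intro σ hσ
    refine key _ le_rfl σ (by rw [hσ]; rfl) ?_
    have : σ.toC.n 4 = 0 := by rw [hσ]; simp
    rw [Nat.sub_self]
    exact this

/-- Store in the register `r` the power of the value of `v` whose exponent is the value of `b`. -/
def Prog.pow (r b v : ℕ) : Prog := .setN r (nl 1) ;; .count 26 b (.setN r (nr r * nr v))

theorem Runs.pow {s : CMem} {r b v x n : ℕ} (hn : s.n b = n) (hx : s.n v = x) (hr : r ≠ 26)
    (hb : b ≠ 26) (hv : v ≠ 26) (hrb : r ≠ b) (hrv : r ≠ v) :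
    Runs (.pow r b v) s ((n + 1) * 20) fun s' => s'.n r = x ^ n := by
  refine Runs.le (T := 2 + (n + 1) * (4 + 8)) (by omega) (Runs.setN_seq (by decide)
    (Runs.count n (fun j s' => s'.n r = x ^ j) ?_ ?_ ?_ ?_ ?_ ?_))
  · simpa [hrb.symm] using hn
  · simpa using hr
  · simp [hb.symm, hrb]
  · simp [hr]
  · intro j _ s1 hF1 _ hI
    have e : s1.n v = x := by
      rw [hF1.n v (by simp [hv.symm, hrv])]
      simpa [hrv.symm] using hx
    refine Runs.le (by simp [NExp.cost]) (Runs.setN ?_)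
    simp [hr, hI, e, pow_succ]
  · intro s1 _ _ h
    exact h

/-- Multiply the widths. -/
def widthProg : Prog :=
  .setN 3 (nr 0 - nl 1) ;; .setC 1 (cn (nl 1)) ;; .count 26 0 (.setC 1 (cr 1 * .wid (nr 26)))

theorem widthProg_runs {m : ℕ} {w : Fin (m + 1) → ℝ} {s : CMem} (h0 : s.n 0 = m + 1)
    (hw : ∀ t : Fin (m + 1), s.wd t = w t) :
    Runs widthProg s ((m + 1) * 200) fun s' =>
      s'.n 3 = m ∧ s'.c 1 = ((∏ t, w t : ℝ) : ℂ) := by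
  refine Runs.le (T := 10 + (10 + (m + 1 + 1) * (30 + 8))) (by omega) (Runs.setN_seq (by decide)
    (Runs.setC_seq (by decide) (Runs.count (m + 1)
      (fun j s' => s'.c 1 = ((∏ t ∈ Finset.range j, s.wd t : ℝ) : ℂ)) ?_ (by decide) (by decide)
      ?_ ?_ ?_)))
  · simpa using h0
  · simp
  · intro j _ s1 hF1 hj hI
    refine Runs.le (by decide) (Runs.setC ?_)
    have e : s1.wd = s.wd := by simp [hF1.wd]
    simp only [CExp.ev_mul, CExp.ev_reg, CExp.ev_wid, NExp.ev_reg, CMem.setN_c, CMem.setC_c,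
      Function.update_self, hI, e, hj, Finset.prod_range_succ, Complex.ofReal_mul]
  · intro s1 hF1 _ hI
    refine ⟨?_, ?_⟩
    · rw [hF1.n 3 (by decide)]
      simp [h0]
    · rw [hI, Finset.prod_range]
      simp only [hw]

/-! ### Sizes, and assembly of the phases. -/

section
variable {m d M : ℕ} {w : Fin (m + 1) → ℝ}
  {A : Fin (m + 1) → Fin M → Matrix (Fin d) (Fin d) ℂ} {δ : ℝ}

/-- The ratio of the scale of the problem to the precision. -/
noncomputable def scaleRatio (M : ℕ) (w : Fin (m + 1) → ℝ) (δ : ℝ) : ℝ :=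
  8 * m * (∏ t, w t) * (M + 1) / δ

/-- As `ε_t` is proportional to `w_t`, one mesh parameter serves all parties, both for the grid and
for the number of rounds. -/
theorem scaleRatio_mul_netEps (hm : 1 ≤ m) (hw : ∀ t, 0 < w t) (hδ : 0 < δ) (t : Fin m) :
    scaleRatio M w δ * netEps w δ t = 8 * w t.castSucc * (M + 1) := by
  have hW : 0 < ∏ t, w t := Finset.prod_pos fun t _ => hw t
  have hm' : (0 : ℝ) < m := by exact_mod_cast hm
  rw [scaleRatio, netEps]
  field_simp

/-- Compute the numbers that control the algorithm. -/
def sizeProg : Prog :=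
  widthProg ;; .setC 2 (cn (nl 8 * nr 3) * cr 1 * cn (nr 2 + nl 1) / cr 0) ;; meshProg ;;
  .setN 5 (nl 2 * nr 4 + nl 1) ;; .setN 8 (nl 2 * nr 2) ;;
  .setN 9 ((nr 4 + nl 1) * (nr 4 + nl 1)) ;; .pow 6 8 5 ;; .pow 7 3 6 ;;
  tableProg 5 6 1 2 ;; tableProg 6 7 3 4

theorem sizeProg_runs {s : CMem} (hm : 1 ≤ m) (h0 : s.n 0 = m + 1) (h2 : s.n 2 = M)
    (hδ : s.c 0 = δ) (hw : ∀ t : Fin (m + 1), s.wd t = w t) {L U : ℕ}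
    (hL : L = meshSize (scaleRatio M w δ)) (hM : M + 1 ≤ U) (hLU : L + 1 ≤ U) (hmU : m + 1 ≤ U) :
    Runs sizeProg s (1000 * U * ((2 * L + 1) ^ (2 * M)) ^ m) fun s' =>
      s'.n 3 = m ∧ Sizes m M L δ (∏ t, w t) s' := by
  set K := (2 * L + 1) ^ (2 * M) with hK
  have hK1 : 1 ≤ K := Nat.one_le_pow _ _ (by omega)
  refine Runs.le (T := (m + 1) * 200 + (400 + (40 * (L + 1) + (10 + (10 + (10 +
    ((2 * M + 1) * 20 + ((m + 1) * 20 + ((K + 1) * 60 + (K ^ m + 1) * 60))))))))) ?_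
    (Runs.call_seq (widthProg_runs h0 hw) fun s1 hF1 ⟨hm1, hW1⟩ => Runs.setC_seq (by decide) ?_)
  · have hKm : K ≤ K ^ m := Nat.le_self_pow (by omega) K
    have hU : 1 ≤ U := by omega
    have p1 : U * 1 ≤ U * K ^ m := Nat.mul_le_mul_left _ (hK1.trans hKm)
    have p2 : 1 * K ^ m ≤ U * K ^ m := Nat.mul_le_mul_right _ hU
    nlinarith
  have hc : (CExp.ev s1 (cn (nl 8 * nr 3) * cr 1 * cn (nr 2 + nl 1) / cr 0)).re =
      scaleRatio M w δ := by
    have e2 : s1.n 2 = M := (hF1.n 2 (by decide)).trans h2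
    have e0 : s1.c 0 = δ := (hF1.c 0 (by decide)).trans hδ
    simp only [CExp.ev_div, CExp.ev_mul, CExp.ev_ofN, NExp.ev_mul, NExp.ev_lit, NExp.ev_reg, hm1,
      CExp.ev_reg, hW1, NExp.ev_add, e2, e0, scaleRatio]
    exact_mod_cast Complex.ofReal_re _
  have hmesh := meshProg_runs (s1.setC 2 (CExp.ev s1
    (cn (nl 8 * nr 3) * cr 1 * cn (nr 2 + nl 1) / cr 0)))
  rw [CMem.setC_c, Function.update_self, hc, ← hL] at hmesh
  refine Runs.call_seq hmesh fun s2 hF2 h4 => Runs.setN_seq (by decide) (Runs.setN_seq (by decide)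
    (Runs.setN_seq (by decide) (Runs.call_seq (Runs.pow (n := 2 * M) (x := 2 * L + 1) ?_ ?_
      (by decide) (by decide) (by decide) (by decide) (by decide)) fun s3 hF3 h6 =>
    Runs.call_seq (Runs.pow (n := m) (x := K) ?_ (h6.trans hK.symm)
      (by decide) (by decide) (by decide) (by decide) (by decide)) fun s4 hF4 h7 =>
    Runs.call_seq (tableProg_runs (b := 2 * L + 1) (n := K) ?_ ?_ (by omega) (by decide)
      (by decide) (by decide)) fun s5 hF5 h12 =>
    Runs.call (tableProg_runs (b := K) (n := K ^ m) ?_ ?_ (by omega) (by decide)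
      (by decide) (by decide)) fun s6 hF6 h34 => ?_)))
  · simp [hF2.n 2 (by decide), hF1.n 2 (by decide), h2]
  · simp [h4]
  · simp [hF3.n 3 (by decide), hF2.n 3 (by decide), hm1]
  · simp [hF4.n 5 (by decide), hF3.n 5 (by decide), h4]
  · rw [hF4.n 6 (by decide), h6]
  · rw [hF5.n 6 (by decide), hF4.n 6 (by decide), h6]
  · rw [hF5.n 7 (by decide), h7]
  · have e4 : s6.n 4 = L := by
      rw [hF6.n 4 (by decide), hF5.n 4 (by decide), hF4.n 4 (by decide), hF3.n 4 (by decide)]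
      simpa using h4
    refine ⟨?_, e4, ?_, ?_, ?_, ?_, ?_, ?_, ?_, ?_, h34⟩
    · rw [hF6.n 3 (by decide), hF5.n 3 (by decide), hF4.n 3 (by decide), hF3.n 3 (by decide)]
      simp [hF2.n 3 (by decide), hm1]
    · rw [hF6.n 5 (by decide), hF5.n 5 (by decide), hF4.n 5 (by decide), hF3.n 5 (by decide)]
      simp [h4]
    · rw [hF6.n 6 (by decide), hF5.n 6 (by decide), hF4.n 6 (by decide), h6]
    · rw [hF6.n 7 (by decide), hF5.n 7 (by decide), h7]
    · rw [hF6.n 8 (by decide), hF5.n 8 (by decide), hF4.n 8 (by decide), hF3.n 8 (by decide)]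
      simp [hF2.n 2 (by decide), hF1.n 2 (by decide), h2]
    · rw [hF6.n 9 (by decide), hF5.n 9 (by decide), hF4.n 9 (by decide), hF3.n 9 (by decide)]
      simp [h4]
      ring
    · rw [hF6.c 0 (by decide), hF5.c 0 (by decide), hF4.c 0 (by decide), hF3.c 0 (by decide)]
      simp [hF2.c 0 (by decide), hF1.c 0 (by decide), hδ]
    · rw [hF6.c 1 (by decide), hF5.c 1 (by decide), hF4.c 1 (by decide), hF3.c 1 (by decide)]
      simp [hF2.c 1 (by decide), hW1]
    · rw [hF6.na 1 (by decide), hF6.na 2 (by decide)]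
      exact h12

/-- The grid vector nearest to a point of `qSpace` is within `ε / (4 (M + 1))` in each coordinate:
close enough to be kept by the test, and within `ε` after summing over the coordinates. -/
theorem NetUpTo.isSelectedNet {L : ℕ} {ε : ℝ} {t : Fin m} {s : CMem}
    (h : NetUpTo w A L ε t ((2 * L + 1) ^ (2 * M)) s) (hw : 0 < w t.castSucc)
    (hA : ∀ i, opNorm (A t.castSucc i) ≤ w t.castSucc) (hε : 0 ≤ ε)
    (hL : 8 * w t.castSucc * (M + 1) ≤ max (L : ℝ) 1 * ε) :
    IsSelectedNet (A t.castSucc) (w t.castSucc) ε (netOf m M s t) where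
  raw q hq i := by
    classical
    obtain ⟨c, hc, rfl⟩ := Finset.mem_image.1 hq
    obtain ⟨l, hl, -⟩ := h.sound c (Finset.mem_range.1 hc)
    simp only [hl]
    exact norm_gridPoint_le hw.le _ _ _
  covers p hp := by
    classical
    have hp' : ∀ i, ‖p i‖ ≤ w t.castSucc := norm_qVec_le hA hp
    obtain ⟨l, hl, hpl⟩ := exists_gridVec (η := ε / (4 * (M + 1))) hw (L := L) (by
      rw [mul_div_assoc', le_div_iff₀ (by positivity)]
      linarith) hp'
    obtain ⟨c, hc, hcl⟩ := h.complete l hl ⟨p, hp, hpl⟩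
    refine ⟨_, Finset.mem_image.2 ⟨c, Finset.mem_range.2 hc, rfl⟩, ?_⟩
    calc ∑ i : Fin M, ‖p i - s.ca 1 ((c * m + t) * M + i)‖
        ≤ ∑ i : Fin M, ε / (4 * (M + 1)) := Finset.sum_le_sum fun i _ => by rw [hcl]; exact hpl i
      _ = M * (ε / (4 * (M + 1))) := by simp
      _ ≤ ε := by
        rw [mul_div_assoc', div_le_iff₀ (by positivity)]
        nlinarith
  selected q hq := by
    classical
    obtain ⟨c, hc, rfl⟩ := Finset.mem_image.1 hq
    obtain ⟨l, hl, hdis⟩ := h.sound c (Finset.mem_range.1 hc)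
    simpa only [hl] using hdis

/-- The algorithm on complex numbers, the precision being in the complex register `0`. -/
def solveProg : Prog := sizeProg ;; netProg ;; finalProg

theorem solveProg_runs {s : CMem} (hm : 1 ≤ m) (hd0 : 0 < d) (hw : ∀ t, 0 < w t)
    (hA : ∀ t i, opNorm (A t i) ≤ w t) (hδ : 0 < δ) (h0 : s.n 0 = m + 1) (h1 : s.n 1 = d)
    (h2 : s.n 2 = M) (hδ0 : s.c 0 = δ) (hwd : ∀ t : Fin (m + 1), s.wd t = w t)
    (hop : ∀ (t : Fin (m + 1)) (i : Fin M), matAt d (s.ca 0) (t * M + i) = A t i) {L U : ℕ}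
    (hL : L = meshSize (scaleRatio M w δ)) (hd : d + 1 ≤ U) (hM : M + 1 ≤ U) (hLU : L + 1 ≤ U)
    (hmU : m + 1 ≤ U) :
    Runs solveProg s (61000 * U ^ 9 * ((2 * L + 1) ^ (2 * M)) ^ m) fun s' =>
      (∀ t, IsSelectedNet (A t.castSucc) (w t.castSucc) (netEps w δ t) (netOf m M s' t)) ∧
      |(s'.c 8).re - enumOpt A (netOf m M s')| ≤ δ := by
  set K := (2 * L + 1) ^ (2 * M) with hK
  have hK1 : 1 ≤ K := Nat.one_le_pow _ _ (by omega)
  have hW : 0 < ∏ t, w t := Finset.prod_pos fun t _ => hw t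
  have hm' : (1 : ℝ) ≤ m := by exact_mod_cast hm
  have hε : ∀ t, 0 ≤ netEps w δ t := fun t => by
    have := hw t.castSucc
    rw [netEps]
    positivity
  have hmax : ∀ t : Fin m, 8 * w t.castSucc * (M + 1) ≤ max (L : ℝ) 1 * netEps w δ t := fun t => by
    rw [← scaleRatio_mul_netEps hm hw hδ, hL]
    exact mul_le_mul_of_nonneg_right (le_max_meshSize _) (hε t)
  have hmaxL : max (L : ℝ) 1 ≤ L + 1 := max_le (by linarith) (by
    have : (0 : ℝ) ≤ L := Nat.cast_nonneg L
    linarith)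
  -- The mesh parameter also controls the final eigenvalue error, because `8 * m ≥ 3`.
  have herr : 3 * ((M + 1) * ∏ t, w t) ≤ (L + 1) * δ := by
    have h := le_max_meshSize (scaleRatio M w δ)
    rw [← hL] at h
    replace h := h.trans hmaxL
    have h4 : 8 * m * (∏ t, w t) * (M + 1) ≤ (L + 1) * δ := by
      rwa [scaleRatio, div_le_iff₀ hδ] at h
    have h3 : 0 ≤ (∏ t, w t) * (M + 1) := by positivity
    nlinarith
  refine Runs.le (T := 1000 * U * K ^ m + (50000 * U ^ 9 * K + 10000 * U ^ 5 * K ^ m)) ?_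
    (Runs.call_seq (sizeProg_runs hm h0 h2 hδ0 hwd hL hM hLU hmU) fun s1 hF1 ⟨h3, hS1⟩ => ?_)
  · have hKm : K ≤ K ^ m := Nat.le_self_pow (by omega) K
    have p1 : U ≤ U ^ 9 := Nat.le_self_pow (by norm_num) U
    have p2 : U ^ 5 ≤ U ^ 9 := Nat.pow_le_pow_right (by omega) (by norm_num)
    have q1 : U * K ^ m ≤ U ^ 9 * K ^ m := Nat.mul_le_mul_right _ p1
    have q2 : U ^ 5 * K ^ m ≤ U ^ 9 * K ^ m := Nat.mul_le_mul_right _ p2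
    have q3 : U ^ 9 * K ≤ U ^ 9 * K ^ m := Nat.mul_le_mul_left _ hKm
    nlinarith
  have hE1 : Env w A s1 := ⟨(hF1.n 1 (by decide)).trans h1, (hF1.n 2 (by decide)).trans h2, h3,
    fun t => by rw [hF1.wd (by decide)]; exact hwd t,
    fun t i => by rw [hF1.ca 0 (by decide)]; exact hop t i⟩
  refine Runs.call_seq (netProg_runs hE1 hS1 hd hM hLU hmU hd0 hw hA hδ.le fun t =>
    (hmax t).trans (mul_le_mul_of_nonneg_right hmaxL (hε t))) fun s2 hF2 hN => ?_
  have hE2 := hE1.frame hF2 (by decide)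
  have hS2 := hS1.frame hF2 (by decide)
  have hsel : ∀ t, IsSelectedNet (A t.castSucc) (w t.castSucc) (netEps w δ t) (netOf m M s2 t) :=
    fun t => (hN t).isSelectedNet (hw _) (hA _) (hε t) (hmax t)
  have hpos : ∀ t : Fin m, 0 < s2.na 0 t := fun t => by
    classical
    obtain ⟨q, hq⟩ := (hsel t).nonempty hd0
    obtain ⟨c, hc, -⟩ := Finset.mem_image.1 hq
    exact (Nat.zero_le c).trans_lt (Finset.mem_range.1 hc)
  refine (finalProg_runs hE2 hS2 hd hM hLU hmU hd0 hw hA hδ.le (fun t => (hsel t).raw) hpos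
    (fun t => (hN t).le) herr).mono le_rfl ?_
  rintro s3 ⟨g0, g1, g2⟩
  have e : netOf m M s3 = netOf m M s2 := by
    funext t
    simp only [netOf, g0, g1]
  rw [e]
  exact ⟨hsel, g2⟩

/-- The algorithm on the real machine. -/
def enumProg : Prog :=
  .setR 1 (.div (.reg 0) (.ofN (nl 2))) ;; .setR 2 (.ofN (nl 0)) ;; solveProg ;; .setR 0 (.reg 17)

/-- Real register 0 is both the input and output slot and the scratch cell, so `δ / 2` moves to
complex register 0, and the result is copied back from real register 17, the real part of complex
register 8. The complex arrays 0 and 1 already coincide with the input and output arrays. -/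
theorem exists_exec_enumProg {σ : Mem} (hI : IsInput w δ A σ) (hm : 1 ≤ m) (hd0 : 0 < d)
    (hw : ∀ t, 0 < w t) (hA : ∀ t i, opNorm (A t i) ≤ w t) (hδ : 0 < δ) {L U : ℕ}
    (hL : L = meshSize (scaleRatio M w (δ / 2))) (hd : d + 1 ≤ U) (hM : M + 1 ≤ U)
    (hLU : L + 1 ≤ U) (hmU : m + 1 ≤ U) :
    ∃ (T : ℕ) (τ : Mem), Exec enumProg σ T τ ∧
      T ≤ 62000 * U ^ 9 * ((2 * L + 1) ^ (2 * M)) ^ m ∧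
      (∀ t, IsSelectedNet (A t.castSucc) (w t.castSucc) (netEps w (δ / 2) t) (outNet m M τ t)) ∧
      |outOpt τ - enumOpt A (outNet m M τ)| ≤ δ / 2 := by
  set σ' := (σ.setR 1 (δ / 2)).setR 2 0 with hσ'
  have hr : σ'.rarr = σ.rarr := rfl
  obtain ⟨T, τ, h1, h2, h3, h4⟩ := solveProg_runs (s := σ'.toC) hm hd0 hw hA (half_pos hδ)
    hI.parties hI.dimension hI.terms (Complex.ext (by simp [Mem.toC, hσ', Mem.setR])
      (by simp [Mem.toC, hσ', Mem.setR])) hI.widths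
    (fun t i => by
      ext a b
      exact Complex.ext (hI.re_entry t i a b) (hI.im_entry t i a b)) hL hd hM hLU hmU σ' rfl
  have e1 : Exec (.setR 1 (.div (.reg 0) (.ofN (nl 2)))) σ 5 (σ.setR 1 (δ / 2)) := by
    have := Exec.setR σ 1 (.div (.reg 0) (.ofN (nl 2)))
    simpa [RExp.eval, NExp.eval, RExp.cost, NExp.cost, hI.precision] using this
  have e2 : Exec (.setR 2 (.ofN (nl 0))) (σ.setR 1 (δ / 2)) 3 σ' := by
    have := Exec.setR (σ.setR 1 (δ / 2)) 2 (.ofN (nl 0))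
    simpa [RExp.eval, NExp.eval, RExp.cost, NExp.cost] using this
  have e3 : Exec (.setR 0 (.reg 17)) τ 2 (τ.setR 0 (τ.rreg 17)) := Exec.setR τ 0 (.reg 17)
  refine ⟨_, _, .seq e1 (.seq e2 (.seq h1 e3)), ?_, h3, ?_⟩
  · have : 1 * 1 ≤ U ^ 9 * ((2 * L + 1) ^ (2 * M)) ^ m := Nat.mul_le_mul
      (Nat.one_le_pow _ _ (by omega)) (Nat.one_le_pow _ _ (Nat.pow_pos (by omega)))
    nlinarith
  · have : outOpt (τ.setR 0 (τ.rreg 17)) = (τ.toC.c 8).re := by simp [outOpt, Mem.setR, Mem.toC]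
    rw [this]
    exact h4

end

end RealRAM

/-! ## The running time -/

namespace RealRAM

/-- For `y > 1` the base satisfies `2 L + 1 < 2 y + 3 ≤ 5 y`, and `M + 1 ≤ 2 M` gives `y ≤ 32 m W M
/ δ`; the constant is `(5 * 32) ^ 2`. -/
theorem mesh_sq_le {m M : ℕ} {W δ : ℝ} (hm : 1 ≤ m) (hM : 1 ≤ M) (hW : 0 < W) (hδ : 0 < δ) :
    (2 * (meshSize (8 * m * W * (M + 1) / (δ / 2)) : ℝ) + 1) ^ 2 ≤
      max 1 (25600 * ((m : ℝ) ^ 2 * W ^ 2 * (M : ℝ) ^ 2 / δ ^ 2)) := by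
  have hm' : (1 : ℝ) ≤ m := by exact_mod_cast hm
  have hM' : (1 : ℝ) ≤ M := by exact_mod_cast hM
  set y := 8 * m * W * (M + 1) / (δ / 2) with hy
  have hy0 : 0 < y := by positivity
  rcases le_or_gt y 1 with h | h
  · have : meshSize y = 0 := if_pos h
    rw [this]
    refine le_max_of_le_left ?_
    norm_num
  · refine le_max_of_le_right ?_
    have h1 := meshSize_lt hy0
    have h2 : y ≤ 32 * (m * W * M / δ) := by
      have e : y = 16 * (m * W * (M + 1) / δ) := by
        rw [hy]
        field_simp
        norm_num
      have : m * W * (M + 1) / δ ≤ 2 * (m * W * M / δ) := by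
        rw [mul_div_assoc', div_le_div_iff_of_pos_right hδ]
        have : 0 < m * W := by positivity
        nlinarith
      linarith
    calc (2 * (meshSize y : ℝ) + 1) ^ 2 ≤ (5 * (32 * (m * W * M / δ))) ^ 2 := by
          refine pow_le_pow_left₀ (by positivity) ?_ 2
          linarith
      _ = 25600 * ((m : ℝ) ^ 2 * W ^ 2 * (M : ℝ) ^ 2 / δ ^ 2) := by
          field_simp
          norm_num

/-- The mesh parameter is a product of four quantities at most `X`, up to constants, so the size
parameter is at most `17 X ^ 4`; its ninth power explains the exponent 36 and the constant. -/
theorem exists_steps_le : ∃ C : ℕ, 1 ≤ C ∧ ∀ (m d M : ℕ) (W δ : ℝ) (L T : ℕ), 1 ≤ m → 1 ≤ d →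
    0 < W → 0 < δ → L = meshSize (8 * m * W * (M + 1) / (δ / 2)) →
    T ≤ 62000 * (d + M + m + L + 1) ^ 9 * ((2 * L + 1) ^ (2 * M)) ^ m →
    (T : ℝ) ≤ C * max 1 (C * ((m : ℝ) ^ 2 * W ^ 2 * (M : ℝ) ^ 2 / δ ^ 2)) ^ (m * M) *
      ((d : ℝ) + M + (m + 1) + W + 1 / δ) ^ 36 := by
  refine ⟨62000 * 17 ^ 9, by norm_num, fun m d M W δ L T hm hd hW hδ hL => ?_⟩
  have hm' : (1 : ℝ) ≤ m := by exact_mod_cast hm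
  have hd' : (1 : ℝ) ≤ d := by exact_mod_cast hd
  have hM' : (0 : ℝ) ≤ M := Nat.cast_nonneg M
  have hδ' : 0 < 1 / δ := by positivity
  set X := (d : ℝ) + M + (m + 1) + W + 1 / δ with hX
  set x := (m : ℝ) ^ 2 * W ^ 2 * (M : ℝ) ^ 2 / δ ^ 2 with hx
  have hx0 : 0 ≤ x := by positivity
  have hX3 : 3 ≤ X := by linarith
  have hXm : m ≤ X ∧ W ≤ X ∧ (M : ℝ) + 1 ≤ X ∧ 1 / δ ≤ X ∧ (d : ℝ) + M + m + 1 ≤ X := by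
    refine ⟨?_, ?_, ?_, ?_, ?_⟩ <;> linarith
  obtain ⟨x1, x2, x3, x4, x5⟩ := hXm
  clear_value X
  have hU : ((d + M + m + L + 1 : ℕ) : ℝ) ≤ 17 * X ^ 4 := by
    have h1 : (L : ℝ) < 16 * (m * W * (M + 1) * (1 / δ)) + 1 := by
      rw [hL]
      refine (meshSize_lt (by positivity)).trans_eq ?_
      field_simp
      ring
    have h2 : m * W * (M + 1) * (1 / δ) ≤ X * X * X * X := by
      gcongr
    have h3 : X + 1 ≤ X ^ 4 := by nlinarith [pow_le_pow_left₀ (by norm_num) hX3 3]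
    push_cast
    have h4 : X * X * X * X = X ^ 4 := by ring
    linarith
  have hK : ((((2 * L + 1) ^ (2 * M)) ^ m : ℕ) : ℝ) ≤
      max 1 ((62000 * 17 ^ 9 : ℕ) * x) ^ (m * M) := by
    rcases Nat.eq_zero_or_pos M with rfl | hM
    · simp
    · have e : (((2 * L + 1) ^ (2 * M)) ^ m : ℕ) = ((2 * L + 1) ^ 2) ^ (m * M) := by
        rw [← pow_mul, ← pow_mul]
        congr 1
        ring
      rw [e]
      push_cast
      refine pow_le_pow_left₀ (by positivity) ?_ _
      rw [hL]
      refine (mesh_sq_le hm hM hW hδ).trans (max_le_max le_rfl ?_)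
      exact mul_le_mul_of_nonneg_right (by norm_num) hx0
  intro hT
  calc (T : ℝ) ≤ ((62000 * (d + M + m + L + 1) ^ 9 * ((2 * L + 1) ^ (2 * M)) ^ m : ℕ) : ℝ) :=
        Nat.cast_le.2 hT
    _ = 62000 * ((d + M + m + L + 1 : ℕ) : ℝ) ^ 9 * ((((2 * L + 1) ^ (2 * M)) ^ m : ℕ) : ℝ) := by
        rw [Nat.cast_mul, Nat.cast_mul, Nat.cast_pow (d + M + m + L + 1) 9, Nat.cast_ofNat]
    _ ≤ 62000 * (17 * X ^ 4) ^ 9 * max 1 ((62000 * 17 ^ 9 : ℕ) * x) ^ (m * M) := by gcongr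
    _ = _ := by
        generalize max 1 ((62000 * 17 ^ 9 : ℕ) * x) ^ (m * M) = F
        rw [mul_pow, ← pow_mul]
        push_cast
        ring

theorem one_lt_log_three : 1 < Real.log 3 := by
  rw [Real.lt_log_iff_exp_lt (by norm_num)]
  linarith [Real.exp_one_lt_d9]

/-- The bound is quasi-polynomial when the number of terms times the number of parties is
polylogarithmic in the dimension. -/
theorem exists_steps_le_exp (C c a : ℕ) (hC : 1 ≤ C) :
    ∃ b : ℕ, ∀ (m d M : ℕ) (W δ T : ℝ), 1 ≤ m → 1 ≤ d → 1 ≤ M → 0 < W → 0 < δ →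
      ((m : ℝ) + 1) * M ≤ Real.log (d + 2) ^ a →
      T ≤ C * max 1 (C * ((m : ℝ) ^ 2 * W ^ 2 * (M : ℝ) ^ 2 / δ ^ 2)) ^ (m * M) *
        ((d : ℝ) + M + (m + 1) + W + 1 / δ) ^ c →
      T ≤ Real.exp (Real.log (d + W + 1 / δ + 2) ^ b) := by
  -- The exponent will be at most a constant times `l ^ (a + 1)`. Since `l ≥ log 3 > 1`, the
  -- constant is absorbed in a further power `l ^ n` with `n` independent of the input.
  obtain ⟨n, hn⟩ := pow_unbounded_of_one_lt
    ((C : ℝ) + (C + 8 * (a + 2)) + c * (a + 2)) one_lt_log_three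
  refine ⟨a + 1 + n, fun m d M W δ T hm hd hM hW hδ hk hT => hT.trans ?_⟩
  have hm' : (1 : ℝ) ≤ m := by exact_mod_cast hm
  have hd' : (1 : ℝ) ≤ d := by exact_mod_cast hd
  have hM' : (1 : ℝ) ≤ M := by exact_mod_cast hM
  have hC' : (1 : ℝ) ≤ C := by exact_mod_cast hC
  have hδ' : 0 < 1 / δ := by positivity
  set Z := d + W + 1 / δ + 2 with hZ
  have hZ3 : 3 ≤ Z := by linarith
  set l := Real.log Z with hl
  have hl3 : Real.log 3 ≤ l := Real.log_le_log (by norm_num) hZ3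
  have hl1 : 1 ≤ l := one_lt_log_three.le.trans hl3
  have hexp : Real.exp l = Z := Real.exp_log (by linarith)
  have hla : 1 ≤ l ^ a := one_le_pow₀ hl1
  have hk' : ((m : ℝ) + 1) * M ≤ l ^ a := hk.trans (pow_le_pow_left₀ (Real.log_nonneg (by linarith))
    (Real.log_le_log (by linarith) (by linarith)) a)
  have hexpn : ∀ j : ℕ, Real.exp (j * l) = Z ^ j := fun j => by rw [Real.exp_nat_mul, hexp]
  have hlZ : l ^ a ≤ Z ^ a :=
    pow_le_pow_left₀ (by linarith)
      ((Real.log_le_sub_one_of_pos (by linarith)).trans (by linarith)) a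
  have hZa : 1 ≤ Z ^ a := one_le_pow₀ (by linarith)
  set X := (d : ℝ) + M + (m + 1) + W + 1 / δ with hX
  have hX1 : 1 ≤ X := by linarith
  have hXm : m ≤ X ∧ W ≤ X ∧ (M : ℝ) ≤ X ∧ 1 / δ ≤ X := by
    refine ⟨?_, ?_, ?_, ?_⟩ <;> linarith
  obtain ⟨x1, x2, x3, x4⟩ := hXm
  -- The number of parties and `M` do not occur in `Z`; each is at most `l ^ a ≤ Z ^ a` by the
  -- polylogarithmic hypothesis.
  have hXZ : X ≤ Z ^ (a + 2) := by
    have h1 : (m + 1 : ℝ) ≤ Z ^ a := le_trans (le_mul_of_one_le_right (by linarith) hM')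
      (hk'.trans hlZ)
    have h2 : (M : ℝ) ≤ Z ^ a := le_trans (le_mul_of_one_le_left (by linarith) (by linarith))
      (hk'.trans hlZ)
    have h3 : X ≤ Z + 2 * Z ^ a := by linarith
    have h4 : Z ^ (a + 2) = Z ^ a * (Z * Z) := by ring
    have h5 : Z + 2 ≤ Z * Z :=
      le_trans (by linarith) (mul_le_mul_of_nonneg_right hZ3 (by linarith))
    have h6 : Z ^ a * (Z + 2) ≤ Z ^ a * (Z * Z) := by gcongr
    have h7 : 1 * Z ≤ Z ^ a * Z := by gcongr
    linarith
  clear_value X l Z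
  have hx : (m : ℝ) ^ 2 * W ^ 2 * (M : ℝ) ^ 2 / δ ^ 2 ≤ X ^ 8 := by
    have e : (m : ℝ) ^ 2 * W ^ 2 * (M : ℝ) ^ 2 / δ ^ 2 = m ^ 2 * W ^ 2 * M ^ 2 * (1 / δ) ^ 2 := by
      field_simp
    have e' : X ^ 8 = X ^ 2 * X ^ 2 * X ^ 2 * X ^ 2 := by ring
    rw [e, e']
    gcongr
  have hCexp : (C : ℝ) ≤ Real.exp (C * l) := by
    have h1 := Real.add_one_le_exp (C * l)
    have h2 : (C : ℝ) ≤ C * l := le_mul_of_one_le_right (by linarith) hl1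
    linarith
  have hXexp : X ≤ Real.exp (((a + 2 : ℕ) : ℝ) * l) := by rwa [hexpn]
  have hmax : max 1 (C * ((m : ℝ) ^ 2 * W ^ 2 * (M : ℝ) ^ 2 / δ ^ 2)) ≤
      Real.exp ((C + 8 * (a + 2)) * l) := by
    refine max_le (Real.one_le_exp (by positivity)) ?_
    calc C * ((m : ℝ) ^ 2 * W ^ 2 * (M : ℝ) ^ 2 / δ ^ 2) ≤ Real.exp (C * l) *
          Real.exp (((a + 2 : ℕ) : ℝ) * l) ^ 8 := by
          refine mul_le_mul hCexp (hx.trans ?_) (by positivity) (by positivity)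
          exact pow_le_pow_left₀ (by linarith) hXexp 8
      _ = Real.exp ((C + 8 * (a + 2)) * l) := by
          rw [← Real.exp_nat_mul, ← Real.exp_add]
          congr 1
          push_cast
          ring
  have hmM : ((m * M : ℕ) : ℝ) ≤ l ^ a := by
    push_cast
    linarith
  calc C * max 1 (C * ((m : ℝ) ^ 2 * W ^ 2 * (M : ℝ) ^ 2 / δ ^ 2)) ^ (m * M) * X ^ c
      ≤ Real.exp (C * l) * Real.exp ((C + 8 * (a + 2)) * l) ^ (m * M) *
        Real.exp (((a + 2 : ℕ) : ℝ) * l) ^ c := by gcongr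
    _ = Real.exp (C * l + (m * M : ℕ) * ((C + 8 * (a + 2)) * l) + c * ((a + 2) * l)) := by
        rw [← Real.exp_nat_mul, ← Real.exp_nat_mul, ← Real.exp_add, ← Real.exp_add]
        push_cast
        rfl
    _ ≤ Real.exp (l ^ (a + 1 + n)) := by
        refine Real.exp_le_exp.2 ?_
        have hln : (C : ℝ) + (C + 8 * (a + 2)) + c * (a + 2) ≤ l ^ n :=
          hn.le.trans (pow_le_pow_left₀ (by linarith [one_lt_log_three]) hl3 n)
        calc C * l + (m * M : ℕ) * ((C + 8 * (a + 2)) * l) + c * ((a + 2) * l)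
            ≤ (l ^ a * C) * l + l ^ a * ((C + 8 * (a + 2)) * l) + (l ^ a * c) * ((a + 2) * l) := by
              gcongr
              · exact le_mul_of_one_le_left (by positivity) hla
              · exact le_mul_of_one_le_left (by positivity) hla
          _ = l ^ (a + 1) * ((C : ℝ) + (C + 8 * (a + 2)) + c * (a + 2)) := by ring
          _ ≤ l ^ (a + 1) * l ^ n := by gcongr
          _ = l ^ (a + 1 + n) := by ring

end RealRAM

theorem IsSelectedNet.mono {d M : ℕ} {B : Fin M → Matrix (Fin d) (Fin d) ℂ} {w ε ε' : ℝ}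
    {N : Finset (Fin M → ℂ)} (h : IsSelectedNet B w ε N) (hε : ε ≤ ε') :
    IsSelectedNet B w ε' N where
  raw := h.raw
  covers p hp := (h.covers p hp).imp fun _ h => ⟨h.1, h.2.trans hε⟩
  selected q hq := (h.selected q hq).trans hε

theorem theorem3p1 :
    -- the enumeration algorithm, in exact arithmetic and with any nets of the prescribed
    -- precisions, is correct to within `δ`
    (∀ (m d M : ℕ) (w : Fin (m + 1) → ℝ) (δ : ℝ)
        (A : Fin (m + 1) → Fin M → Matrix (Fin d) (Fin d) ℂ) (Q : MultiOp (m + 1) d),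
        1 ≤ m → 1 ≤ d → (∀ t, 0 < w t) → 0 < δ → Q.IsHermitian → IsDecomposition w A Q →
      IsGreatest (productValues Q) (optSep Q) ∧
      ∀ N : Fin m → Finset (Fin M → ℂ),
        (∀ t, IsSelectedNet (A t.castSucc) (w t.castSucc) (netEps w δ t) (N t)) →
        |enumOpt A N - optSep Q| ≤ δ) ∧
    -- one real-RAM program carries it out within the time bound
    (∃ (P : RealRAM.Prog) (C c : ℕ) (b : ℕ → ℕ),
      ∀ (m d M : ℕ) (w : Fin (m + 1) → ℝ) (δ : ℝ)
        (A : Fin (m + 1) → Fin M → Matrix (Fin d) (Fin d) ℂ) (Q : MultiOp (m + 1) d),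
        1 ≤ m → 1 ≤ d → (∀ t, 0 < w t) → 0 < δ → Q.IsHermitian → IsDecomposition w A Q →
      ∀ σ : RealRAM.Mem, RealRAM.IsInput w δ A σ →
      ∃ (T : ℕ) (τ : RealRAM.Mem), RealRAM.Exec P σ T τ ∧
        -- the nets it has generated
        (∀ t, IsSelectedNet (A t.castSucc) (w t.castSucc) (netEps w δ t)
          (RealRAM.outNet m M τ t)) ∧
        -- the returned value: the maximum over these nets, up to the numerical error in the
        -- eigenvalues, and within `δ` of the optimum
        |RealRAM.outOpt τ - enumOpt A (RealRAM.outNet m M τ)| ≤ δ / 2 ∧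
        |RealRAM.outOpt τ - optSep Q| ≤ δ ∧
        -- the running time
        (T : ℝ) ≤ C * max 1 (C * ((m : ℝ) ^ 2 * (∏ t, w t) ^ 2 * (M : ℝ) ^ 2 / δ ^ 2)) ^ (m * M) *
          ((d : ℝ) + M + (m + 1) + (∏ t, w t) + 1 / δ) ^ c ∧
        -- it is quasi-polynomial when `k M` is polylogarithmic in `d`
        (∀ a : ℕ, 1 ≤ M → ((m : ℝ) + 1) * M ≤ Real.log (d + 2) ^ a →
          (T : ℝ) ≤ Real.exp (Real.log (d + (∏ t, w t) + 1 / δ + 2) ^ b a))) := by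
  refine ⟨fun m d M w δ A Q hm hd hw _ _ hQ =>
    ⟨isGreatest_optSep hd Q, fun N hN => abs_enumOpt_sub_optSep_le hm hd hw hQ hN⟩, ?_⟩
  obtain ⟨C, hC, hsteps⟩ := RealRAM.exists_steps_le
  choose b hb using fun a => RealRAM.exists_steps_le_exp C 36 a hC
  refine ⟨RealRAM.enumProg, C, 36, b, ?_⟩
  intro m d M w δ A Q hm hd hw hδ _ hQ σ hσ
  have hW : 0 < ∏ t, w t := Finset.prod_pos fun t _ => hw t
  obtain ⟨L, hL⟩ : ∃ L, L = RealRAM.meshSize (RealRAM.scaleRatio M w (δ / 2)) := ⟨_, rfl⟩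
  -- The run produces nets of precision `netEps w (δ / 2)`, finer than required. Correctness for
  -- them costs `δ / 2`, leaving the other half for the numerical error.
  obtain ⟨T, τ, h1, h2, h3, h4⟩ := RealRAM.exists_exec_enumProg hσ hm hd hw hQ.2 hδ hL
    (U := d + M + m + L + 1) (by omega) (by omega) (by omega) (by omega)
  have hT := hsteps m d M _ δ L T hm hd hW hδ hL h2
  refine ⟨T, τ, h1, fun t => (h3 t).mono ?_, h4, ?_, hT,
    fun a hM ha => hb a m d M _ δ T hm hd hM hW hδ ha hT⟩
  · have := hw t.castSucc
    unfold netEps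
    gcongr
    exact half_le_self hδ.le
  · have h5 := abs_enumOpt_sub_optSep_le hm hd hw hQ h3
    rw [abs_le] at h4 h5 ⊢
    constructor <;> linarith only [h4.1, h4.2, h5.1, h5.2]
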